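/- **Conventions.** For an ordinal $\alpha\le\omega$ let $\mathsf{Sc}_\alpha,\mathsf{CA}_\alpha,\mathsf{QA}_\alpha,\mathsf{QEA}_\alpha$ denote the classes of (Pinter's) substitution algebras, cylindric algebras, quasi-polyadic algebras and quasi-polyadic equality algebras of dimension $\alpha$, and for finite $n$ let $\mathsf{PEA}_n$ be the class of polyadic equality algebras of dimension $n$. These are Boolean algebras with the following extra operations, satisfying the usual equations: $\mathsf{Sc}$: cylindrifications $\mathsf c_i$ and replacements $\mathsf s_{[i/j]}$; $\mathsf{CA}$: $\mathsf c_i$ and diagonals $\mathsf d_{ij}$; $\mathsf{QA}$: $\mathsf c_i$, $\mathsf s_{[i/j]}$ and transpositions $\mathsf s_{[i,j]}$; $\mathsf{QEA}$: those of $\mathsf{QA}$ and $\mathsf d_{ij}$; $\mathsf{PEA}_n$: $\mathsf c_i$, $\mathsf d_{ij}$ and $\mathsf s_\tau$ for all $\tau:n\to n$ (here $i,j<\alpha$, resp. $i,j<n$). $\mathrm{Rd}_{\mathsf{Sc}}$ and $\mathrm{Rd}_{\mathsf{QEA}}$ denote the reducts of a $\mathsf{PEA}_n$ to the similarity types of $\mathsf{Sc}_n$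 and $\mathsf{QEA}_n$. For $n\le m\le\omega$ and an $m$-dimensional algebra $\mathfrak C$, the neat reduct $\mathrm{Nr}_n\mathfrak C$ is the $n$-dimensional algebra on $\{x\in\mathfrak C:\mathsf c_i x=x\text{ for all } n\le i<m\}$ with the operations of $\mathfrak C$ whose indices are below $n$. For a class $\mathsf L$ of $m$-dimensional algebras, $S_c\mathrm{Nr}_n\mathsf L$ is the class of all algebras $\mathfrak A$ that have an embedding $f$ into $\mathrm{Nr}_n\mathfrak C$ for some $\mathfrak C\in\mathsf L$ such that whenever $a$ is the supremum of $X\subseteq\mathfrak A$ in $\mathfrak A$, $f(a)$ is the supremum of $f[X]$ in $\mathrm{Nr}_n\mathfrak C$. An $n$-dimensional algebra $\mathfrak A$ is completely representable if there are pairwise disjoint sets $U_i$ $(i\in I)$ and an embedding $f$ of $\mathfrak A$ into the full set algebra $\wp(V)$, $V=\bigcup_{i\in I}{}^nU_i$, whose operations are the concrete ones, such that $f(a)=\bigcup_{x\in X}f(x)$ whenever $a$ is the supremum of $X\subseteq\mathfrak A$ in $\mathfrak A$. A class of algebras is elementary if it is the class of all models of a set of first-order sentences; $\equiv$ is elementary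 equivalence. **Theorem.** Let $3\le n<\omega$. 1. There is an atomic $\mathfrak A\in\mathsf{PEA}_n$ with countably many atoms such that $\mathrm{Rd}_{\mathsf{Sc}}\mathfrak A\notin S_c\mathrm{Nr}_n\mathsf{Sc}_{n+3}$, and there is a countable (atomic) $\mathfrak B\in\mathsf{PEA}_n$ with $\mathrm{Rd}_{\mathsf{QEA}}\mathfrak B\in S_c\mathrm{Nr}_n\mathsf{QEA}_\omega$ and $\mathfrak A\equiv\mathfrak B$ (in the language of $\mathsf{PEA}_n$). 2. No class $\mathsf K$ with $S_c\mathrm{Nr}_n\mathsf{CA}_\omega\subseteq\mathsf K\subseteq S_c\mathrm{Nr}_n\mathsf{CA}_{n+3}$ is elementary. 3. For each $\mathsf L\in\{\mathsf{CA},\mathsf{QA},\mathsf{QEA},\mathsf{Sc}\}$, the class of completely representable algebras of the type of $\mathsf L_n$ is not elementary. -/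

import Mathlib

universe u

namespace CylAlg

open scoped FirstOrder

/-! ## Similarity types -/

/-- The five similarity types of Boolean algebras with operators: Pinter's substitution algebras,
cylindric algebras, quasi-polyadic algebras, quasi-polyadic equality algebras, and polyadic
equality algebras. -/
inductive Kind : Type
  | Sc
  | CA
  | QA
  | QEA
  | PEA

/-- The similarity type contains the replacement operators `s_[i/j]`. -/
def Kind.HasRepl : Kind → Prop
  | .Sc | .QA | .QEA => True
  | .CA | .PEA => False

/-- The similarity type contains the transposition operators `s_[i,j]`. -/
def Kind.HasSwap : Kind → Prop
  | .QA | .QEA => True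
  | .Sc | .CA | .PEA => False

/-- The similarity type contains the substitution operators `s_τ` for all `τ : α → α`. -/
def Kind.HasSub : Kind → Prop
  | .PEA => True
  | .Sc | .CA | .QA | .QEA => False

/-- The similarity type contains the diagonal constants `d_ij`. -/
def Kind.HasDiag : Kind → Prop
  | .CA | .QEA | .PEA => True
  | .Sc | .QA => False

/-- Unary non-Boolean operation symbols, with dimensions (indices) taken from `α`. -/
inductive UnOp (K : Kind) (α : Type) : Type
  | cyl (i : α)
  | repl (h : K.HasRepl) (i j : α)
  | swap (h : K.HasSwap) (i j : α)
  | sub (h : K.HasSub) (τ : α → α)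

/-- Non-Boolean constant symbols. -/
inductive NulOp (K : Kind) (α : Type) : Type
  | diag (h : K.HasDiag) (i j : α)

/-- All operation symbols, indexed by arity. -/
inductive Fn (K : Kind) (α : Type) : ℕ → Type
  | bot : Fn K α 0
  | top : Fn K α 0
  | nul (o : NulOp K α) : Fn K α 0
  | compl : Fn K α 1
  | una (o : UnOp K α) : Fn K α 1
  | sup : Fn K α 2
  | inf : Fn K α 2

/-- The first-order language of the algebras of type `K` and dimension `α`. -/
def lang (K : Kind) (α : Type) : FirstOrder.Language.{0, 0} where
  Functions := Fn K α
  Relations := fun _ => Empty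

/-! ## Algebras -/

/-- A Boolean algebra with extra operations of type `K` and dimension `α` (no axioms on the
extra operations yet). -/
structure Alg (K : Kind) (α : Type) : Type (u + 1) where
  carrier : Type u
  [ba : BooleanAlgebra carrier]
  una : UnOp K α → carrier → carrier
  nul : NulOp K α → carrier

instance (K : Kind) (α : Type) : CoeSort (Alg.{u} K α) (Type u) := ⟨Alg.carrier⟩

attribute [instance] Alg.ba

/-- An algebra as a first-order structure. -/
instance (K : Kind) (α : Type) (A : Alg.{u} K α) : (lang K α).Structure A where
  funMap := fun {_} o => match o with
    | .bot => fun _ => ⊥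
    | .top => fun _ => ⊤
    | .nul o => fun _ => A.nul o
    | .compl => fun v => (v 0)ᶜ
    | .una o => fun v => A.una o (v 0)
    | .sup => fun v => v 0 ⊔ v 1
    | .inf => fun v => v 0 ⊓ v 1
  RelMap := fun r => r.elim

/-- A class of algebras is elementary if it is the class of all models (among the Boolean algebras
with operators of the given type) of some set of first-order sentences. -/
def IsElementary {K : Kind} {α : Type} (𝒦 : Set (Alg.{u} K α)) : Prop :=
  ∃ T : (lang K α).Theory, ∀ A : Alg.{u} K α, A ∈ 𝒦 ↔ (A : Type u) ⊨ T

/-- The replacement `[i/j]`: the identity, except that `i` is mapped to `j`. -/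
def replace {α : Type} [DecidableEq α] (i j : α) : α → α := Function.update id i j

/-! ## The equations defining the classes -/

section Axioms

variable {α : Type} {A : Type u} [BooleanAlgebra A]

/-- The `c i` are commuting quantifiers. -/
structure QuantifierAxioms (c : α → A → A) : Prop where
  cyl_bot : ∀ i, c i ⊥ = ⊥
  le_cyl : ∀ i x, x ≤ c i x
  cyl_inf_cyl : ∀ i x y, c i (x ⊓ c i y) = c i x ⊓ c i y
  cyl_comm : ∀ i j x, c i (c j x) = c j (c i x)

/-- `f` is a Boolean endomorphism. -/
structure IsBoolEndo (f : A → A) : Prop where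
  map_sup : ∀ x y, f (x ⊔ y) = f x ⊔ f y
  map_compl : ∀ x, f xᶜ = (f x)ᶜ

/-- Substitution algebras; `s i j` is `s_[i/j]`. -/
structure ScAxioms (c : α → A → A) (s : α → α → A → A) : Prop extends QuantifierAxioms c where
  repl_self : ∀ i x, s i i x = x
  repl_endo : ∀ i j, IsBoolEndo (s i j)
  repl_cyl : ∀ i j x, s i j (c i x) = c i x
  cyl_repl : ∀ i j x, i ≠ j → c i (s i j x) = s i j x
  repl_cyl_comm : ∀ i j k x, k ≠ i → k ≠ j → s i j (c k x) = c k (s i j x)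
  cyl_repl_symm : ∀ i j x, c i (s j i x) = c j (s i j x)
  repl_comm : ∀ i j k l x, [i, j, k, l].Nodup → s j i (s l k x) = s l k (s j i x)
  repl_repl : ∀ i j l x, s l i (s j l x) = s l i (s j i x)

/-- Cylindric algebras. -/
structure CAAxioms (c : α → A → A) (d : α → α → A) : Prop extends QuantifierAxioms c where
  diag_self : ∀ i, d i i = ⊤
  diag_eq_cyl : ∀ i j k, k ≠ i → k ≠ j → d i j = c k (d i k ⊓ d k j)
  cyl_diag_disjoint : ∀ i j x, i ≠ j → c i (d i j ⊓ x) ⊓ c i (d i j ⊓ xᶜ) = ⊥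

/-- Quasi-polyadic algebras; `s i j` is `s_[i/j]` and `p i j` is `s_[i,j]`. -/
structure QAAxioms (c : α → A → A) (s p : α → α → A → A) : Prop where
  repl_self : ∀ i x, s i i x = x
  swap_self : ∀ i x, p i i x = x
  swap_symm : ∀ i j x, p i j x = p j i x
  le_cyl : ∀ i x, x ≤ c i x
  cyl_sup : ∀ i x y, c i (x ⊔ y) = c i x ⊔ c i y
  repl_cyl : ∀ i j x, s i j (c i x) = c i x
  cyl_repl : ∀ i j x, i ≠ j → c i (s i j x) = s i j x
  repl_cyl_comm : ∀ i j k x, k ≠ i → k ≠ j → s i j (c k x) = c k (s i j x)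
  repl_endo : ∀ i j, IsBoolEndo (s i j)
  swap_endo : ∀ i j, IsBoolEndo (p i j)
  swap_swap : ∀ i j x, p i j (p i j x) = x
  swap_braid : ∀ i j k x, [i, j, k].Nodup → p i j (p i k x) = p j k (p i j x)
  swap_repl : ∀ i j x, p i j (s i j x) = s j i x

/-- Quasi-polyadic equality algebras. -/
structure QEAAxioms (c : α → A → A) (s p : α → α → A → A) (d : α → α → A) : Prop
    extends QAAxioms c s p where
  repl_diag : ∀ i j, s i j (d i j) = ⊤
  inf_diag_le : ∀ i j x, x ⊓ d i j ≤ s i j x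

/-- Polyadic equality algebras of finite dimension; `t τ` is `s_τ`. Since the dimension is finite,
Halmos' axioms on the quantifiers `c_(Γ)` reduce to the case of singletons `Γ`. -/
structure PEAAxioms [DecidableEq α] (c : α → A → A) (t : (α → α) → A → A) (d : α → α → A) : Prop
    extends QuantifierAxioms c where
  sub_id : ∀ x, t id x = x
  sub_comp : ∀ σ τ x, t (σ ∘ τ) x = t σ (t τ x)
  sub_endo : ∀ τ, IsBoolEndo (t τ)
  sub_cyl_congr : ∀ σ τ i x, (∀ k, k ≠ i → σ k = τ k) → t σ (c i x) = t τ (c i x)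
  cyl_sub_of_singleton : ∀ τ i j x, τ ⁻¹' {i} = {j} → c i (t τ x) = t τ (c j x)
  cyl_sub_of_empty : ∀ τ i x, τ ⁻¹' {i} = ∅ → c i (t τ x) = t τ x
  diag_self : ∀ i, d i i = ⊤
  inf_diag_le : ∀ i j x, x ⊓ d i j ≤ t (replace i j) x
  sub_diag : ∀ τ i j, t τ (d i j) = d (τ i) (τ j)

end Axioms

/-- The class `Sc_α`. -/
def Sc (α : Type) : Set (Alg.{u} .Sc α) :=
  {A | ScAxioms (fun i => A.una (.cyl i)) (fun i j => A.una (.repl trivial i j))}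

/-- The class `CA_α`. -/
def CA (α : Type) : Set (Alg.{u} .CA α) :=
  {A | CAAxioms (fun i => A.una (.cyl i)) (fun i j => A.nul (.diag trivial i j))}

/-- The class `QEA_α`. -/
def QEA (α : Type) : Set (Alg.{u} .QEA α) :=
  {A | QEAAxioms (fun i => A.una (.cyl i)) (fun i j => A.una (.repl trivial i j))
    (fun i j => A.una (.swap trivial i j)) (fun i j => A.nul (.diag trivial i j))}

/-- The class `PEA_n` for finite `n`. -/
def PEA (n : ℕ) : Set (Alg.{u} .PEA (Fin n)) :=
  {A | PEAAxioms (fun i => A.una (.cyl i)) (fun τ => A.una (.sub trivial τ))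
    (fun i j => A.nul (.diag trivial i j))}

/-! ## Reducts -/

/-- The algebra with the same Boolean part in which the operation symbols are interpreted through
a translation into the symbols of `A`. -/
def Alg.reduct {K K' : Kind} {α β : Type} (A : Alg.{u} K α)
    (f : UnOp K' β → UnOp K α) (g : NulOp K' β → NulOp K α) : Alg.{u} K' β where
  carrier := A
  una := fun o => A.una (f o)
  nul := fun o => A.nul (g o)

/-- The `Sc` reduct of a `PEA`-type algebra. -/
def Alg.rdSc {α : Type} [DecidableEq α] (A : Alg.{u} .PEA α) : Alg.{u} .Sc α :=
  A.reduct
    (fun o => match o with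
      | .cyl i => .cyl i
      | .repl _ i j => .sub trivial (replace i j)
      | .swap h _ _ => h.elim
      | .sub h _ => h.elim)
    (fun o => match o with
      | .diag h _ _ => h.elim)

/-- The `QEA` reduct of a `PEA`-type algebra. -/
def Alg.rdQEA {α : Type} [DecidableEq α] (A : Alg.{u} .PEA α) : Alg.{u} .QEA α :=
  A.reduct
    (fun o => match o with
      | .cyl i => .cyl i
      | .repl _ i j => .sub trivial (replace i j)
      | .swap _ i j => .sub trivial (Equiv.swap i j)
      | .sub h _ => h.elim)
    (fun o => match o with
      | .diag _ i j => .diag trivial i j)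

/-- The reduct `Rd^ρ` to the dimensions in the range of an injection `ρ : α → β`. -/
noncomputable def Alg.rdDim {K : Kind} {α β : Type} (ρ : α ↪ β) (A : Alg.{u} K β) : Alg.{u} K α :=
  A.reduct
    (fun o => match o with
      | .cyl i => .cyl (ρ i)
      | .repl h i j => .repl h (ρ i) (ρ j)
      | .swap h i j => .swap h (ρ i) (ρ j)
      | .sub h τ => .sub h (Function.extend ρ (ρ ∘ τ) id))
    (fun o => match o with
      | .diag h i j => .diag h (ρ i) (ρ j))

/-! ## Embeddings, neat reducts, `S_c Nr` -/

/-- `f` is an injective homomorphism. -/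
structure IsEmbedding {K : Kind} {α : Type} {A B : Alg.{u} K α} (f : A → B) : Prop where
  injective : Function.Injective f
  map_bot : f ⊥ = ⊥
  map_top : f ⊤ = ⊤
  map_sup : ∀ x y, f (x ⊔ y) = f x ⊔ f y
  map_inf : ∀ x y, f (x ⊓ y) = f x ⊓ f y
  map_compl : ∀ x, f xᶜ = (f x)ᶜ
  map_una : ∀ o x, f (A.una o x) = B.una o (f x)
  map_nul : ∀ o, f (A.nul o) = B.nul o

/-- The universe of the neat reduct `Nr_α C` along `ρ : α → β`: the elements fixed by every
cylindrification `c_i` with `i` outside the range of `ρ`. It is a subset of `Rd^ρ C`. -/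
def nr {K : Kind} {α β : Type} (ρ : α ↪ β) (C : Alg.{u} K β) : Set (C.rdDim ρ) :=
  {x | ∀ i, i ∉ Set.range ρ → C.una (.cyl i) x = x}

/-- The class `S_c Nr_α 𝒦`: the algebras `A` that embed into the neat reduct `Nr_α C` of some
`C ∈ 𝒦` as a complete subalgebra, that is, every supremum that exists in `A` is a supremum in
`Nr_α C` as well. -/
def ScNr {K : Kind} {α β : Type} (ρ : α ↪ β) (𝒦 : Set (Alg.{u} K β)) : Set (Alg.{u} K α) :=
  {A | ∃ C ∈ 𝒦, ∃ f : A → nr ρ C,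
    IsEmbedding (A := A) (B := C.rdDim ρ) (fun x => (f x : C.rdDim ρ)) ∧
    ∀ (S : Set A) (a : A), IsLUB S a → IsLUB (f '' S) (f a)}

/-! ## Complete representations -/

/-- The generalized space with subbases the members of `𝒰`: the union of the cartesian powers
`^α W`, `W ∈ 𝒰`. -/
def genSpace (α : Type) {U : Type u} (𝒰 : Set (Set U)) : Set (α → U) :=
  {s | ∃ W ∈ 𝒰, ∀ k, s k ∈ W}

/-- The full set algebra `℘(V)` on a set `V` of `α`-ary sequences. -/
def setAlg (K : Kind) {α : Type} [DecidableEq α] {U : Type u} (V : Set (α → U)) :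
    Alg.{u} K α where
  carrier := Set V
  una := fun o X => match o with
    | .cyl i => {s | ∃ t ∈ X, ∀ j, j ≠ i → t.1 j = s.1 j}
    | .repl _ i j => {s | ∃ t ∈ X, t.1 = s.1 ∘ replace i j}
    | .swap _ i j => {s | ∃ t ∈ X, t.1 = s.1 ∘ Equiv.swap i j}
    | .sub _ τ => {s | ∃ t ∈ X, t.1 = s.1 ∘ τ}
  nul := fun o => match o with
    | .diag _ i j => {s | s.1 i = s.1 j}

/-- The class of completely representable algebras: there is an embedding into the full set algebra
on a generalized space (with pairwise disjoint subbases) that carries all existing suprema to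
unions. -/
def CompletelyRepresentable (K : Kind) (α : Type) [DecidableEq α] : Set (Alg.{u} K α) :=
  {A | ∃ (U : Type u) (𝒰 : Set (Set U)), 𝒰.PairwiseDisjoint id ∧
    ∃ f : A → Set (genSpace α 𝒰),
      IsEmbedding (A := A) (B := setAlg K (genSpace α 𝒰)) f ∧
      ∀ (S : Set A) (a : A), IsLUB S a → f a = ⋃ x ∈ S, f x}

end CylAlg

universe v

/-! Write n = m + 1. Both algebras consist of sets of types of n-tuples in labelled structures. A
point may be a base point of one of m sorts, or may carry a tint. A pair carries an adjacency bit
and an edge label, white of one of m sorts or red. An m-tuple carries a shade. A base consists of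
one base point of each sort, and a tinted point adjacent to all of them is an apex over it. There
are three constraints (`LabelSys.Valid`). Tinted points adjacent to a common base point of sort l
are not joined by the white label l, so edges between apexes over one base are red. For three points
of consecutive tints with red edges, the second edge label is the predecessor of the first. The tint
of an apex lies in the shade of its base.

For 𝔄 the labels are natural numbers (`std`), and 𝔄 is the full complex algebra `cm` of the types.
Suppose it embeds completely into a neat reduct with three spare dimensions. These hold apexes of
consecutive tints over one base whose shade permits every tint. White and red labels form a
partition of unity, which the embedding preserves, and white is excluded, so any nonzero
configuration of two apexes meets a definite red label. Adding the next apex gives an edge whose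
label is smaller by one, and the oldest apex can be dropped. This is an infinite descent in ℕ
(`NeatMap.false_of_descent`). It uses only cylindrifications and replacements; since diagonals
define replacements, it also excludes the cylindric reduct and, through set algebras of higher
dimension, all complete representations.

In an ultrapower of 𝔄 red labels can be infinite, and descent from an infinite label never ends:
there is a function h from tints to red labels that drops by one along consecutive tints
(`germ_exists_descending`). A countable elementary substructure is taken that is also closed under
operations for picking atoms and for coding and decoding labels. Its elements then describe sets of
types over a countable label system of germs. A countable structure realizing these types
homogeneously turns the substructure into an algebra 𝔅 of sets of tuples. Every tuple lies in an
atom of 𝔅, so suprema in 𝔅 are unions, and all reducts of 𝔅 are completely representable.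

The crux is adding one point z to a structure, with its relation to at most m old points prescribed
(`exists_extension`). A red edge from z is forced only if those points form a base. If an old apex
over it has the tint of z, its edges are copied; otherwise labels are taken from h. The invariant
`Tame` ensures that h fits the old edges: over each base either all permitted tints occur, so that
copying is possible, or consecutive apexes are already joined according to h. With fewer than m
prescribed points nothing is forced, and this weaker amalgamation, valid for the natural labels too,
yields the axioms for `cm`. -/

namespace CylAlg

open scoped FirstOrder

/-! ### Set algebras on generalized spaces satisfy the axioms; complete representations give neat
embeddings -/

section SetAlgebras

variable {α : Type} {U : Type u} {𝒰 : Set (Set U)}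

/-- Concrete cylindrification. -/
def cylSet (V : Set (α → U)) (i : α) (X : Set V) : Set V :=
  {s | ∃ t ∈ X, ∀ j, j ≠ i → t.1 j = s.1 j}

/-- Concrete substitution. -/
def subSet (V : Set (α → U)) (τ : α → α) (X : Set V) : Set V :=
  {s | ∃ t ∈ X, t.1 = s.1 ∘ τ}

/-- Concrete diagonals. -/
def diagSet (V : Set (α → U)) (i j : α) : Set V := {s | s.1 i = s.1 j}

theorem comp_mem_genSpace {β : Type} {s : α → U} (hs : s ∈ genSpace α 𝒰) (τ : β → α) :
    s ∘ τ ∈ genSpace β 𝒰 := by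
  obtain ⟨W, hW, h⟩ := hs
  exact ⟨W, hW, fun k => h _⟩

/-- Subbases are disjoint, so one common value already determines the subbase. This is what keeps
one-coordinate changes of a sequence inside the space. -/
theorem exists_block {β : Type} (h𝒰 : 𝒰.PairwiseDisjoint id) {s : α → U} {t : β → U}
    (hs : s ∈ genSpace α 𝒰) (ht : t ∈ genSpace β 𝒰) {k : α} {l : β} (h : s k = t l) :
    ∃ W ∈ 𝒰, (∀ k, s k ∈ W) ∧ ∀ k, t k ∈ W := by
  obtain ⟨W, hW, hs⟩ := hs
  obtain ⟨W', hW', ht⟩ := ht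
  by_cases hWW : W = W'
  · subst hWW; exact ⟨W, hW, hs, ht⟩
  · exact ((Set.disjoint_left.1 (h𝒰 hW hW' hWW)) (hs k) (h ▸ ht l)).elim

theorem le_cylSet (i : α) (X : Set (genSpace α 𝒰)) : X ≤ cylSet _ i X :=
  fun s hs => ⟨s, hs, fun _ _ => rfl⟩

theorem cylSet_sup (i : α) (X Y : Set (genSpace α 𝒰)) :
    cylSet _ i (X ⊔ Y) = cylSet _ i X ⊔ cylSet _ i Y := by
  ext s
  constructor
  · rintro ⟨t, ht | ht, h⟩
    exacts [Or.inl ⟨t, ht, h⟩, Or.inr ⟨t, ht, h⟩]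
  · rintro (⟨t, ht, h⟩ | ⟨t, ht, h⟩)
    exacts [⟨t, Or.inl ht, h⟩, ⟨t, Or.inr ht, h⟩]

theorem mem_subSet {τ : α → α} {X : Set (genSpace α 𝒰)} {s : genSpace α 𝒰} :
    s ∈ subSet _ τ X ↔ (⟨s.1 ∘ τ, comp_mem_genSpace s.2 τ⟩ : genSpace α 𝒰) ∈ X := by
  constructor
  · rintro ⟨t, ht, h⟩
    rwa [show (⟨s.1 ∘ τ, _⟩ : genSpace α 𝒰) = t from Subtype.ext h.symm]
  · intro h
    exact ⟨_, h, rfl⟩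

theorem subSet_subSet (σ τ : α → α) (X : Set (genSpace α 𝒰)) :
    subSet _ σ (subSet _ τ X) = subSet _ (σ ∘ τ) X := by
  ext s; simp only [mem_subSet]; rfl

theorem subSet_id (X : Set (genSpace α 𝒰)) : subSet _ id X = X := by
  ext s; simp only [mem_subSet]; rfl

theorem subSet_endo (τ : α → α) : IsBoolEndo (subSet (genSpace α 𝒰) τ) where
  map_sup x y := by ext s; simp [mem_subSet]
  map_compl x := by ext s; simp [mem_subSet]

theorem subSet_cylSet_congr (σ τ : α → α) (i : α) (X : Set (genSpace α 𝒰))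
    (h : ∀ k, k ≠ i → σ k = τ k) :
    subSet _ σ (cylSet _ i X) = subSet _ τ (cylSet _ i X) := by
  ext s
  simp only [mem_subSet]
  constructor <;> rintro ⟨t, ht, h'⟩ <;> refine ⟨t, ht, fun k hk => ?_⟩
  · simpa [h k hk] using h' k hk
  · simpa [h k hk] using h' k hk

theorem cylSet_subSet_of_empty (τ : α → α) (i : α) (X : Set (genSpace α 𝒰))
    (h : τ ⁻¹' {i} = ∅) : cylSet _ i (subSet _ τ X) = subSet _ τ X := by
  have h1 : ∀ k, τ k ≠ i := fun k hk => by
    have := Set.ext_iff.1 h k; simp [hk] at this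
  ext s
  constructor
  · rintro ⟨t, ht, hs⟩
    rw [mem_subSet] at ht ⊢
    convert ht using 1
    exact Subtype.ext (funext fun k => (hs _ (h1 k)).symm)
  · intro hs
    exact ⟨s, hs, fun _ _ => rfl⟩

variable [DecidableEq α]

theorem update_mem_genSpace {β : Type} (h𝒰 : 𝒰.PairwiseDisjoint id) {s : α → U} {t : β → U}
    (hs : s ∈ genSpace α 𝒰) (ht : t ∈ genSpace β 𝒰) {k : α} {l : β} (h : s k = t l)
    (i : α) (j : β) : Function.update s i (t j) ∈ genSpace α 𝒰 := by
  obtain ⟨W, hW, h1, h2⟩ := exists_block h𝒰 hs ht h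
  refine ⟨W, hW, fun k => ?_⟩
  by_cases hk : k = i
  · subst hk; simpa using h2 j
  · simpa [hk] using h1 k

theorem cylSet_subSet_of_singleton [Nontrivial α] (h𝒰 : 𝒰.PairwiseDisjoint id) (τ : α → α)
    (i j : α) (X : Set (genSpace α 𝒰)) (h : τ ⁻¹' {i} = {j}) :
    cylSet _ i (subSet _ τ X) = subSet _ τ (cylSet _ j X) := by
  have h1 : ∀ k, τ k = i ↔ k = j := fun k => by
    have := Set.ext_iff.1 h k; simpa using this
  ext s
  rw [mem_subSet]
  constructor
  · rintro ⟨t, ht, hs⟩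
    refine ⟨_, mem_subSet.1 ht, fun k hk => hs _ ?_⟩
    rwa [Ne, h1]
  · rintro ⟨t, ht, hs⟩
    -- A second coordinate is needed: it gives `t` and `s` a common value, hence a common subbase.
    obtain ⟨k, hk⟩ := exists_ne j
    refine ⟨⟨Function.update s.1 i (t.1 j),
      update_mem_genSpace h𝒰 s.2 t.2 (k := τ k) (l := k) (hs k hk).symm _ _⟩, ?_, ?_⟩
    · rw [mem_subSet]
      convert ht using 1
      refine Subtype.ext (funext fun l => ?_)
      by_cases hl : l = j
      · subst hl; simp [(h1 l).2 rfl]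
      · have : τ l ≠ i := by rwa [Ne, h1]
        simp [this, hs l hl]
    · intro l hl; simp [hl]

theorem cylSet_quantifier (h𝒰 : 𝒰.PairwiseDisjoint id) :
    QuantifierAxioms (cylSet (genSpace α 𝒰)) where
  cyl_bot i := by
    ext s; constructor
    · rintro ⟨t, ht, -⟩; exact ht
    · exact fun h => h.elim
  le_cyl := le_cylSet
  cyl_inf_cyl i X Y := by
    ext s
    constructor
    · rintro ⟨t, ⟨ht, r, hr, h1⟩, h2⟩
      exact ⟨⟨t, ht, h2⟩, r, hr, fun j hj => (h1 j hj).trans (h2 j hj)⟩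
    · rintro ⟨⟨t, ht, h2⟩, r, hr, h1⟩
      exact ⟨t, ⟨ht, r, hr, fun j hj => (h1 j hj).trans (h2 j hj).symm⟩, h2⟩
  cyl_comm := by
    have key : ∀ i j (X : Set (genSpace α 𝒰)),
        cylSet _ i (cylSet _ j X) ⊆ cylSet _ j (cylSet _ i X) := by
      rintro i j X s ⟨t, ⟨r, hr, h1⟩, h2⟩
      by_cases hij : i = j
      · subst hij; exact ⟨t, ⟨r, hr, h1⟩, h2⟩
      obtain ⟨W, hW, hrW, htW⟩ := exists_block h𝒰 r.2 t.2 (h1 i hij)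
      have htj : t.1 j = s.1 j := h2 j (Ne.symm hij)
      -- The values `t j` and `r j` lie in one subbase `W`, and `t j = s j`. Listing them as a
      -- sequence indexed by `Bool` makes `update_mem_genSpace` applicable.
      refine ⟨⟨Function.update s.1 j (r.1 j),
        update_mem_genSpace h𝒰 s.2 ⟨W, hW, fun l => ?_⟩
          (t := fun b : Bool => bif b then t.1 j else r.1 j)
          (k := j) (l := true) htj.symm j false⟩, ⟨r, hr, fun k hk => ?_⟩, fun k hk => ?_⟩
      · cases l
        · exact hrW j
        · exact htW j
      · by_cases hkj : k = j
        · subst hkj; simp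
        · simp [hkj, h1 k hkj, h2 k hk]
      · simp [hk]
    intro i j X
    exact Set.Subset.antisymm (key i j X) (key j i X)

theorem replace_apply_self (i j : α) : replace i j i = j := by simp [replace]

theorem replace_apply_of_ne {i j k : α} (h : k ≠ i) : replace i j k = k := by simp [replace, h]

theorem replace_self (i : α) : replace i i = id := by simp [replace]

theorem setAlg_diag_eq (i j k : α) (hi : k ≠ i) (hj : k ≠ j) :
    diagSet (genSpace α 𝒰) i j = cylSet _ k (diagSet _ i k ⊓ diagSet _ k j) := by
  ext s
  constructor
  · intro h
    have h : s.1 i = s.1 j := h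
    obtain ⟨W, hW, hs⟩ := s.2
    refine ⟨⟨Function.update s.1 k (s.1 i), ⟨W, hW, fun l => ?_⟩⟩, ⟨?_, ?_⟩, fun l hl => by simp [hl]⟩
    · by_cases hl : l = k
      · subst hl; simpa using hs i
      · simpa [hl] using hs l
    · simp [diagSet, hi.symm]
    · simp [diagSet, hj.symm, h]
  · rintro ⟨t, ⟨h1, h2⟩, h⟩
    have h1 : t.1 i = t.1 k := h1
    have h2 : t.1 k = t.1 j := h2
    show s.1 i = s.1 j
    rw [← h i hi.symm, ← h j hj.symm, h1, h2]

theorem cylSet_diag_inf (i j : α) (hij : i ≠ j) (X : Set (genSpace α 𝒰)) :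
    cylSet _ i (diagSet _ i j ⊓ X) = subSet _ (replace i j) X := by
  ext s
  rw [mem_subSet]
  constructor
  · rintro ⟨t, ⟨h1, h2⟩, h⟩
    have h1 : t.1 i = t.1 j := h1
    convert h2 using 1
    refine Subtype.ext (funext fun k => ?_)
    by_cases hk : k = i
    · subst hk; simp [replace_apply_self, h1, h j hij.symm]
    · simp [replace_apply_of_ne hk, h k hk]
  · intro h
    refine ⟨_, ⟨?_, h⟩, fun k hk => ?_⟩
    · simp [diagSet, replace_apply_self, replace_apply_of_ne hij.symm]
    · simp [replace_apply_of_ne hk]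

theorem cylSet_repl_symm (h𝒰 : 𝒰.PairwiseDisjoint id) (i j : α) (X : Set (genSpace α 𝒰)) :
    cylSet _ i (subSet _ (replace j i) X) = cylSet _ j (subSet _ (replace i j) X) := by
  have key : ∀ i j, cylSet _ i (subSet _ (replace j i) X) ⊆
      cylSet _ j (subSet _ (replace i j) X) := by
    rintro i j s ⟨t, ht, h⟩
    by_cases hij : i = j
    · subst hij; exact ⟨t, ht, h⟩
    rw [mem_subSet] at ht
    refine ⟨⟨Function.update s.1 j (t.1 i),
      update_mem_genSpace h𝒰 s.2 t.2 (h j (Ne.symm hij)).symm _ _⟩, ?_, fun k hk => by simp [hk]⟩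
    rw [mem_subSet]
    convert ht using 1
    refine Subtype.ext (funext fun k => ?_)
    by_cases hk : k = i
    · subst hk
      simp [replace_apply_self, replace_apply_of_ne hij]
    · by_cases hk' : k = j
      · subst hk'; simp [replace_apply_self, replace_apply_of_ne hk]
      · simp [replace_apply_of_ne hk, replace_apply_of_ne hk', h k hk, hk']
  exact Set.Subset.antisymm (key i j) (key j i)

theorem replace_preimage_empty {i j : α} (h : i ≠ j) : replace i j ⁻¹' {i} = ∅ := by
  ext k
  by_cases hk : k = i
  · subst hk; simp [replace_apply_self, h.symm]
  · simp [replace_apply_of_ne hk, hk]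

theorem replace_preimage_singleton {i j k : α} (hi : k ≠ i) (hj : k ≠ j) :
    replace i j ⁻¹' {k} = {k} := by
  ext l
  by_cases hl : l = i
  · subst hl; simp [replace_apply_self, hj.symm, hi.symm]
  · simp [replace_apply_of_ne hl]

theorem replace_comm {i j k l : α} (h : [i, j, k, l].Nodup) :
    replace j i ∘ replace l k = replace l k ∘ replace j i := by
  simp only [List.nodup_cons, List.mem_cons, List.not_mem_nil, or_false, not_or] at h
  funext x
  simp only [replace, Function.comp, Function.update_apply, id]
  grind

theorem replace_replace (i j l : α) :
    replace l i ∘ replace j l = replace l i ∘ replace j i := by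
  funext x
  simp only [replace, Function.comp, Function.update_apply, id]
  grind

theorem setAlg_sc [Nontrivial α] (h𝒰 : 𝒰.PairwiseDisjoint id) :
    ScAxioms (cylSet (genSpace α 𝒰)) (fun i j => subSet _ (replace i j)) where
  __ := cylSet_quantifier h𝒰
  repl_self i X := by rw [replace_self, subSet_id]
  repl_endo i j := subSet_endo _
  repl_cyl i j X := by
    rw [subSet_cylSet_congr (replace i j) id i X (fun k hk => replace_apply_of_ne hk), subSet_id]
  cyl_repl i j X h := cylSet_subSet_of_empty _ _ _ (replace_preimage_empty h)
  repl_cyl_comm i j k X hi hj :=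
    (cylSet_subSet_of_singleton h𝒰 _ _ _ _ (replace_preimage_singleton hi hj)).symm
  cyl_repl_symm i j X := cylSet_repl_symm h𝒰 i j X
  repl_comm i j k l X h := by rw [subSet_subSet, subSet_subSet, replace_comm h]
  repl_repl i j l X := by rw [subSet_subSet, subSet_subSet, replace_replace]

theorem setAlg_ca (h𝒰 : 𝒰.PairwiseDisjoint id) :
    CAAxioms (cylSet (genSpace α 𝒰)) (diagSet (genSpace α 𝒰)) where
  __ := cylSet_quantifier h𝒰
  diag_self i := by ext s; simp [diagSet]
  diag_eq_cyl i j k hi hj := setAlg_diag_eq i j k hi hj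
  cyl_diag_disjoint i j X h := by
    rw [cylSet_diag_inf i j h, cylSet_diag_inf i j h, (subSet_endo _).map_compl, inf_compl_eq_bot]

theorem inf_diagSet_le (i j : α) (X : Set (genSpace α 𝒰)) :
    X ⊓ diagSet _ i j ≤ subSet _ (replace i j) X := by
  rintro s ⟨h1, h2⟩
  have h2 : s.1 i = s.1 j := h2
  rw [mem_subSet]
  convert h1 using 1
  refine Subtype.ext (funext fun k => ?_)
  by_cases hk : k = i
  · subst hk; simp [replace_apply_self, h2]
  · simp [replace_apply_of_ne hk]

theorem setAlg_qea [Nontrivial α] (h𝒰 : 𝒰.PairwiseDisjoint id) :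
    QEAAxioms (cylSet (genSpace α 𝒰)) (fun i j => subSet _ (replace i j))
      (fun i j => subSet _ (Equiv.swap i j)) (diagSet (genSpace α 𝒰)) where
  repl_self i X := by rw [replace_self, subSet_id]
  swap_self i X := by rw [Equiv.swap_self]; exact subSet_id X
  swap_symm i j X := by rw [Equiv.swap_comm]
  le_cyl := le_cylSet
  cyl_sup := cylSet_sup
  repl_cyl := (setAlg_sc h𝒰).repl_cyl
  cyl_repl := (setAlg_sc h𝒰).cyl_repl
  repl_cyl_comm := (setAlg_sc h𝒰).repl_cyl_comm
  repl_endo i j := subSet_endo _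
  swap_endo i j := subSet_endo _
  swap_swap i j X := by
    rw [subSet_subSet, show (Equiv.swap i j ∘ Equiv.swap i j : α → α) = id from
      funext fun k => Equiv.swap_apply_self i j k, subSet_id]
  swap_braid i j k X h := by
    simp only [List.nodup_cons, List.mem_cons, List.not_mem_nil, or_false, not_or] at h
    rw [subSet_subSet, subSet_subSet]
    congr 1
    funext x
    simp only [Function.comp, Equiv.swap_apply_def]
    grind
  swap_repl i j X := by
    rw [subSet_subSet]
    congr 1
    funext x
    simp only [replace, Function.comp, Function.update_apply, id, Equiv.swap_apply_def]
    grind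
  repl_diag i j := by
    ext s
    simp only [mem_subSet, Set.top_eq_univ, Set.mem_univ, iff_true]
    by_cases hij : j = i
    · simp [diagSet, hij]
    · simp [diagSet, replace_apply_self, replace_apply_of_ne hij]
  inf_diag_le := inf_diagSet_le

theorem setAlg_pea [Nontrivial α] (h𝒰 : 𝒰.PairwiseDisjoint id) :
    PEAAxioms (cylSet (genSpace α 𝒰)) (subSet (genSpace α 𝒰)) (diagSet (genSpace α 𝒰)) where
  __ := cylSet_quantifier h𝒰
  sub_id := subSet_id
  sub_comp σ τ X := (subSet_subSet σ τ X).symm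
  sub_endo := subSet_endo
  sub_cyl_congr := subSet_cylSet_congr
  cyl_sub_of_singleton := cylSet_subSet_of_singleton h𝒰
  cyl_sub_of_empty := cylSet_subSet_of_empty
  diag_self i := by ext s; simp [diagSet]
  inf_diag_le := inf_diagSet_le
  sub_diag τ i j := by ext s; rw [mem_subSet]; rfl

end SetAlgebras

theorem setAlg_mem_Sc {α : Type} [DecidableEq α] [Nontrivial α] {U : Type u} {𝒰 : Set (Set U)}
    (h : 𝒰.PairwiseDisjoint id) : setAlg .Sc (genSpace α 𝒰) ∈ Sc α := setAlg_sc h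

theorem setAlg_mem_CA {α : Type} [DecidableEq α] {U : Type u} {𝒰 : Set (Set U)}
    (h : 𝒰.PairwiseDisjoint id) : setAlg .CA (genSpace α 𝒰) ∈ CA α := setAlg_ca h

theorem setAlg_mem_QEA {α : Type} [DecidableEq α] [Nontrivial α] {U : Type u} {𝒰 : Set (Set U)}
    (h : 𝒰.PairwiseDisjoint id) : setAlg .QEA (genSpace α 𝒰) ∈ QEA α := setAlg_qea h

/-- Complete representability yields membership in `S_c Nr` of any class containing the full
set algebras. -/
theorem CompletelyRepresentable.mem_scNr {K : Kind} (hK : ¬ K.HasSub) {α β : Type}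
    [DecidableEq α] [DecidableEq β] [Nontrivial α] (ρ : α ↪ β) {𝒦 : Set (Alg.{u} K β)}
    (h𝒦 : ∀ (U : Type u) (𝒰 : Set (Set U)), 𝒰.PairwiseDisjoint id →
      setAlg K (genSpace β 𝒰) ∈ 𝒦)
    {A : Alg.{u} K α} (hA : A ∈ CompletelyRepresentable K α) : A ∈ ScNr ρ 𝒦 := by
  obtain ⟨U, 𝒰, h𝒰, f, hf, hsup⟩ := hA
  -- Elements are pulled back along the restriction of β-sequences to the coordinates in ρ. Suprema
  -- become unions, and a union that belongs to the neat reduct is a supremum there.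
  let g : A → Set (genSpace β 𝒰) := fun x => {s | ⟨s.1 ∘ ρ, comp_mem_genSpace s.2 ρ⟩ ∈ f x}
  have hg : ∀ x s, s ∈ g x ↔ (⟨s.1 ∘ ρ, comp_mem_genSpace s.2 ρ⟩ : genSpace α 𝒰) ∈ f x :=
    fun _ _ => Iff.rfl
  have hgU : ∀ (S : Set A) (a : A), IsLUB S a → g a = ⋃ x ∈ S, g x := by
    intro S a h
    ext s
    rw [hg, hsup S a h]
    simp [hg]
  have hsub : ∀ (σ : α → α) (τ : β → β) (x : A) (X : Set (genSpace α 𝒰)),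
      f x = subSet _ σ X → (∀ k, τ (ρ k) = ρ (σ k)) →
      ∀ y, f y = X → g x = subSet _ τ (g y) := by
    intro σ τ x X hx hτ y hy
    ext s
    rw [hg, hx, mem_subSet, mem_subSet, hg, hy]
    have : (s.1 ∘ ρ) ∘ σ = (s.1 ∘ τ) ∘ ρ := funext fun k => by simp [hτ]
    simp only [this]
  refine ⟨setAlg K (genSpace β 𝒰), h𝒦 U 𝒰 h𝒰, fun x => ⟨g x, ?_⟩, ?_, ?_⟩
  · intro i hi
    refine Set.Subset.antisymm ?_ (le_cylSet i _)
    rintro s ⟨t, ht, h⟩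
    have ht' := (hg x t).1 ht
    refine (hg x s).2 ?_
    convert ht' using 1
    exact Subtype.ext (funext fun k => (h (ρ k) fun e => hi ⟨k, e⟩).symm)
  · constructor
    · intro x y hxy
      refine hf.injective (Set.ext fun t => ?_)
      obtain ⟨W, hW, ht⟩ := t.2
      obtain ⟨k0, -⟩ := exists_pair_ne α
      -- The remaining coordinates are filled with one value of `t`, which stays in the same
      -- subbase.
      let s : genSpace β 𝒰 := ⟨Function.extend ρ t.1 (fun _ => t.1 k0), W, hW, fun k => by
        by_cases hk : ∃ a, ρ a = k
        · obtain ⟨a, rfl⟩ := hk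
          rw [ρ.injective.extend_apply]; exact ht a
        · rw [Function.extend_apply' _ _ _ hk]; exact ht k0⟩
      have hs : (⟨s.1 ∘ ρ, comp_mem_genSpace s.2 ρ⟩ : genSpace α 𝒰) = t :=
        Subtype.ext (funext fun k => ρ.injective.extend_apply t.1 (fun _ => t.1 k0) k)
      have := Set.ext_iff.1 hxy s
      have h2 := (hg x s).symm.trans (this.trans (hg y s))
      rwa [hs] at h2
    · show g ⊥ = ∅
      ext s; rw [hg, hf.map_bot]; exact Iff.rfl
    · show g ⊤ = Set.univ
      ext s; rw [hg, hf.map_top]; exact Iff.rfl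
    · intro x y
      show g (x ⊔ y) = g x ∪ g y
      ext s; rw [hg, hf.map_sup]; exact Iff.rfl
    · intro x y
      show g (x ⊓ y) = g x ∩ g y
      ext s; rw [hg, hf.map_inf]; exact Iff.rfl
    · intro x
      show g xᶜ = (g x)ᶜ
      ext s; rw [hg, hf.map_compl]; exact Iff.rfl
    · intro o x
      cases o with
      | cyl i =>
        show g _ = cylSet _ (ρ i) (g x)
        ext s
        rw [hg, hf.map_una]
        constructor
        · rintro ⟨t, ht, h⟩
          obtain ⟨k, hk⟩ := exists_ne i
          refine ⟨⟨Function.update s.1 (ρ i) (t.1 i), update_mem_genSpace h𝒰 s.2 t.2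
            (k := ρ k) (l := k) (h k hk).symm _ _⟩, ?_, fun j hj => by simp [hj]⟩
          rw [hg]
          convert ht using 1
          refine Subtype.ext (funext fun j => ?_)
          by_cases hj : j = i
          · subst hj; simp
          · have : ρ j ≠ ρ i := fun e => hj (ρ.injective e)
            simpa [this] using (h j hj).symm
        · rintro ⟨t, ht, h⟩
          exact ⟨_, ht, fun j hj => h _ fun e => hj (ρ.injective e)⟩
      | repl h i j =>
        refine hsub (replace i j) (replace (ρ i) (ρ j)) _ _ (hf.map_una _ _) (fun k => ?_) x rfl
        by_cases hk : k = i
        · subst hk; simp [replace_apply_self]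
        · rw [replace_apply_of_ne hk, replace_apply_of_ne fun e => hk (ρ.injective e)]
      | swap h i j =>
        refine hsub (Equiv.swap i j) (Equiv.swap (ρ i) (ρ j)) _ _ (hf.map_una _ _) (fun k => ?_) x rfl
        exact ρ.injective.swap_apply i j k
      | sub h => exact (hK h).elim
    · rintro ⟨h, i, j⟩
      show g _ = diagSet _ (ρ i) (ρ j)
      ext s
      rw [hg, hf.map_nul]
      exact Iff.rfl
  · intro S a h
    constructor
    · rintro _ ⟨x, hx, rfl⟩
      show g x ≤ g a
      rw [hgU S a h]
      exact Set.subset_biUnion_of_mem (u := g) hx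
    · rintro ⟨Y, hY⟩ hub
      show g a ≤ Y
      rw [hgU S a h]
      exact Set.iUnion₂_subset fun x hx => hub ⟨x, hx, rfl⟩

/-! ### Boolean endomorphisms and commuting quantifiers -/

section Boolean

variable {A : Type u} [BooleanAlgebra A] {f : A → A}

theorem IsBoolEndo.map_inf (h : IsBoolEndo f) (x y : A) : f (x ⊓ y) = f x ⊓ f y := by
  have : x ⊓ y = (xᶜ ⊔ yᶜ)ᶜ := by simp
  rw [this, h.map_compl, h.map_sup, h.map_compl, h.map_compl]; simp

theorem IsBoolEndo.map_bot (h : IsBoolEndo f) : f ⊥ = ⊥ := by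
  have : (⊥ : A) = ⊥ ⊓ ⊥ᶜ := by simp
  rw [this, h.map_inf, h.map_compl]; simp

theorem IsBoolEndo.mono (h : IsBoolEndo f) : Monotone f := fun x y hxy => by
  rw [← inf_eq_left.2 hxy, h.map_inf]; exact inf_le_right

end Boolean

namespace QuantifierAxioms

variable {α : Type} {A : Type u} [BooleanAlgebra A] {c : α → A → A} (h : QuantifierAxioms c)
include h

theorem mono (i : α) : Monotone (c i) := fun x y hxy => by
  have : x = x ⊓ c i y := (inf_eq_left.2 (hxy.trans (h.le_cyl i y))).symm
  rw [this, h.cyl_inf_cyl]; exact inf_le_right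

theorem cyl_cyl (i : α) (x : A) : c i (c i x) = c i x := by
  have := h.cyl_inf_cyl i ⊤ x
  rwa [top_inf_eq, top_le_iff.1 (h.le_cyl i ⊤), top_inf_eq] at this

theorem cyl_compl (i : α) (x : A) : c i (c i x)ᶜ = (c i x)ᶜ := by
  refine le_antisymm ?_ (h.le_cyl _ _)
  rw [le_compl_iff_disjoint_right, disjoint_iff, ← h.cyl_inf_cyl, compl_inf_eq_bot, h.cyl_bot]

/-- Fixed elements of `c i` are closed under complement and meet, hence under join, so the
right-hand side is fixed and lies above `x ⊔ y`. -/
theorem cyl_sup (i : α) (x y : A) : c i (x ⊔ y) = c i x ⊔ c i y := by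
  refine le_antisymm ?_ (sup_le (h.mono i le_sup_left) (h.mono i le_sup_right))
  have hc : c i (c i x ⊔ c i y) = c i x ⊔ c i y := by
    have e : c i x ⊔ c i y = (c i ((c i x)ᶜ ⊓ c i (c i y)ᶜ))ᶜ := by
      rw [h.cyl_inf_cyl, h.cyl_compl, h.cyl_compl]; simp
    rw [e, h.cyl_compl]
  rw [← hc]
  exact h.mono i (sup_le_sup (h.le_cyl i x) (h.le_cyl i y))

theorem cyl_inf_of_closed (i : α) {x y : A} (hy : c i y = y) : c i (x ⊓ y) = c i x ⊓ y := by
  conv_lhs => rw [← hy]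
  rw [h.cyl_inf_cyl, hy]

theorem cyl_inf_eq_bot (i : α) {x y : A} (hy : c i y = y) (hxy : x ⊓ y = ⊥) : c i x ⊓ y = ⊥ := by
  rw [← h.cyl_inf_of_closed i hy, hxy, h.cyl_bot]

theorem inf_closed (i : α) {x y : A} (hx : c i x = x) (hy : c i y = y) :
    c i (x ⊓ y) = x ⊓ y := by rw [h.cyl_inf_of_closed i hy, hx]

end QuantifierAxioms

/-! ### Replacements definable in cylindric algebras -/

namespace CAAxioms

variable {α : Type} {A : Type u} [BooleanAlgebra A] {c : α → A → A} {d : α → α → A}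
  (h : CAAxioms c d)
include h

theorem cyl_diag_inf_diag {i j : α} (hij : i ≠ j) : c i (d j i ⊓ d i j) = ⊤ := by
  rw [← h.diag_eq_cyl j j i hij hij, h.diag_self]

theorem diag_symm (i j : α) : d i j = d j i := by
  by_cases hij : i = j
  · rw [hij]
  have key : ∀ {i j}, i ≠ j → d i j ≤ d j i := fun {i j} hij => by
    have := h.cyl_diag_disjoint i j (d j i) hij
    rw [inf_comm (d i j) (d j i), h.cyl_diag_inf_diag hij, top_inf_eq] at this
    have h2 := (h.le_cyl i (d i j ⊓ (d j i)ᶜ)).trans this.le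
    rw [← compl_compl (d j i), le_compl_iff_disjoint_right, disjoint_iff]
    exact le_bot_iff.1 h2
  exact le_antisymm (key hij) (key (Ne.symm hij))

theorem cyl_diag {i j : α} (hij : i ≠ j) : c i (d i j) = ⊤ :=
  top_le_iff.1 ((h.cyl_diag_inf_diag hij).ge.trans (h.mono i inf_le_right))

theorem diag_closed {i j k : α} (hi : k ≠ i) (hj : k ≠ j) : c k (d i j) = d i j := by
  rw [h.diag_eq_cyl i j k hi hj, h.cyl_cyl]

/-- On the diagonal, coordinate `i` is determined by coordinate `j`, so quantifying over it adds
nothing there. This is `cyl_diag_disjoint` read as an inclusion. -/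
theorem diag_inf_cyl {i j : α} (hij : i ≠ j) (x : A) : d i j ⊓ c i (d i j ⊓ x) = d i j ⊓ x := by
  refine le_antisymm (le_inf inf_le_left ?_) (le_inf inf_le_left (h.le_cyl _ _))
  rw [← compl_compl x, le_compl_iff_disjoint_right, disjoint_iff, ← le_bot_iff,
    ← h.cyl_diag_disjoint i j x hij, compl_compl]
  exact le_inf (inf_le_left.trans inf_le_right)
    ((le_inf (inf_le_left.trans inf_le_left) inf_le_right).trans (h.le_cyl _ _))

theorem diag_inf_diag {i j l : α} (hij : i ≠ j) (hil : i ≠ l) (hjl : j ≠ l) :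
    d l i ⊓ d j l = d l i ⊓ d j i := by
  refine le_antisymm (le_inf inf_le_left ?_) (le_inf inf_le_left ?_)
  · rw [h.diag_eq_cyl j i l hjl.symm hil.symm, inf_comm]
    exact h.le_cyl _ _
  · rw [h.diag_eq_cyl j l i hij hil, inf_comm, h.diag_symm i l]
    exact h.le_cyl _ _

open Classical in
/-- The substitution operators definable in a cylindric algebra. -/
theorem scAxioms : ScAxioms c (fun i j x => if i = j then x else c i (d i j ⊓ x)) where
  __ := h.toQuantifierAxioms
  repl_self i x := by simp
  repl_endo i j := by
    by_cases hij : i = j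
    · exact ⟨fun x y => by simp [hij], fun x => by simp [hij]⟩
    refine ⟨fun x y => ?_, fun x => ?_⟩ <;> simp only [hij, if_false]
    · rw [inf_sup_left, h.cyl_sup]
    · symm
      rw [compl_eq_comm]
      refine (IsCompl.of_eq ?_ ?_).compl_eq
      · rw [inf_comm]; exact h.cyl_diag_disjoint i j x hij
      · rw [← h.cyl_sup, ← inf_sup_left]; simp [h.cyl_diag hij]
  repl_cyl i j x := by
    by_cases hij : i = j
    · simp [hij]
    · simp only [hij, if_false]; rw [h.cyl_inf_cyl, h.cyl_diag hij, top_inf_eq]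
  cyl_repl i j x hij := by simp only [hij, if_false]; rw [h.cyl_cyl]
  repl_cyl_comm i j k x hi hj := by
    by_cases hij : i = j
    · simp [hij]
    · simp only [hij, if_false]
      rw [h.cyl_comm k i, inf_comm (d i j) x, h.cyl_inf_of_closed k (h.diag_closed hi hj), inf_comm]
  cyl_repl_symm i j x := by
    by_cases hij : i = j
    · simp [hij]
    · simp only [hij, Ne.symm hij, if_false]
      rw [h.cyl_comm i j, h.diag_symm i j]
  repl_comm i j k l x hn := by
    simp only [List.nodup_cons, List.mem_cons, List.not_mem_nil, or_false, not_or] at hn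
    obtain ⟨⟨hij, hik, hil⟩, ⟨hjk, hjl⟩, hkl, -⟩ := hn
    simp only [Ne.symm hij, Ne.symm hkl, if_false]
    rw [inf_comm (d j i), inf_comm (d l k) (c j _),
      ← h.cyl_inf_of_closed l (h.diag_closed (Ne.symm hjl) (Ne.symm hil)),
      ← h.cyl_inf_of_closed j (h.diag_closed hjl hjk), h.cyl_comm j l]
    congr 2
    ac_rfl
  repl_repl i j l x := by
    by_cases hli : l = i
    · simp [hli]
    by_cases hjl : j = l
    · subst hjl
      simp only [hli, if_true, if_false]
      rw [h.cyl_inf_cyl, h.cyl_diag hli, top_inf_eq]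
    by_cases hji : j = i
    · subst hji
      simp only [hli, hjl, if_true, if_false]
      rw [h.diag_symm l j, h.diag_inf_cyl hjl]
    simp only [hli, hjl, hji, if_false]
    have hc : c j (d l i) = d l i := h.diag_closed hjl hji
    rw [inf_comm (d l i) (c j _), inf_comm (d l i) (c j _), ← h.cyl_inf_of_closed j hc,
      ← h.cyl_inf_of_closed j hc, inf_right_comm, inf_right_comm (d j i), inf_comm (d j l),
      inf_comm (d j i), h.diag_inf_diag (Ne.symm hji) (Ne.symm hli) hjl]

end CAAxioms

/-! ### Calculus of replacements -/

namespace ScAxioms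

variable {β : Type} {C : Type u} [BooleanAlgebra C] {c : β → C → C} {s : β → β → C → C}
  (h : ScAxioms c s)
include h

theorem repl_of_closed {i : β} {x : C} (hx : c i x = x) (j : β) : s i j x = x := by
  rw [← hx, h.repl_cyl]

theorem repl_closed {i j k : β} {x : C} (hx : c k x = x) (hi : k ≠ i) (hj : k ≠ j) :
    c k (s i j x) = s i j x := by rw [← h.repl_cyl_comm i j k x hi hj, hx]

/-- A dimension on which `x` does not depend can serve as an intermediate register. -/
theorem repl_trans {i m p : β} {x : C} (hx : c m x = x) (hi : m ≠ i) (hp : m ≠ p) :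
    s m p (s i m x) = s i p x := by
  rw [h.repl_repl p i m x, h.repl_of_closed (h.repl_closed hx hi hp)]

/-- Moving the dependence on `i` to an unused dimension `p` loses nothing and can be undone. -/
theorem repl_repl_inverse {i p : β} {x : C} (hx : c p x = x) : s p i (s i p x) = x := by
  rw [h.repl_repl i i p x, h.repl_self, h.repl_of_closed hx]

/-- Renaming of a bound variable. -/
theorem cyl_repl_of_closed {i p : β} {x : C} (hx : c p x = x) : c p (s i p x) = c i x := by
  rw [← h.cyl_repl_symm i p x, h.repl_of_closed hx]

end ScAxioms

/-! ### Descent in a neat reduct with three spare dimensions -/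

theorem exists_third_fin : ∀ {p q : Fin 3}, p ≠ q →
    ∃ r, r ≠ p ∧ r ≠ q ∧ ∀ t, t = p ∨ t = q ∨ t = r := by
  decide

/-- A homomorphism `f` from an algebra with cylindrifications and replacements indexed by `I` into
the neat reduct of a substitution algebra with three more dimensions `σ 0`, `σ 1`, `σ 2`, which
preserves all partitions of unity. -/
structure NeatMap {I β : Type} {A C : Type u} [BooleanAlgebra A] [BooleanAlgebra C]
    (cA : I → A → A) (sA : I → I → A → A) (c : β → C → C) (s : β → β → C → C)
    (ι : I → β) (σ : Fin 3 → β) (f : A → C) : Prop where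
  sc : ScAxioms c s
  ι_inj : Function.Injective ι
  σ_inj : Function.Injective σ
  ι_ne_σ : ∀ i p, ι i ≠ σ p
  map_bot : f ⊥ = ⊥
  map_inf : ∀ x y, f (x ⊓ y) = f x ⊓ f y
  map_cyl : ∀ i x, f (cA i x) = c (ι i) (f x)
  map_repl : ∀ i j x, f (sA i j x) = s (ι i) (ι j) (f x)
  closed : ∀ p x, c (σ p) (f x) = f x
  dense : ∀ S : Set A, IsLUB S ⊤ → ∀ z, (∀ p, c (σ p) z = z) → (∀ x ∈ S, z ⊓ f x = ⊥) → z = ⊥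

namespace NeatMap

variable {I β : Type} {A C : Type u} [BooleanAlgebra A] [BooleanAlgebra C]
  {cA : I → A → A} {sA : I → I → A → A} {c : β → C → C} {s : β → β → C → C}
  {ι : I → β} {σ : Fin 3 → β} {f : A → C} (h : NeatMap cA sA c s ι σ f)
include h

theorem mono : Monotone f := fun x y hxy => by
  rw [← inf_eq_left.2 hxy, h.map_inf]; exact inf_le_right

theorem closed_ι {i : I} {x : A} (hx : cA i x = x) : c (ι i) (f x) = f x := by
  rw [← h.map_cyl, hx]

/-- Density concerns only elements closed under all spare dimensions, but it transfers to copies of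
a partition moved from `a`, `o` to the spare dimensions `p`, `q`. After closing `y` under `a`, `o`
and the third spare dimension, the two moves can be reversed, which produces an element fixed by all
three spare quantifiers. -/
theorem eq_bot_of_partition {a o : I} (hao : a ≠ o) {p q : Fin 3} (hpq : p ≠ q) {S : Set A}
    (hS : IsLUB S ⊤) {y : C}
    (hy : ∀ x ∈ S, y ⊓ s (ι a) (σ p) (s (ι o) (σ q) (f x)) = ⊥) : y = ⊥ := by
  obtain ⟨r, hrp, hrq, hr⟩ : ∃ r : Fin 3, r ≠ p ∧ r ≠ q ∧ ∀ t, t = p ∨ t = q ∨ t = r :=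
    exists_third_fin hpq
  have sc := h.sc
  have hao' : ι a ≠ ι o := fun e => hao (h.ι_inj e)
  have hpq' : σ p ≠ σ q := fun e => hpq (h.σ_inj e)
  have hrp' : σ r ≠ σ p := fun e => hrp (h.σ_inj e)
  have hrq' : σ r ≠ σ q := fun e => hrq (h.σ_inj e)
  have hι := h.ι_ne_σ
  -- The moved members of the partition depend on none of these three dimensions, so disjointness
  -- survives the closure.
  set y' := c (ι a) (c (ι o) (c (σ r) y)) with hy'
  have hya : c (ι a) y' = y' := sc.cyl_cyl _ _
  have hyo : c (ι o) y' = y' := by rw [hy', sc.cyl_comm (ι o) (ι a), sc.cyl_cyl]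
  have hyr : c (σ r) y' = y' := by
    rw [hy', sc.cyl_comm (σ r) (ι a), sc.cyl_comm (σ r) (ι o), sc.cyl_cyl]
  have hle : y ≤ y' := (sc.le_cyl _ _).trans ((sc.le_cyl _ _).trans (sc.le_cyl _ _))
  have h1 : ∀ x ∈ S, y' ⊓ s (ι a) (σ p) (s (ι o) (σ q) (f x)) = ⊥ := by
    intro x hx
    refine sc.cyl_inf_eq_bot _ (sc.cyl_repl _ _ _ (hι a p)) ?_
    refine sc.cyl_inf_eq_bot _ (sc.repl_closed (sc.cyl_repl _ _ _ (hι o q)) hao'.symm (hι o p)) ?_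
    exact sc.cyl_inf_eq_bot _ (sc.repl_closed (sc.repl_closed (h.closed r x) (hι o r).symm hrq')
      (hι a r).symm hrp') (hy x hx)
  -- Reversing the moves takes `y'` back; `z` is disjoint from every `f x`, and `y'` is recovered
  -- from `z` (`e3`).
  set z := s (σ q) (ι o) (s (σ p) (ι a) y') with hz
  have hu : c (ι o) (s (σ p) (ι a) y') = s (σ p) (ι a) y' :=
    sc.repl_closed hyo (hι o p) hao'.symm
  have hz0 : z = ⊥ := by
    refine h.dense S hS z (fun t => ?_) fun x hx => ?_
    · rcases hr t with rfl | rfl | rfl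
      · exact sc.repl_closed (sc.cyl_repl _ _ _ (hι a t).symm) hpq' (hι o t).symm
      · exact sc.cyl_repl _ _ _ (hι o t).symm
      · exact sc.repl_closed (sc.repl_closed hyr hrp' (hι a t).symm) hrq' (hι o t).symm
    · have e1 : s (σ p) (ι a) (s (ι a) (σ p) (s (ι o) (σ q) (f x))) = s (ι o) (σ q) (f x) :=
        sc.repl_repl_inverse (sc.repl_closed (h.closed p x) (hι o p).symm hpq')
      have e2 : s (σ q) (ι o) (s (ι o) (σ q) (f x)) = f x := sc.repl_repl_inverse (h.closed q x)
      have := congrArg (fun t => s (σ q) (ι o) (s (σ p) (ι a) t)) (h1 x hx)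
      simpa only [(sc.repl_endo _ _).map_inf, (sc.repl_endo _ _).map_bot, e1, e2] using this
  have e3 : s (ι a) (σ p) (s (ι o) (σ q) z) = y' := by
    rw [hz, sc.repl_repl_inverse hu, sc.repl_repl_inverse hya]
  rw [← le_bot_iff]
  rw [← e3, hz0, (sc.repl_endo _ _).map_bot, (sc.repl_endo _ _).map_bot] at hle
  exact hle

variable {a b o : I} (hab : a ≠ b) (hao : a ≠ o) (hbo : b ≠ o)
include hab hao hbo

/-- The exclusion of a white edge between two apexes sharing a base point is an identity of `A` in
the coordinates `m` and `o`. Here it is moved to the spare dimensions `p` and `q`. The coordinate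
`m` is a free place for the first apex and has to avoid the base coordinate `l`. -/
theorem white_eq_bot {l : I} {G G' W : A} (p q : Fin 3)
    (hG : ∀ m, m ≠ l → m ≠ o → cA m G = G) (hG' : ∀ m, m ≠ l → m ≠ o → cA m G' = G')
    (hW : cA b W = W)
    (hGW : ∀ m, m ≠ l → m ≠ o → sA o m G ⊓ G' ⊓ sA a m W = ⊥) :
    s (ι o) (σ p) (f G) ⊓ s (ι o) (σ q) (f G') ⊓ s (ι a) (σ p) (s (ι o) (σ q) (f W)) = ⊥ := by
  have sc := h.sc
  have hι := h.ι_ne_σ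
  have hι' : ∀ {i j}, i ≠ j → ι i ≠ ι j := fun hij e => hij (h.ι_inj e)
  have main : ∀ m, m ≠ l → m ≠ o → s (ι m) (σ p) (s (ι o) (σ q) (s (ι a) (ι m) (f W))) =
      s (ι a) (σ p) (s (ι o) (σ q) (f W)) →
      s (ι o) (σ p) (f G) ⊓ s (ι o) (σ q) (f G') ⊓ s (ι a) (σ p) (s (ι o) (σ q) (f W)) = ⊥ := by
    intro m hml hmo hm
    have e1 : s (ι m) (σ p) (s (ι o) (σ q) (s (ι o) (ι m) (f G))) = s (ι o) (σ p) (f G) := by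
      rw [sc.repl_of_closed (sc.cyl_repl _ _ _ (hι' hmo.symm)) (σ q),
        sc.repl_trans (h.closed_ι (hG m hml hmo)) (hι' hmo) (hι m p)]
    have e2 : s (ι m) (σ p) (s (ι o) (σ q) (f G')) = s (ι o) (σ q) (f G') :=
      sc.repl_of_closed (sc.repl_closed (h.closed_ι (hG' m hml hmo)) (hι' hmo) (hι m q)) _
    have := congrArg (fun t => s (ι m) (σ p) (s (ι o) (σ q) (f t))) (hGW m hml hmo)
    simpa only [h.map_inf, h.map_bot, h.map_repl, (sc.repl_endo _ _).map_inf,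
      (sc.repl_endo _ _).map_bot, e1, e2, hm] using this
  -- The natural choice is `m = a`, where `W` is already read. If the base point sits at `a`, then
  -- `b` is used instead, since `W` does not depend on `b`.
  by_cases hla : l = a
  · refine main b (by rintro rfl; exact hab hla.symm) hbo ?_
    rw [sc.repl_comm (σ q) (ι o) (ι b) (ι a) (f W), sc.repl_trans _ (hι' hab.symm) (hι b p)]
    · exact sc.repl_closed (h.closed_ι hW) (hι' hbo) (hι b q)
    · simp [hι' hab.symm, hι' hbo.symm, hι' hao.symm, (hι _ q).symm]
  · refine main a (Ne.symm hla) hao ?_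
    rw [sc.repl_self]

/-- The same transport for three points: `A` forbids the pattern at `a`, `b`, `o`, and these
coordinates are moved to the spare dimensions `p`, `q`, `r`. The identities `e1` to `e6` follow each
factor through the three moves. -/
theorem chain_eq_bot {V V' V'' E E' E'' : A} (p q r : Fin 3)
    (hV : ∀ m, m ≠ o → cA m V = V) (hV' : ∀ m, m ≠ o → cA m V' = V')
    (hV'' : ∀ m, m ≠ o → cA m V'' = V'')
    (hE : cA b E = E) (hE' : cA b E' = E') (hE'' : cA b E'' = E'')
    (hbot : sA o a V ⊓ sA o b V' ⊓ V'' ⊓ sA o b E ⊓ sA a b E' ⊓ E'' = ⊥) :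
    s (ι o) (σ p) (f V) ⊓ s (ι o) (σ q) (f V') ⊓ s (ι o) (σ r) (f V'') ⊓
      s (ι a) (σ p) (s (ι o) (σ q) (f E)) ⊓ s (ι a) (σ q) (s (ι o) (σ r) (f E')) ⊓
      s (ι a) (σ p) (s (ι o) (σ r) (f E'')) = ⊥ := by
  have sc := h.sc
  have hι := h.ι_ne_σ
  have hι' : ∀ {i j}, i ≠ j → ι i ≠ ι j := fun hij e => hij (h.ι_inj e)
  have e1 : s (ι a) (σ p) (s (ι b) (σ q) (s (ι o) (σ r) (s (ι o) (ι a) (f V)))) =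
      s (ι o) (σ p) (f V) := by
    rw [sc.repl_of_closed (sc.cyl_repl _ _ _ (hι' hao.symm)) (σ r),
      sc.repl_of_closed (sc.repl_closed (h.closed_ι (hV b hbo)) (hι' hbo) (hι' hab.symm)) (σ q),
      sc.repl_trans (h.closed_ι (hV a hao)) (hι' hao) (hι a p)]
  have e2 : s (ι a) (σ p) (s (ι b) (σ q) (s (ι o) (σ r) (s (ι o) (ι b) (f V')))) =
      s (ι o) (σ q) (f V') := by
    rw [sc.repl_of_closed (sc.cyl_repl _ _ _ (hι' hbo.symm)) (σ r),
      sc.repl_trans (h.closed_ι (hV' b hbo)) (hι' hbo) (hι b q),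
      sc.repl_of_closed (sc.repl_closed (h.closed_ι (hV' a hao)) (hι' hao) (hι a q))]
  have e3 : s (ι a) (σ p) (s (ι b) (σ q) (s (ι o) (σ r) (f V''))) = s (ι o) (σ r) (f V'') := by
    rw [sc.repl_of_closed (sc.repl_closed (h.closed_ι (hV'' b hbo)) (hι' hbo) (hι b r)),
      sc.repl_of_closed (sc.repl_closed (h.closed_ι (hV'' a hao)) (hι' hao) (hι a r))]
  have e4 : s (ι a) (σ p) (s (ι b) (σ q) (s (ι o) (σ r) (s (ι o) (ι b) (f E)))) =
      s (ι a) (σ p) (s (ι o) (σ q) (f E)) := by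
    rw [sc.repl_of_closed (sc.cyl_repl _ _ _ (hι' hbo.symm)) (σ r),
      sc.repl_trans (h.closed_ι hE) (hι' hbo) (hι b q)]
  have e5 : s (ι a) (σ p) (s (ι b) (σ q) (s (ι o) (σ r) (s (ι a) (ι b) (f E')))) =
      s (ι a) (σ q) (s (ι o) (σ r) (f E')) := by
    rw [sc.repl_comm (σ r) (ι o) (ι b) (ι a) (f E'), sc.repl_trans _ (hι' hab.symm) (hι b q),
      sc.repl_of_closed (sc.cyl_repl _ _ _ (hι a q))]
    · exact sc.repl_closed (h.closed_ι hE') (hι' hbo) (hι b r)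
    · simp [hι' hab.symm, hι' hbo.symm, hι' hao.symm, (hι _ r).symm]
  have e6 : s (ι a) (σ p) (s (ι b) (σ q) (s (ι o) (σ r) (f E''))) =
      s (ι a) (σ p) (s (ι o) (σ r) (f E'')) := by
    rw [sc.repl_of_closed (sc.repl_closed (h.closed_ι hE'') (hι' hbo) (hι b r)) (σ q)]
  have := congrArg (fun t => s (ι a) (σ p) (s (ι b) (σ q) (s (ι o) (σ r) (f t)))) hbot
  simpa only [h.map_inf, h.map_bot, h.map_repl, (sc.repl_endo _ _).map_inf,
    (sc.repl_endo _ _).map_bot, e1, e2, e3, e4, e5, e6] using this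

/-- An infinite sequence of apexes over a common base, linked by edges whose indices descend,
cannot exist. -/
theorem false_of_descent {θ : ℕ → A} {φ : A} {L : Set I} {G : I → ℕ → A} {W : I → A} {E V : ℕ → A}
    (hθ : ∀ i, cA o (θ i) = φ) (hθ0 : f (θ 0) ≠ ⊥)
    (hθG : ∀ l ∈ L, ∀ i, θ i ≤ G l i) (hθV : ∀ i, θ i ≤ V i)
    (hG : ∀ l ∈ L, ∀ i m, m ≠ l → m ≠ o → cA m (G l i) = G l i)
    (hV : ∀ i m, m ≠ o → cA m (V i) = V i)
    (hW : ∀ l ∈ L, cA b (W l) = W l) (hE : ∀ k, cA b (E k) = E k)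
    (hGW : ∀ l ∈ L, ∀ i j m, m ≠ l → m ≠ o → sA o m (G l i) ⊓ G l j ⊓ sA a m (W l) = ⊥)
    (hVE : ∀ i k k' k'', k ≠ k' + 1 → sA o a (V i) ⊓ sA o b (V (i + 1)) ⊓ V (i + 2) ⊓
      sA o b (E k) ⊓ sA a b (E k') ⊓ E k'' = ⊥)
    (hsup : IsLUB (W '' L ∪ Set.range E) ⊤) : False := by
  have sc := h.sc
  have hι := h.ι_ne_σ
  -- `Θ p i` places the apex number `i` on spare dimension `p`, over a base held by the ordinary
  -- coordinates; `R p q k` says that the edge from `p` to `q` has red label number `k`.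
  let Θ : Fin 3 → ℕ → C := fun p i => s (ι o) (σ p) (f (θ i))
  let R : Fin 3 → Fin 3 → ℕ → C := fun p q k => s (ι a) (σ p) (s (ι o) (σ q) (f (E k)))
  have hΘ : ∀ p i x, θ i ≤ x → Θ p i ≤ s (ι o) (σ p) (f x) := fun p i x hx =>
    (sc.repl_endo _ _).mono (h.mono hx)
  have hΘc : ∀ p i, c (σ p) (Θ p i) = f φ := fun p i => by
    rw [← hθ i, h.map_cyl, ← sc.cyl_repl_of_closed (h.closed p _)]
  have hΘr : ∀ p r i, r ≠ p → c (σ r) (Θ p i) = Θ p i := fun p r i hrp =>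
    sc.repl_closed (h.closed r _) (hι o r).symm fun e => hrp (h.σ_inj e)
  have hΘφ : ∀ p i, Θ p i ≤ f φ := fun p i => (sc.le_cyl (σ p) _).trans (hΘc p i).le
  -- White members of the partition miss `y`; if all red ones did too, `y` would vanish.
  have exists_red : ∀ p q i j y, p ≠ q → y ≠ ⊥ → y ≤ Θ p i → y ≤ Θ q j →
      ∃ k, y ⊓ R p q k ≠ ⊥ := by
    intro p q i j y hpq hy hp hq
    by_contra! hcon
    refine hy (h.eq_bot_of_partition hao hpq hsup ?_)
    rintro x (⟨l, hl, rfl⟩ | ⟨k, rfl⟩)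
    · have := h.white_eq_bot hab hao hbo p q (hG l hl i) (hG l hl j) (hW l hl)
        (hGW l hl i j)
      rw [← le_bot_iff, ← this]
      exact inf_le_inf_right _ (le_inf (hp.trans (hΘ p i _ (hθG l hl i)))
        (hq.trans (hΘ q j _ (hθG l hl j))))
    · exact hcon k
  -- Quantifying the apex away leaves only the base `φ`, the same for every tint, so any apex can be
  -- placed on a spare dimension not in use.
  have extend : ∀ y r i, y ≠ ⊥ → y ≤ f φ → c (σ r) y = y → y ⊓ Θ r i ≠ ⊥ := by
    intro y r i hy hyφ hr hbot
    apply hy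
    have := congrArg (c (σ r)) hbot
    rwa [inf_comm, sc.cyl_inf_of_closed _ hr, hΘc, sc.cyl_bot, inf_eq_right.2 hyφ] at this
  -- Strong induction on the label. The third dimension takes the next apex, the new edge must have
  -- label `k - 1`, and the induction hypothesis applies to the last two apexes, with dimension `p`
  -- free again.
  have key : ∀ k i p q, p ≠ q → Θ p i ⊓ Θ q (i + 1) ⊓ R p q k = ⊥ := by
    intro k
    induction k using Nat.strong_induction_on with
    | _ k ih =>
      intro i p q hpq
      by_contra hy
      obtain ⟨r, hrp, hrq, -⟩ := exists_third_fin hpq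
      set y := Θ p i ⊓ Θ q (i + 1) ⊓ R p q k with hydef
      have hyp : y ≤ Θ p i := inf_le_left.trans inf_le_left
      have hyq : y ≤ Θ q (i + 1) := inf_le_left.trans inf_le_right
      have hyr : c (σ r) y = y := by
        refine sc.inf_closed _ (sc.inf_closed _ (hΘr _ _ _ hrp) (hΘr _ _ _ hrq)) ?_
        exact sc.repl_closed (sc.repl_closed (h.closed r _) (hι o r).symm
          fun e => hrq (h.σ_inj e)) (hι a r).symm fun e => hrp (h.σ_inj e)
      have h1 := extend y r (i + 2) hy (hyp.trans (hΘφ _ _)) hyr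
      obtain ⟨k', h2⟩ := exists_red q r (i + 1) (i + 2) _ hrq.symm h1 (inf_le_left.trans hyq)
        inf_le_right
      obtain ⟨k'', h3⟩ := exists_red p r i (i + 2) _ hrp.symm h2
        (inf_le_left.trans (inf_le_left.trans hyp)) (inf_le_left.trans inf_le_right)
      by_cases hk : k = k' + 1
      · refine h2 (le_bot_iff.1 (le_trans ?_ (ih k' (by omega) (i + 1) q r hrq.symm).le))
        exact inf_le_inf_right _ (inf_le_inf_right _ hyq)
      · refine h3 (le_bot_iff.1 (le_trans ?_ (h.chain_eq_bot hab hao hbo p q r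
          (hV i) (hV (i + 1)) (hV (i + 2)) (hE k) (hE k') (hE k'') (hVE i k k' k'' hk)).le))
        refine inf_le_inf_right _ (inf_le_inf_right _ ?_)
        refine le_inf (le_inf (le_inf ?_ ?_) ?_) ?_
        · exact (inf_le_left.trans hyp).trans (hΘ _ _ _ (hθV _))
        · exact (inf_le_left.trans hyq).trans (hΘ _ _ _ (hθV _))
        · exact inf_le_right.trans (hΘ _ _ _ (hθV _))
        · exact inf_le_left.trans inf_le_right
  have h0 : Θ 0 0 ≠ ⊥ := by
    intro e
    apply hθ0
    have := sc.repl_repl_inverse (i := ι o) (h.closed 0 (θ 0))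
    rw [show s (ι o) (σ 0) (f (θ 0)) = ⊥ from e, (sc.repl_endo _ _).map_bot] at this
    exact this.symm
  have h1 := extend (Θ 0 0) 1 1 h0 (hΘφ _ _) (hΘr 0 1 0 (by decide))
  obtain ⟨k, hk⟩ := exists_red 0 1 0 1 _ (by decide) h1 inf_le_left inf_le_right
  exact hk (key k 0 0 1 (by decide))

end NeatMap

/-! ### Labelled structures -/

/-- The positions of a labelled structure on `X`: each carries a label. -/
inductive Pos (m : ℕ) (X : Type) : Type
  | col (x : X)
  | adj (x y : X)
  | el (x y : X)
  | shade (F : Fin m → X)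

namespace Pos

variable {m : ℕ} {X Y Z : Type}

/-- The action of a map on positions. -/
def map (f : X → Y) : Pos m X → Pos m Y
  | col x => col (f x)
  | adj x y => adj (f x) (f y)
  | el x y => el (f x) (f y)
  | shade F => shade (f ∘ F)

/-- All points of the position belong to `J`. -/
def In (J : Set X) : Pos m X → Prop
  | col x => x ∈ J
  | adj x y => x ∈ J ∧ y ∈ J
  | el x y => x ∈ J ∧ y ∈ J
  | shade F => ∀ l, F l ∈ J

theorem map_map (g : Y → Z) (f : X → Y) (p : Pos m X) : (p.map f).map g = p.map (g ∘ f) := by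
  cases p <;> rfl

theorem map_id (p : Pos m X) : p.map id = p := by cases p <;> rfl

theorem in_map {f : X → Y} {J : Set Y} {p : Pos m X} : (p.map f).In J ↔ p.In (f ⁻¹' J) := by
  cases p <;> rfl

theorem In.mono {J J' : Set X} {p : Pos m X} (h : p.In J) (hJ : J ⊆ J') : p.In J' := by
  cases p
  · exact hJ h
  · exact ⟨hJ h.1, hJ h.2⟩
  · exact ⟨hJ h.1, hJ h.2⟩
  · exact fun l => hJ (h l)

theorem map_congr {f g : X → Y} {J : Set X} {p : Pos m X} (h : p.In J) (hfg : ∀ x ∈ J, f x = g x) :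
    p.map f = p.map g := by
  cases p with
  | col x => simp only [map]; rw [hfg _ h]
  | adj x y => simp only [map]; rw [hfg _ h.1, hfg _ h.2]
  | el x y => simp only [map]; rw [hfg _ h.1, hfg _ h.2]
  | shade F => simp only [map]; congr 1; exact funext fun l => hfg _ (h l)

theorem in_univ (p : Pos m X) : p.In Set.univ := by
  cases p <;> simp [In]

end Pos

/-- A system of labels: colours of points (base points of `m` sorts and tints), adjacency bits,
edge labels (white of `m` sorts, and red), and shades. -/
structure LabelSys (m : ℕ) (D : Type u) where
  base : Fin m → D → Prop
  tint : D → Prop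
  nxt : D → D → Prop
  adj : D → Prop
  white : Fin m → D → Prop
  red : D → Prop
  dec : D → D → Prop
  mem : D → D → Prop
  base_unique : ∀ {l l' d}, base l d → base l' d → l = l'
  not_tint_of_base : ∀ {l d}, base l d → ¬ tint d
  tint_of_nxt : ∀ {d d'}, nxt d d' → tint d ∧ tint d'
  nxt_irrefl : ∀ {d}, ¬ nxt d d
  nxt_nxt_ne : ∀ {d d'}, nxt d d' → ¬ nxt d' d
  white_unique : ∀ {l l' d}, white l d → white l' d → l = l'
  not_red_of_white : ∀ {l d}, white l d → ¬ red d
  red_of_not_white : ∀ {d}, (∀ l, ¬ white l d) → red d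
  exists_not_adj : ∃ d, ¬ adj d
  exists_white : ∀ l, ∃ d, white l d
  exists_shade : ∀ T : Finset D, ∃ y, ∀ t, mem t y ↔ t ∈ T

namespace LabelSys

variable {m : ℕ} {D : Type u} (S : LabelSys m D) {X Y : Type}

/-- The constraints on a labelled structure. -/
structure Valid (L : Pos m X → D) : Prop where
  white : ∀ l x y q, S.tint (L (.col x)) → S.tint (L (.col y)) → S.base l (L (.col q)) →
    S.adj (L (.adj x q)) → S.adj (L (.adj y q)) → ¬ S.white l (L (.el x y))
  chain : ∀ x y w, S.nxt (L (.col x)) (L (.col y)) → S.nxt (L (.col y)) (L (.col w)) →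
    S.red (L (.el x y)) → S.red (L (.el y w)) → S.red (L (.el x w)) →
    S.dec (L (.el x y)) (L (.el y w))
  shade : ∀ x F, S.tint (L (.col x)) → (∀ l, S.base l (L (.col (F l)))) →
    (∀ l, S.adj (L (.adj x (F l)))) → S.mem (L (.col x)) (L (.shade F))

variable {S}

theorem Valid.comap {L : Pos m X → D} (h : S.Valid L) (f : Y → X) :
    S.Valid (fun p => L (p.map f)) where
  white l x y q := h.white l (f x) (f y) (f q)
  chain x y w := h.chain (f x) (f y) (f w)
  shade x F := h.shade (f x) (f ∘ F)

variable (S)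

/-- `x` is an apex over the tuple `F`. -/
def Apex (L : Pos m X → D) (x : X) (F : Fin m → X) : Prop :=
  S.tint (L (.col x)) ∧ ∀ l, S.adj (L (.adj x (F l)))

/-- Over the tuple `F`, the edges between apexes of consecutive tints have the labels
prescribed by `h`. -/
def Uniform (h : D → D) (L : Pos m X → D) (F : Fin m → X) : Prop :=
  ∀ x y, S.Apex L x F → S.Apex L y F → S.nxt (L (.col x)) (L (.col y)) →
    L (.el x y) = h (L (.col x))

/-- Over each base, either all permitted tints occur already, or the red edges are prescribed
by `h`. -/
def Tame (h : D → D) (L : Pos m X → D) : Prop :=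
  ∀ F : Fin m → X, (∀ l, S.base l (L (.col (F l)))) →
    (∀ t, S.tint t → S.mem t (L (.shade F)) → ∃ x, S.Apex L x F ∧ L (.col x) = t) ∨
    S.Uniform h L F

variable {S}

/-- Surjectivity keeps realized tints realized. Injectivity is not needed: duplicating points is
harmless, and this is used to add dummy points. -/
theorem Tame.comap {h : D → D} {L : Pos m X → D} (hL : S.Tame h L) {f : Y → X}
    (hf : Function.Surjective f) : S.Tame h (fun p => L (p.map f)) := by
  intro F hF
  rcases hL (f ∘ F) hF with h1 | h1
  · refine Or.inl fun t ht hm => ?_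
    obtain ⟨x, hx, hxt⟩ := h1 t ht hm
    obtain ⟨y, rfl⟩ := hf x
    exact ⟨y, hx, hxt⟩
  · exact Or.inr fun x y hx hy hxy => h1 (f x) (f y) hx hy hxy

theorem injective_of_base {L : Pos m X → D} {F : Fin m → X} (hF : ∀ l, S.base l (L (.col (F l)))) :
    Function.Injective F := fun l l' e => S.base_unique (hF l) (e ▸ hF l')

variable (S) in
/-- The red labels `h t` descend along consecutive tints. -/
structure Descending (h : D → D) : Prop where
  red : ∀ t, S.red (h t)
  dec : ∀ t t', S.nxt t t' → S.dec (h t) (h t')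

/-! ### One-point amalgamation -/

section Extension

variable (S) in
/-- Every sort of base points has a member in `Φ` adjacent to both `y` and the new point. -/
def Forced (M : Pos m X → D) (N : Pos m (Option X) → D) (Φ : Finset X) (y : X) : Prop :=
  ∀ l, ∃ q ∈ Φ, S.base l (M (.col q)) ∧ S.adj (N (.adj none (some q))) ∧ S.adj (M (.adj y q))

/-- A forced point exhibits m distinct base points in `Φ`, and `Φ` has at most m elements. So `Φ` is
exactly one base, the same for every forced point. -/
theorem exists_tuple_of_forced {M : Pos m X → D} {N : Pos m (Option X) → D} {Φ : Finset X}
    (hcard : Φ.card ≤ m) {y : X} (hy : S.Forced M N Φ y) :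
    ∃ F : Fin m → X, (∀ l, F l ∈ Φ) ∧ (∀ l, S.base l (M (.col (F l)))) ∧
      (∀ l, S.adj (N (.adj none (some (F l))))) ∧ (∀ x ∈ Φ, ∃ l, F l = x) ∧ m ≤ Φ.card ∧
      ∀ y', S.Forced M N Φ y' ↔ ∀ l, S.adj (M (.adj y' (F l))) := by
  classical
  choose F hF hb hz ha using hy
  have hinj : Function.Injective F := injective_of_base hb
  have hsub : Finset.univ.image F ⊆ Φ := by
    intro x hx
    obtain ⟨l, -, rfl⟩ := Finset.mem_image.1 hx
    exact hF l
  have hc : (Finset.univ.image F).card = m := by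
    rw [Finset.card_image_of_injective _ hinj, Finset.card_univ, Fintype.card_fin]
  have heq : Finset.univ.image F = Φ := Finset.eq_of_subset_of_card_le hsub (by rw [hc]; exact hcard)
  have hsurj : ∀ x ∈ Φ, ∃ l, F l = x := by
    intro x hx
    rw [← heq] at hx
    obtain ⟨l, -, h⟩ := Finset.mem_image.1 hx
    exact ⟨l, h⟩
  refine ⟨F, hF, hb, hz, hsurj, hc ▸ Finset.card_le_card hsub, fun y' =>
    ⟨fun h l => ?_, fun h l => ?_⟩⟩
  · obtain ⟨q, hq, hbq, -, haq⟩ := h l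
    obtain ⟨l', rfl⟩ := hsurj q hq
    rwa [S.base_unique (hb l') hbq] at haq
  · exact ⟨F l, hF l, hb l, hz l, h l⟩

/-- The choice of labels on the edges between a new point and the points outside `Φ`. -/
theorem exists_edge_labels {M : Pos m X → D} {N : Pos m (Option X) → D} {Φ : Finset X} {h : D → D}
    (hcard : Φ.card ≤ m) (hM : S.Valid M) (hN : S.Valid N)
    (hagree : ∀ p : Pos m X, p.In (Φ : Set X) → N (p.map some) = M p)
    (hgood : Φ.card < m ∨ S.Descending h ∧ S.Tame h M) :
    ∃ e₁ e₂ : X → D, S.tint (N (.col none)) →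
      (∀ y l, S.tint (M (.col y)) → (S.white l (e₁ y) ∨ S.white l (e₂ y)) →
        ¬ ∃ q ∈ Φ, S.base l (M (.col q)) ∧ S.adj (N (.adj none (some q))) ∧ S.adj (M (.adj y q))) ∧
      (∀ y, S.tint (M (.col y)) → (S.red (e₁ y) ∨ S.red (e₂ y)) → ∀ x ∈ Φ, ¬ S.tint (M (.col x))) ∧
      (∀ y y', S.nxt (N (.col none)) (M (.col y)) → S.nxt (M (.col y)) (M (.col y')) →
        S.red (e₁ y) → S.red (M (.el y y')) → S.red (e₁ y') → S.dec (e₁ y) (M (.el y y'))) ∧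
      (∀ y y', S.nxt (M (.col y)) (N (.col none)) → S.nxt (N (.col none)) (M (.col y')) →
        S.red (e₂ y) → S.red (e₁ y') → S.red (M (.el y y')) → S.dec (e₂ y) (e₁ y')) ∧
      (∀ y y', S.nxt (M (.col y)) (M (.col y')) → S.nxt (M (.col y')) (N (.col none)) →
        S.red (M (.el y y')) → S.red (e₂ y') → S.red (e₂ y) → S.dec (M (.el y y')) (e₂ y')) ∧
      (∀ F : Fin m → X, (∀ l, F l ∈ Φ) → (∀ l, S.base l (M (.col (F l)))) →
        (∀ l, S.adj (N (.adj none (some (F l))))) → S.Uniform h M F → ∀ y, S.Apex M y F →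
        (S.nxt (N (.col none)) (M (.col y)) → e₁ y = h (N (.col none))) ∧
        (S.nxt (M (.col y)) (N (.col none)) → e₂ y = h (M (.col y)))) := by
  classical
  -- The constraints on edge labels concern tinted points only, so a new point without tint needs
  -- nothing.
  by_cases hc : S.tint (N (.col none))
  swap
  · exact ⟨fun y => h (M (.col y)), fun y => h (M (.col y)), fun h => (hc h).elim⟩
  choose wh hwh using S.exists_white
  -- For a point that is not forced, some sort has no common base point in `Φ`. The white label of
  -- that sort is then permitted and, not being red, stays out of the chain constraint. Only forced
  -- points remain, whose labels are `g₁` and `g₂`.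
  let w : X → D → D := fun y d => if hy : S.Forced M N Φ y then d else wh (not_forall.1 hy).choose
  have w_forced : ∀ {y d}, S.Forced M N Φ y → w y d = d := fun hy => dif_pos hy
  have w_white : ∀ {y d}, ¬ S.Forced M N Φ y → ∃ l, S.white l (w y d) ∧
      ¬ ∃ q ∈ Φ, S.base l (M (.col q)) ∧ S.adj (N (.adj none (some q))) ∧ S.adj (M (.adj y q)) := by
    intro y d hy
    refine ⟨(not_forall.1 hy).choose, ?_, (not_forall.1 hy).choose_spec⟩
    rw [show w y d = wh (not_forall.1 hy).choose from dif_neg hy]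
    exact hwh _
  have forced_of_red : ∀ {y d}, S.red (w y d) → S.Forced M N Φ y := by
    intro y d hr
    by_contra hy
    obtain ⟨l, hl, -⟩ := w_white (d := d) hy
    exact S.not_red_of_white hl hr
  suffices key : ∃ g₁ g₂ : X → D,
      (∀ y, S.tint (M (.col y)) → S.Forced M N Φ y → S.red (g₁ y) ∧ S.red (g₂ y)) ∧
      (∀ y y', S.nxt (N (.col none)) (M (.col y)) → S.nxt (M (.col y)) (M (.col y')) →
        S.Forced M N Φ y → S.red (M (.el y y')) → S.Forced M N Φ y' →
        S.dec (g₁ y) (M (.el y y'))) ∧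
      (∀ y y', S.nxt (M (.col y)) (N (.col none)) → S.nxt (N (.col none)) (M (.col y')) →
        S.Forced M N Φ y → S.Forced M N Φ y' → S.red (M (.el y y')) → S.dec (g₂ y) (g₁ y')) ∧
      (∀ y y', S.nxt (M (.col y)) (M (.col y')) → S.nxt (M (.col y')) (N (.col none)) →
        S.red (M (.el y y')) → S.Forced M N Φ y' → S.Forced M N Φ y →
        S.dec (M (.el y y')) (g₂ y')) ∧
      (∀ F : Fin m → X, (∀ l, F l ∈ Φ) → (∀ l, S.base l (M (.col (F l)))) →
        (∀ l, S.adj (N (.adj none (some (F l))))) → S.Uniform h M F → ∀ y, S.Apex M y F →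
        (S.nxt (N (.col none)) (M (.col y)) → g₁ y = h (N (.col none))) ∧
        (S.nxt (M (.col y)) (N (.col none)) → g₂ y = h (M (.col y)))) by
    obtain ⟨g₁, g₂, hred, h1, h2, h3, h4⟩ := key
    refine ⟨fun y => w y (g₁ y), fun y => w y (g₂ y), fun _ => ⟨?_, ?_, ?_, ?_, ?_, ?_⟩⟩
    · intro y l hy hl
      by_cases hf : S.Forced M N Φ y
      · simp only [w_forced hf] at hl
        rcases hl with hl | hl
        · exact (S.not_red_of_white hl (hred y hy hf).1).elim
        · exact (S.not_red_of_white hl (hred y hy hf).2).elim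
      · have : ∀ d, S.white l (w y d) →
          ¬ ∃ q ∈ Φ, S.base l (M (.col q)) ∧ S.adj (N (.adj none (some q))) ∧
            S.adj (M (.adj y q)) := by
          intro d hl
          obtain ⟨l', hl', hn⟩ := w_white (d := d) hf
          rwa [S.white_unique hl hl']
        rcases hl with hl | hl
        exacts [this _ hl, this _ hl]
    · intro y hy hr x hx ht
      have hf : S.Forced M N Φ y := by
        rcases hr with hr | hr
        exacts [forced_of_red hr, forced_of_red hr]
      obtain ⟨F, -, hb, -, hs, -⟩ := exists_tuple_of_forced hcard hf
      obtain ⟨l, rfl⟩ := hs x hx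
      exact S.not_tint_of_base (hb l) ht
    · intro y y' a1 a2 a3 a4 a5
      beta_reduce
      rw [w_forced (forced_of_red a3)]
      exact h1 y y' a1 a2 (forced_of_red a3) a4 (forced_of_red a5)
    · intro y y' a1 a2 a3 a4 a5
      beta_reduce
      rw [w_forced (forced_of_red a3), w_forced (forced_of_red a4)]
      exact h2 y y' a1 a2 (forced_of_red a3) (forced_of_red a4) a5
    · intro y y' a1 a2 a3 a4 a5
      beta_reduce
      rw [w_forced (forced_of_red a4)]
      exact h3 y y' a1 a2 a3 (forced_of_red a4) (forced_of_red a5)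
    · intro F hF hb hz hu y hy
      have hf : S.Forced M N Φ y := fun l => ⟨F l, hF l, hb l, hz l, hy.2 l⟩
      beta_reduce
      rw [w_forced hf, w_forced hf]
      exact h4 F hF hb hz hu y hy
  by_cases hex : ∃ y, S.Forced M N Φ y
  swap
  · have hno : ∀ y, ¬ S.Forced M N Φ y := not_exists.1 hex
    exact ⟨fun y => h (M (.col y)), fun y => h (M (.col y)), fun y _ hf => (hno y hf).elim,
      fun y _ _ _ hf => (hno y hf).elim, fun y _ _ _ hf => (hno y hf).elim,
      fun _ y _ _ _ hf => (hno y hf).elim,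
      fun F hF hb hz _ y hy => (hno y fun l => ⟨F l, hF l, hb l, hz l, hy.2 l⟩).elim⟩
  obtain ⟨y₀, hy₀⟩ := hex
  obtain ⟨F, hFΦ, hb, hz, hsurj, hm, hforced⟩ := exists_tuple_of_forced hcard hy₀
  obtain ⟨hdesc, htame⟩ := hgood.resolve_left hm.not_gt
  have hFuniq : ∀ F' : Fin m → X, (∀ l, F' l ∈ Φ) → (∀ l, S.base l (M (.col (F' l)))) → F' = F := by
    intro F' hF' hb'
    funext l
    obtain ⟨l', hl'⟩ := hsurj _ (hF' l)
    have := hb l'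
    rw [hl'] at this
    rw [← hl', S.base_unique this (hb' l)]
  have hcolF : ∀ l, N (.col (some (F l))) = M (.col (F l)) := fun l =>
    hagree (.col (F l)) (hFΦ l)
  have hshadeF : N (.shade (some ∘ F)) = M (.shade F) := hagree (.shade F) hFΦ
  -- `N` is valid, so the tint of the new point is permitted over `F`. Hence, if it does not occur
  -- there yet, the first alternative of tameness fails.
  have hmem : S.mem (N (.col none)) (M (.shade F)) := by
    rw [← hshadeF]
    exact hN.shade none (some ∘ F) hc (fun l => by rw [Function.comp, hcolF]; exact hb l) hz
  -- A twin `x` has the same tint and the same base, so copying its edges reduces every requirement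
  -- to the validity of `M`.
  by_cases htwin : ∃ x, S.Apex M x F ∧ M (.col x) = N (.col none)
  · obtain ⟨x, hx, hxc⟩ := htwin
    refine ⟨fun y => M (.el x y), fun y => M (.el y x), ?_, ?_, ?_, ?_, ?_⟩
    · intro y hy hf
      have hy' := (hforced y).1 hf
      exact ⟨S.red_of_not_white fun l => hM.white l x y (F l) hx.1 hy (hb l) (hx.2 l) (hy' l),
        S.red_of_not_white fun l => hM.white l y x (F l) hy hx.1 (hb l) (hy' l) (hx.2 l)⟩
    · intro y y' a1 a2 a3 a4 a5
      have t2 := S.tint_of_nxt a2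
      exact hM.chain x y y' (hxc ▸ a1) a2
        (S.red_of_not_white fun l => hM.white l x y (F l) hx.1 t2.1 (hb l) (hx.2 l)
          ((hforced y).1 a3 l)) a4
        (S.red_of_not_white fun l => hM.white l x y' (F l) hx.1 t2.2 (hb l) (hx.2 l)
          ((hforced y').1 a5 l))
    · intro y y' a1 a2 a3 a4 a5
      exact hM.chain y x y' (hxc ▸ a1) (hxc ▸ a2)
        (S.red_of_not_white fun l => hM.white l y x (F l) (S.tint_of_nxt a1).1 hx.1 (hb l)
          ((hforced y).1 a3 l) (hx.2 l))
        (S.red_of_not_white fun l => hM.white l x y' (F l) hx.1 (S.tint_of_nxt a2).2 (hb l)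
          (hx.2 l) ((hforced y').1 a4 l)) a5
    · intro y y' a1 a2 a3 a4 a5
      have t1 := S.tint_of_nxt a1
      exact hM.chain y y' x a1 (hxc ▸ a2) a3
        (S.red_of_not_white fun l => hM.white l y' x (F l) t1.2 hx.1 (hb l)
          ((hforced y').1 a4 l) (hx.2 l))
        (S.red_of_not_white fun l => hM.white l y x (F l) t1.1 hx.1 (hb l)
          ((hforced y).1 a5 l) (hx.2 l))
    · intro F' hF' hb' _ hu y hy
      obtain rfl := hFuniq F' hF' hb'
      exact ⟨fun a => hxc ▸ hu x y hx hy (hxc.symm ▸ a), fun a => hu y x hy hx (hxc.symm ▸ a)⟩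
  -- Without a twin the old consecutive edges over `F` follow `h`; labelling the new ones by `h` of
  -- the first tint continues the descent.
  · have hu : S.Uniform h M F := (htame F hb).resolve_left fun hcl => htwin (hcl _ hc hmem)
    refine ⟨fun y => h (N (.col none)), fun y => h (M (.col y)),
      fun _ _ _ => ⟨hdesc.red _, hdesc.red _⟩,
      ?_, ?_, ?_, fun _ _ _ _ _ _ _ => ⟨fun _ => rfl, fun _ => rfl⟩⟩
    · intro y y' a1 a2 a3 a4 a5
      have t2 := S.tint_of_nxt a2
      rw [hu y y' ⟨t2.1, (hforced y).1 a3⟩ ⟨t2.2, (hforced y').1 a5⟩ a2]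
      exact hdesc.dec _ _ a1
    · intro y y' a1 a2 a3 a4 a5
      exact hdesc.dec _ _ a1
    · intro y y' a1 a2 a3 a4 a5
      have t1 := S.tint_of_nxt a1
      rw [hu y y' ⟨t1.1, (hforced y).1 a5⟩ ⟨t1.2, (hforced y').1 a4⟩ a1]
      exact hdesc.dec _ _ a1

/-- One-point extension: a valid structure `M` on `X` can be amalgamated with a structure on a
new point and a set `Φ` of at most `m` points of `X`. -/
theorem exists_extension {M : Pos m X → D} {N : Pos m (Option X) → D} {Φ : Finset X} {h : D → D}
    (hcard : Φ.card ≤ m) (hM : S.Valid M) (hN : S.Valid N)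
    (hagree : ∀ p : Pos m X, p.In (Φ : Set X) → N (p.map some) = M p)
    (hgood : Φ.card < m ∨ S.Descending h ∧ S.Tame h M) :
    ∃ M' : Pos m (Option X) → D, S.Valid M' ∧ (∀ p, M' (p.map some) = M p) ∧
      (∀ p, p.In (insert none (some '' (Φ : Set X))) → M' p = N p) ∧
      (S.Tame h M → S.Tame h M') := by
  classical
  obtain ⟨e₁, e₂, he⟩ := exists_edge_labels hcard hM hN hagree hgood
  obtain ⟨na, hna⟩ := S.exists_not_adj
  choose sh hsh using S.exists_shade
  set R : Finset (Option X) := insert none (Φ.map Function.Embedding.some) with hR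
  have hRset : (insert none (some '' (Φ : Set X)) : Set (Option X)) = (R : Set (Option X)) := by
    ext x; simp [hR]
  rw [hRset]
  have none_mem : none ∈ R := by simp [hR]
  have some_mem : ∀ {x}, some x ∈ R ↔ x ∈ Φ := by simp [hR]
  have hRcard : R.card = Φ.card + 1 := by
    rw [hR, Finset.card_insert_of_notMem (by simp), Finset.card_map]
  let col : Option X → D := fun x => x.elim (N (.col none)) fun x => M (.col x)
  -- The new point is adjacent to nothing outside `R`, so a base containing it has all its apexes in
  -- `R`.
  let adj : Option X → Option X → D
    | some x, some y => M (.adj x y)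
    | none, y => if y ∈ R then N (.adj none y) else na
    | some x, none => if x ∈ Φ then N (.adj (some x) none) else na
  let el : Option X → Option X → D
    | some x, some y => M (.el x y)
    | none, none => N (.el none none)
    | none, some y => if y ∈ Φ then N (.el none (some y)) else e₁ y
    | some x, none => if x ∈ Φ then N (.el (some x) none) else e₂ x
  -- A tuple through the new point that leaves `R` has a freely chosen shade. It permits exactly the
  -- tints of the finitely many apexes present. This makes the shade constraint hold and gives the
  -- first alternative of tameness, whatever labels `N` and `M` prescribe between these apexes.
  let shade : (Fin m → Option X) → D := fun F =>
    if hF : ∃ G : Fin m → X, F = some ∘ G then M (.shade hF.choose)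
    else if ∀ l, F l ∈ R then N (.shade F)
    else sh ((R.filter fun x => S.tint (col x) ∧ ∀ l, S.adj (adj x (F l))).image col)
  let M' : Pos m (Option X) → D
    | .col x => col x
    | .adj x y => adj x y
    | .el x y => el x y
    | .shade F => shade F
  have hsome : ∀ p, M' (p.map some) = M p := by
    intro p
    cases p with
    | shade F =>
      have hF : ∃ G : Fin m → X, some ∘ F = some ∘ G := ⟨F, rfl⟩
      have hG : hF.choose = F := funext fun l => (Option.some.inj (congrFun hF.choose_spec l)).symm
      exact (dif_pos hF).trans (by rw [hG])
    | _ => rfl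
  have hcolR : ∀ {x}, x ∈ R → col x = N (.col x) := by
    intro x hx
    cases x with
    | none => rfl
    | some x => exact (hagree (.col x) (some_mem.1 hx)).symm
  have hadjR : ∀ {x y}, x ∈ R → y ∈ R → adj x y = N (.adj x y) := by
    intro x y hx hy
    cases x with
    | none => exact if_pos hy
    | some x => cases y with
      | none => exact if_pos (some_mem.1 hx)
      | some y => exact (hagree (.adj x y) ⟨some_mem.1 hx, some_mem.1 hy⟩).symm
  have helR : ∀ {x y}, x ∈ R → y ∈ R → el x y = N (.el x y) := by
    intro x y hx hy
    cases x with
    | none => cases y with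
      | none => rfl
      | some y => exact if_pos (some_mem.1 hy)
    | some x => cases y with
      | none => exact if_pos (some_mem.1 hx)
      | some y => exact (hagree (.el x y) ⟨some_mem.1 hx, some_mem.1 hy⟩).symm
  have hshadeR : ∀ {F}, (∀ l, F l ∈ R) → shade F = N (.shade F) := by
    intro F hF
    by_cases hG : ∃ G : Fin m → X, F = some ∘ G
    · obtain ⟨G, rfl⟩ := hG
      exact (hsome (.shade G)).trans (hagree (.shade G) fun l => some_mem.1 (hF l)).symm
    · exact (dif_neg hG).trans (if_pos hF)
  have hadj_none : ∀ {y}, S.adj (adj none y) → y ∈ R := by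
    intro y hy
    by_contra hyR
    rw [show adj none y = na from if_neg hyR] at hy
    exact hna hy
  have hadj_none' : ∀ {x}, S.adj (adj x none) → x ∈ R := by
    intro x hx
    cases x with
    | none => exact none_mem
    | some x =>
      by_contra hxR
      rw [some_mem] at hxR
      rw [show adj (some x) none = na from if_neg hxR] at hx
      exact hna hx
  have hel₁ : ∀ {y}, y ∉ Φ → el none (some y) = e₁ y := fun hy => if_neg hy
  have hel₂ : ∀ {y}, y ∉ Φ → el (some y) none = e₂ y := fun hy => if_neg hy
  have hmem_shade : ∀ {F : Fin m → Option X}, (∃ l, F l = none) → (¬ ∀ l, F l ∈ R) →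
      ∀ t, S.mem t (shade F) ↔
        ∃ x ∈ R, (S.tint (col x) ∧ ∀ l, S.adj (adj x (F l))) ∧ col x = t := by
    intro F hF hFR t
    have hG : ¬ ∃ G : Fin m → X, F = some ∘ G := by
      rintro ⟨G, rfl⟩
      obtain ⟨l, hl⟩ := hF
      exact Option.some_ne_none _ hl
    rw [show shade F = sh _ from (dif_neg hG).trans (if_neg hFR), hsh]
    simp [and_assoc]
  have all_some : ∀ {F : Fin m → Option X}, (¬ ∃ l, F l = none) → ∃ G : Fin m → X, F = some ∘ G := by
    intro F hF
    have : ∀ l, ∃ x, F l = some x := fun l => Option.ne_none_iff_exists'.1 fun e => hF ⟨l, e⟩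
    choose G hG using this
    exact ⟨G, funext hG⟩
  refine ⟨M', ⟨?_, ?_, ?_⟩, hsome, ?_, ?_⟩
  · intro l x y q hx hy hq hxq hyq hw
    have inR : x ∈ R → y ∈ R → q ∈ R → False := fun h1 h2 h3 => by
      refine hN.white l x y q ?_ ?_ ?_ ?_ ?_ ?_
      · rw [← hcolR h1]; exact hx
      · rw [← hcolR h2]; exact hy
      · rw [← hcolR h3]; exact hq
      · rw [← hadjR h1 h3]; exact hxq
      · rw [← hadjR h2 h3]; exact hyq
      · rw [← helR h1 h2]; exact hw
    cases q with
    | none => exact inR (hadj_none' hxq) (hadj_none' hyq) none_mem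
    | some q =>
      cases x with
      | none =>
        have hqR := hadj_none hxq
        cases y with
        | none => exact inR none_mem none_mem hqR
        | some y =>
          by_cases hyΦ : y ∈ Φ
          · exact inR none_mem (some_mem.2 hyΦ) hqR
          · refine (he hx).1 y l hy (Or.inl (hel₁ hyΦ ▸ hw)) ⟨q, some_mem.1 hqR, hq, ?_, hyq⟩
            rw [← hadjR none_mem hqR]; exact hxq
      | some x =>
        cases y with
        | none =>
          have hqR := hadj_none hyq
          by_cases hxΦ : x ∈ Φ
          · exact inR (some_mem.2 hxΦ) none_mem hqR
          · refine (he hy).1 x l hx (Or.inr (hel₂ hxΦ ▸ hw)) ⟨q, some_mem.1 hqR, hq, ?_, hxq⟩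
            rw [← hadjR none_mem hqR]; exact hyq
        | some y => exact hM.white l x y q hx hy hq hxq hyq hw
  · intro x y w hxy hyw rxy ryw rxw
    have inR : x ∈ R → y ∈ R → w ∈ R → S.dec (M' (.el x y)) (M' (.el y w)) := fun h1 h2 h3 => by
      show S.dec (el x y) (el y w)
      rw [helR h1 h2, helR h2 h3]
      refine hN.chain x y w ?_ ?_ ?_ ?_ ?_
      · rw [← hcolR h1, ← hcolR h2]; exact hxy
      · rw [← hcolR h2, ← hcolR h3]; exact hyw
      · rw [← helR h1 h2]; exact rxy
      · rw [← helR h2 h3]; exact ryw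
      · rw [← helR h1 h3]; exact rxw
    have t1 := S.tint_of_nxt hxy
    have t2 := S.tint_of_nxt hyw
    -- the two points other than the new one lie both in `Φ` or both outside
    have both : ∀ y y' : X, S.tint (N (.col none)) → S.tint (M (.col y)) → S.tint (M (.col y')) →
        (S.red (el none (some y)) ∨ S.red (el (some y) none)) →
        (S.red (el none (some y')) ∨ S.red (el (some y') none)) →
        (y ∈ Φ ∧ y' ∈ Φ) ∨ (y ∉ Φ ∧ y' ∉ Φ) := by
      have one : ∀ y y' : X, S.tint (N (.col none)) → S.tint (M (.col y)) → S.tint (M (.col y')) →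
          (S.red (el none (some y)) ∨ S.red (el (some y) none)) → y ∉ Φ → y' ∉ Φ := by
        intro y y' hc hy hy' hr hyΦ hyΦ'
        rw [hel₁ hyΦ, hel₂ hyΦ] at hr
        exact (he hc).2.1 y hy hr y' hyΦ' hy'
      intro y y' hc hy hy' hr hr'
      by_cases h1 : y ∈ Φ
      · by_cases h2 : y' ∈ Φ
        · exact Or.inl ⟨h1, h2⟩
        · exact (one y' y hc hy' hy hr' h2 h1).elim
      · exact Or.inr ⟨h1, one y y' hc hy hy' hr h1⟩
    cases x with
    | none =>
      cases y with
      | none => exact (S.nxt_irrefl hxy).elim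
      | some y =>
        cases w with
        | none => exact (S.nxt_nxt_ne hxy hyw).elim
        | some w =>
          rcases both y w t1.1 t1.2 t2.2 (Or.inl rxy) (Or.inl rxw) with ⟨h1, h2⟩ | ⟨h1, h2⟩
          · exact inR none_mem (some_mem.2 h1) (some_mem.2 h2)
          · show S.dec (el none (some y)) (M (.el y w))
            rw [hel₁ h1]
            exact (he t1.1).2.2.1 y w hxy hyw (hel₁ h1 ▸ rxy) ryw (hel₁ h2 ▸ rxw)
    | some x =>
      cases y with
      | none =>
        cases w with
        | none => exact (S.nxt_irrefl hyw).elim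
        | some w =>
          rcases both x w t1.2 t1.1 t2.2 (Or.inr rxy) (Or.inl ryw) with ⟨h1, h2⟩ | ⟨h1, h2⟩
          · exact inR (some_mem.2 h1) none_mem (some_mem.2 h2)
          · show S.dec (el (some x) none) (el none (some w))
            rw [hel₂ h1, hel₁ h2]
            exact (he t1.2).2.2.2.1 x w hxy hyw (hel₂ h1 ▸ rxy) (hel₁ h2 ▸ ryw) rxw
      | some y =>
        cases w with
        | none =>
          rcases both x y t2.2 t1.1 t1.2 (Or.inr rxw) (Or.inr ryw) with ⟨h1, h2⟩ | ⟨h1, h2⟩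
          · exact inR (some_mem.2 h1) (some_mem.2 h2) none_mem
          · show S.dec (M (.el x y)) (el (some y) none)
            rw [hel₂ h2]
            exact (he t2.2).2.2.2.2.1 x y hxy hyw rxy (hel₂ h2 ▸ ryw) (hel₂ h1 ▸ rxw)
        | some w => exact hM.chain x y w hxy hyw rxy ryw rxw
  · intro x F hx hb ha
    have inR : x ∈ R → (∀ l, F l ∈ R) → S.mem (M' (.col x)) (M' (.shade F)) := fun h1 h2 => by
      show S.mem (col x) (shade F)
      rw [hcolR h1, hshadeR h2]
      refine hN.shade x F ?_ (fun l => ?_) fun l => ?_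
      · rw [← hcolR h1]; exact hx
      · rw [← hcolR (h2 l)]; exact hb l
      · rw [← hadjR h1 (h2 l)]; exact ha l
    by_cases hF : ∃ l, F l = none
    · have hxR : x ∈ R := by
        obtain ⟨l, hl⟩ := hF
        have := ha l
        rw [hl] at this
        exact hadj_none' this
      by_cases hFR : ∀ l, F l ∈ R
      · exact inR hxR hFR
      · exact (hmem_shade hF hFR _).2 ⟨x, hxR, ⟨hx, ha⟩, rfl⟩
    · obtain ⟨G, rfl⟩ := all_some hF
      cases x with
      | none => exact inR none_mem fun l => hadj_none (ha l)
      | some x =>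
        have := hM.shade x G hx hb ha
        rwa [← hsome (.shade G)] at this
  · intro p hp
    cases p with
    | col x => exact hcolR hp
    | adj x y => exact hadjR hp.1 hp.2
    | el x y => exact helR hp.1 hp.2
    | shade F => exact hshadeR hp
  · intro htame F hb
    by_cases hF : ∃ l, F l = none
    · have hxR : ∀ x, S.Apex M' x F → x ∈ R := by
        intro x hx
        obtain ⟨l, hl⟩ := hF
        have := hx.2 l
        rw [hl] at this
        exact hadj_none' this
      by_cases hFR : ∀ l, F l ∈ R
      -- Two apexes of consecutive tints and a base would be m + 2 points of `R`, which has at most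
      -- m + 1. So uniformity is vacuous.
      · right
        intro x y hx hy hxy
        exfalso
        have hinj : Function.Injective F := injective_of_base (L := M') hb
        have hne : x ≠ y := by rintro rfl; exact S.nxt_irrefl hxy
        have hnF : ∀ z, S.tint (col z) → z ∉ Finset.univ.image F := by
          intro z hz hzF
          obtain ⟨l, -, rfl⟩ := Finset.mem_image.1 hzF
          exact S.not_tint_of_base (hb l) hz
        have hsub : insert x (insert y (Finset.univ.image F)) ⊆ R := by
          intro z hz
          rw [Finset.mem_insert, Finset.mem_insert, Finset.mem_image] at hz
          rcases hz with rfl | rfl | ⟨l, -, rfl⟩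
          exacts [hxR _ hx, hxR _ hy, hFR l]
        have := Finset.card_le_card hsub
        rw [Finset.card_insert_of_notMem, Finset.card_insert_of_notMem (hnF y hy.1),
          Finset.card_image_of_injective _ hinj, Finset.card_univ, Fintype.card_fin] at this
        · omega
        · rw [Finset.mem_insert, not_or]
          exact ⟨hne, hnF x hx.1⟩
      · left
        intro t _ hm
        obtain ⟨x, -, hx, hxt⟩ := (hmem_shade hF hFR t).1 hm
        exact ⟨x, hx, hxt⟩
    · obtain ⟨G, rfl⟩ := all_some hF
      have hG : M' (.shade (some ∘ G)) = M (.shade G) := hsome (.shade G)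
      rcases htame G hb with h1 | h1
      · left
        intro t ht hm
        rw [hG] at hm
        obtain ⟨x, hx, hxt⟩ := h1 t ht hm
        exact ⟨some x, hx, hxt⟩
      · right
        intro x y hx hy hxy
        -- If the new point is an apex over `G`, then `G` fills `Φ`, so every other apex over `G`
        -- lies outside `Φ` and its edge label was chosen by `exists_edge_labels`.
        have new : ∀ y, S.Apex M' none (some ∘ G) → S.Apex M y G →
            (S.nxt (N (.col none)) (M (.col y)) → el none (some y) = h (N (.col none))) ∧
            (S.nxt (M (.col y)) (N (.col none)) → el (some y) none = h (M (.col y))) := by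
          intro y hz hy
          have hGΦ : ∀ l, G l ∈ Φ := fun l => some_mem.1 (hadj_none (hz.2 l))
          have hyΦ : y ∉ Φ := by
            intro hyΦ
            have hsub : insert y (Finset.univ.image G) ⊆ Φ := by
              intro z hz
              rw [Finset.mem_insert, Finset.mem_image] at hz
              rcases hz with rfl | ⟨l, -, rfl⟩
              exacts [hyΦ, hGΦ l]
            have := Finset.card_le_card hsub
            rw [Finset.card_insert_of_notMem, Finset.card_image_of_injective _
              (injective_of_base (L := M) hb), Finset.card_univ, Fintype.card_fin] at this
            · omega
            · intro hmem
              obtain ⟨l, -, rfl⟩ := Finset.mem_image.1 hmem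
              exact S.not_tint_of_base (hb l) hy.1
          rw [hel₁ hyΦ, hel₂ hyΦ]
          refine (he hz.1).2.2.2.2.2 G hGΦ hb (fun l => ?_) h1 y hy
          rw [← hadjR none_mem (some_mem.2 (hGΦ l))]
          exact hz.2 l
        cases x with
        | none =>
          cases y with
          | none => exact (S.nxt_irrefl hxy).elim
          | some y => exact (new y hx hy).1 hxy
        | some x =>
          cases y with
          | none => exact (new x hy hx).2 hxy
          | some y => exact h1 x y hx hy hxy

end Extension

/-! ### Atoms as types of tuples, and their complex algebra -/

variable {m : ℕ} {D : Type v} (S : LabelSys m D)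

/-- An atom: the isomorphism type of an `m + 1`-tuple in a valid structure, given by an
equality pattern and labels. -/
@[ext]
structure Atom where
  E : Fin (m + 1) → Fin (m + 1) → Prop
  L : Pos m (Fin (m + 1)) → D
  good : ∃ r : Fin (m + 1) → Fin (m + 1), (∀ j k, E j k ↔ r j = r k) ∧
    (∀ p, L (p.map r) = L p) ∧ S.Valid L

variable {S}

/-- The map `r` selects one coordinate for each point occurring in the tuple. Coordinates naming the
same point are interchangeable for the labels. -/
theorem good_of_tuple {X : Type} {M : Pos m X → D} (hM : S.Valid M) (s : Fin (m + 1) → X) :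
    ∃ r : Fin (m + 1) → Fin (m + 1), (∀ j k, s j = s k ↔ r j = r k) ∧
      (∀ p : Pos m (Fin (m + 1)), M ((p.map r).map s) = M (p.map s)) ∧
      S.Valid (fun p => M (p.map s)) := by
  have hr : ∀ j, s (Function.invFun s (s j)) = s j := fun j => Function.invFun_eq ⟨j, rfl⟩
  refine ⟨Function.invFun s ∘ s, fun j k => ⟨fun h => congrArg (Function.invFun s) h, fun h => ?_⟩,
    fun p => ?_, hM.comap s⟩
  · rw [← hr j, ← hr k]; exact congrArg s h
  · rw [Pos.map_map, show s ∘ Function.invFun s ∘ s = s from funext hr]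

/-- The type of a tuple in a valid structure. -/
def typ {X : Type} (M : Pos m X → D) (hM : S.Valid M) (s : Fin (m + 1) → X) : S.Atom where
  E j k := s j = s k
  L p := M (p.map s)
  good := good_of_tuple hM s

namespace Atom

theorem valid (a : S.Atom) : S.Valid a.L := a.good.choose_spec.2.2

theorem E_refl (a : S.Atom) (j : Fin (m + 1)) : a.E j j := by
  obtain ⟨r, hr, -⟩ := a.good
  exact (hr j j).2 rfl

theorem L_map_eq (a : S.Atom) {J : Set (Fin (m + 1))} {q q' : Fin (m + 1) → Fin (m + 1)}
    (hq : ∀ k ∈ J, a.E (q k) (q' k)) {p : Pos m (Fin (m + 1))} (hp : p.In J) :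
    a.L (p.map q) = a.L (p.map q') := by
  obtain ⟨r, hr, hL, -⟩ := a.good
  rw [← hL (p.map q), ← hL (p.map q'), Pos.map_map, Pos.map_map,
    Pos.map_congr hp (f := r ∘ q) (g := r ∘ q') fun k hk => (hr _ _).1 (hq k hk)]

theorem L_map_self (a : S.Atom) {J : Set (Fin (m + 1))} {q : Fin (m + 1) → Fin (m + 1)}
    (hq : ∀ k ∈ J, a.E (q k) k) {p : Pos m (Fin (m + 1))} (hp : p.In J) :
    a.L (p.map q) = a.L p := by
  rw [a.L_map_eq (q' := id) hq hp, Pos.map_id]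

/-- Substitution in an atom. -/
def comp (a : S.Atom) (τ : Fin (m + 1) → Fin (m + 1)) : S.Atom where
  E j k := a.E (τ j) (τ k)
  L p := a.L (p.map τ)
  good := by
    obtain ⟨r, hr, hL, hv⟩ := a.good
    obtain ⟨r', h1, h2, h3⟩ := good_of_tuple hv (r ∘ τ)
    have key : ∀ p : Pos m (Fin (m + 1)), a.L (p.map (r ∘ τ)) = a.L (p.map τ) := fun p => by
      rw [← Pos.map_map, hL]
    simp only [key] at h2 h3
    exact ⟨r', fun j k => (hr _ _).trans (h1 j k), h2, h3⟩

theorem comp_comp (a : S.Atom) (σ τ : Fin (m + 1) → Fin (m + 1)) :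
    (a.comp σ).comp τ = a.comp (σ ∘ τ) := by
  ext1
  · rfl
  · funext p; simp only [comp, Pos.map_map]

theorem comp_self (a : S.Atom) {q : Fin (m + 1) → Fin (m + 1)} (hq : ∀ k, a.E (q k) k) :
    a.comp q = a := by
  obtain ⟨r, hr, -⟩ := a.good
  ext1
  · funext j k
    exact propext (by simp only [comp, hr, (hr _ _).1 (hq _)])
  · funext p
    exact a.L_map_self (fun k _ => hq k) p.in_univ

theorem comp_id (a : S.Atom) : a.comp id = a := a.comp_self a.E_refl

/-- Two atoms agree on a set of coordinates. -/
def Agree (J : Set (Fin (m + 1))) (a b : S.Atom) : Prop :=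
  (∀ j ∈ J, ∀ k ∈ J, a.E j k ↔ b.E j k) ∧ ∀ p : Pos m (Fin (m + 1)), p.In J → a.L p = b.L p

variable {J J' : Set (Fin (m + 1))} {a b c : S.Atom}

theorem Agree.refl (J : Set (Fin (m + 1))) (a : S.Atom) : Agree J a a :=
  ⟨fun _ _ _ _ => Iff.rfl, fun _ _ => rfl⟩

theorem Agree.symm (h : Agree J a b) : Agree J b a :=
  ⟨fun j hj k hk => (h.1 j hj k hk).symm, fun p hp => (h.2 p hp).symm⟩

theorem Agree.trans (h : Agree J a b) (h' : Agree J b c) : Agree J a c :=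
  ⟨fun j hj k hk => (h.1 j hj k hk).trans (h'.1 j hj k hk),
    fun p hp => (h.2 p hp).trans (h'.2 p hp)⟩

theorem Agree.mono (h : Agree J a b) (hJ : J' ⊆ J) : Agree J' a b :=
  ⟨fun j hj k hk => h.1 j (hJ hj) k (hJ hk), fun p hp => h.2 p (hp.mono hJ)⟩

theorem Agree.eq (h : Agree Set.univ a b) : a = b := by
  ext1
  · funext j k; exact propext (h.1 j trivial k trivial)
  · funext p; exact h.2 p p.in_univ

theorem Agree.comp (h : Agree J a b) {τ : Fin (m + 1) → Fin (m + 1)} (hτ : ∀ k ∈ J', τ k ∈ J) :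
    Agree J' (a.comp τ) (b.comp τ) :=
  ⟨fun j hj k hk => h.1 _ (hτ j hj) _ (hτ k hk),
    fun _ hp => h.2 _ (Pos.in_map.2 (hp.mono hτ))⟩

theorem agree_comp_congr (a : S.Atom) {σ τ : Fin (m + 1) → Fin (m + 1)} (h : ∀ k ∈ J, σ k = τ k) :
    Agree J (a.comp σ) (a.comp τ) := by
  refine ⟨fun j hj k hk => ?_, fun p hp => ?_⟩
  · simp only [Atom.comp, h j hj, h k hk]
  · simp only [Atom.comp, Pos.map_congr hp h]

end Atom

/-- A tuple in a structure has on the coordinates in `J` the type prescribed by an atom. -/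
def Realizes {X : Type} (M : Pos m X → D) (s : Fin (m + 1) → X) (J : Set (Fin (m + 1)))
    (b : S.Atom) : Prop :=
  (∀ j ∈ J, ∀ k ∈ J, s j = s k ↔ b.E j k) ∧
    ∀ p : Pos m (Fin (m + 1)), p.In J → M (p.map s) = b.L p

/-- If `b` identifies `j` with a coordinate in `J`, the required point is present, and the added one
is a mere duplicate. Otherwise the points named by `J` are amalgamated with a new point whose labels
are read from `b` along `ρ`. A coordinate outside `J` other than `j` leaves fewer than m old points,
so no red label is forced and `h` is irrelevant. -/
theorem exists_realizes {X : Type} {M : Pos m X → D} (hM : S.Valid M) {s : Fin (m + 1) → X}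
    {J : Set (Fin (m + 1))} {j : Fin (m + 1)} (hj : j ∉ J) {b : S.Atom} (hs : Realizes M s J b)
    {h : D → D} (hgood : (∃ i, i ∉ J ∧ i ≠ j) ∨ S.Descending h ∧ S.Tame h M) :
    ∃ M' : Pos m (Option X) → D, S.Valid M' ∧ (∀ p, M' (p.map some) = M p) ∧
      (S.Tame h M → S.Tame h M') ∧
      ∃ z, Realizes M' (Function.update (some ∘ s) j z) (insert j J) b := by
  classical
  obtain ⟨r, hr, hL, hv⟩ := b.good
  by_cases hE : ∃ i ∈ J, b.E j i
  · obtain ⟨i, hi, hji⟩ := hE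
    let ψ : Option X → X := fun x => x.elim (s i) id
    have hψ : Function.Surjective ψ := fun x => ⟨some x, rfl⟩
    let q : Fin (m + 1) → Fin (m + 1) := Function.update id j i
    have hq : ∀ k, b.E (q k) k := by
      intro k
      by_cases hk : k = j
      · subst hk
        simp only [q, Function.update_self]
        exact (hr _ _).2 ((hr _ _).1 hji).symm
      · simp only [q, Function.update_of_ne hk]
        exact b.E_refl k
    have hqJ : ∀ k ∈ insert j J, q k ∈ J := by
      intro k hk
      by_cases hkj : k = j
      · subst hkj; simpa [q] using hi
      · simpa [q, hkj] using hk
    have hs' : ∀ k, Function.update (some ∘ s) j (some (s i)) k = some (s (q k)) := by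
      intro k
      by_cases hk : k = j
      · subst hk; simp [q]
      · simp [q, hk]
    refine ⟨fun p => M (p.map ψ), hM.comap ψ, fun p => ?_, fun ht => ht.comap hψ, some (s i),
      fun k hk l hl => ?_, fun p hp => ?_⟩
    · beta_reduce
      rw [Pos.map_map, show ψ ∘ some = id from rfl, Pos.map_id]
    · rw [hs', hs', Option.some_inj, hs.1 _ (hqJ k hk) _ (hqJ l hl), hr, hr,
        (hr _ _).1 (hq k), (hr _ _).1 (hq l)]
    · beta_reduce
      rw [Pos.map_map, show ψ ∘ Function.update (some ∘ s) j (some (s i)) = s ∘ q from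
        funext fun k => by simp only [Function.comp, hs']; rfl, ← Pos.map_map,
        hs.2 _ (Pos.in_map.2 (hp.mono hqJ)), b.L_map_self (fun k _ => hq k) p.in_univ]
  · let Φ : Finset X := J.toFinset.image s
    have hΦ : ∀ {x}, x ∈ Φ ↔ ∃ i ∈ J, s i = x := by simp [Φ]
    let σ : X → Fin (m + 1) := fun x => if hx : ∃ i ∈ J, s i = x then hx.choose else j
    have hσ : ∀ x, (∃ i ∈ J, s i = x) → σ x ∈ J ∧ s (σ x) = x := by
      intro x hx
      rw [show σ x = hx.choose from dif_pos hx]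
      exact hx.choose_spec
    let ρ : Option X → Fin (m + 1) := fun x => x.elim j σ
    have hcardJ : J.toFinset.card ≤ m := by
      have : J.toFinset.card < Fintype.card (Fin (m + 1)) :=
        Finset.card_lt_univ_of_notMem (x := j) (by simpa using hj)
      rw [Fintype.card_fin] at this
      omega
    have hcard : Φ.card ≤ J.toFinset.card := Finset.card_image_le
    have hgood' : Φ.card < m ∨ S.Descending h ∧ S.Tame h M := by
      refine hgood.imp_left fun ⟨i, hiJ, hij⟩ => lt_of_le_of_lt hcard ?_
      have hsub : insert i (insert j J.toFinset) ⊆ Finset.univ := Finset.subset_univ _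
      have := Finset.card_le_card hsub
      rw [Finset.card_insert_of_notMem (by simp [hij, hiJ]),
        Finset.card_insert_of_notMem (by simpa using hj), Finset.card_univ, Fintype.card_fin] at this
      omega
    obtain ⟨M', hM', hext, hnew, ht⟩ := exists_extension (N := fun p => b.L (p.map ρ))
      (hcard.trans hcardJ) hM (hv.comap ρ) (fun p hp => by
        have e1 : (p.map some).map ρ = p.map σ := by rw [Pos.map_map]; rfl
        rw [e1, ← hs.2 (p.map σ) (Pos.in_map.2 (hp.mono fun x hx => (hσ x (hΦ.1 hx)).1)),
          Pos.map_map, Pos.map_congr hp (f := s ∘ σ) (g := id) fun x hx => (hσ x (hΦ.1 hx)).2,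
          Pos.map_id]) hgood'
    have hne : ∀ k ∈ J, k ≠ j := fun k hk e => hj (e ▸ hk)
    refine ⟨M', hM', hext, ht, none, ?_, fun p hp => ?_⟩
    · have h0 : ∀ k ∈ J, ¬ b.E j k ∧ ¬ b.E k j := fun k hk =>
        ⟨fun e => hE ⟨k, hk, e⟩, fun e => hE ⟨k, hk, (hr _ _).2 ((hr _ _).1 e).symm⟩⟩
      rintro k (rfl | hk) l (rfl | hl)
      · simp [b.E_refl]
      · simp [hne l hl, h0 l hl]
      · simp [hne k hk, h0 k hk]
      · simpa [hne l hl, hne k hk] using hs.1 k hk l hl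
    · rw [hnew, Pos.map_map, b.L_map_self (J := insert j J) _ hp]
      · rintro k (rfl | hk)
        · simpa [ρ] using b.E_refl k
        · have hk' := hσ (s k) ⟨k, hk, rfl⟩
          simp only [Function.comp, Function.update_of_ne (hne k hk), ρ, Option.elim]
          exact (hs.1 _ hk'.1 _ hk).1 hk'.2
      · rw [Pos.in_map]
        refine hp.mono ?_
        rintro k (rfl | hk)
        · simp
        · simp only [Set.mem_preimage, Function.update_of_ne (hne k hk)]
          exact Or.inr ⟨s k, hΦ.2 ⟨k, hk, rfl⟩, rfl⟩

/-- Amalgamation of atoms. -/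
theorem Atom.exists_amalgam {a b : S.Atom} {J : Set (Fin (m + 1))} {i : Fin (m + 1)} (hi : i ∉ J)
    (hab : Atom.Agree J a b) : ∃ c : S.Atom, Atom.Agree {i}ᶜ a c ∧ Atom.Agree (insert i J) c b := by
  -- With a further coordinate outside `J`, amalgamation needs no descending function. Otherwise `J`
  -- is the complement of `i`, and `b` itself is the amalgam.
  by_cases hJ : ∃ k, k ∉ J ∧ k ≠ i
  · obtain ⟨r, hr, hL, hv⟩ := a.good
    have hs : Realizes a.L r J b :=
      ⟨fun j hj k hk => (hr j k).symm.trans (hab.1 j hj k hk), fun p hp => (hL p).trans (hab.2 p hp)⟩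
    obtain ⟨M', hM', hext, -, z, hz⟩ := exists_realizes hv hi hs (h := id) (Or.inl hJ)
    have hne : ∀ k ∈ ({i}ᶜ : Set (Fin (m + 1))), Function.update (some ∘ r) i z k = some (r k) :=
      fun k hk => Function.update_of_ne hk _ _
    refine ⟨typ M' hM' (Function.update (some ∘ r) i z), ⟨fun j hj k hk => ?_, fun p hp => ?_⟩, hz⟩
    · simp only [typ, hne j hj, hne k hk, Option.some_inj, hr]
    · simp only [typ]
      rw [Pos.map_congr hp hne, ← hL p, ← hext, Pos.map_map]
      rfl
  · push Not at hJ
    refine ⟨b, hab.mono fun k hk => ?_, Atom.Agree.refl _ _⟩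
    by_contra hkJ
    exact hk (hJ k hkJ)

variable (S) in
/-- The complex algebra of the atoms. -/
def cm : Alg.{max u v} .PEA (Fin (m + 1)) where
  carrier := Set (ULift.{u} S.Atom)
  una := fun o X => match o with
    | .cyl i => {a | ∃ b ∈ X, Atom.Agree {i}ᶜ a.down b.down}
    | .sub _ τ => {a | ⟨a.down.comp τ⟩ ∈ X}
    | .repl h _ _ => h.elim
    | .swap h _ _ => h.elim
  nul := fun o => match o with
    | .diag _ i j => {a | a.down.E i j}

/-- Amalgamation of atoms enters twice: in the commutation of cylindrifications and in one inclusion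
of the law for a singleton preimage. The other laws are computations with patterns and labels. -/
theorem cm_mem_PEA : cm.{u} S ∈ PEA.{max u v} (m + 1) := by
  have cyl_comm : ∀ i j (X : Set (ULift.{u} S.Atom)),
      {a : ULift.{u} S.Atom | ∃ b ∈ {b : ULift.{u} S.Atom | ∃ c ∈ X, Atom.Agree {j}ᶜ b.down c.down},
        Atom.Agree {i}ᶜ a.down b.down} ⊆
      {a | ∃ b ∈ {b : ULift.{u} S.Atom | ∃ c ∈ X, Atom.Agree {i}ᶜ b.down c.down},
        Atom.Agree {j}ᶜ a.down b.down} := by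
    rintro i j X a ⟨b, ⟨c, hc, hbc⟩, hab⟩
    by_cases hij : i = j
    · subst hij; exact ⟨b, ⟨c, hc, hbc⟩, hab⟩
    have hac : Atom.Agree ({i, j}ᶜ : Set (Fin (m + 1))) a.down c.down :=
      (hab.mono (by simp [Set.subset_def])).trans (hbc.mono (by simp [Set.subset_def]))
    obtain ⟨d, had, hdc⟩ := Atom.exists_amalgam (i := j) (by simp) hac
    refine ⟨⟨d⟩, ⟨c, hc, hdc.mono fun k hk => ?_⟩, had⟩
    by_cases hkj : k = j
    · exact Or.inl hkj
    · refine Or.inr ?_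
      simp only [Set.mem_compl_iff, Set.mem_insert_iff, Set.mem_singleton_iff, not_or]
      exact ⟨hk, hkj⟩
  refine ⟨⟨?_, ?_, ?_, ?_⟩, ?_, ?_, ?_, ?_, ?_, ?_, ?_, ?_, ?_⟩
  · intro i
    refine Set.eq_empty_iff_forall_notMem.2 ?_
    rintro a ⟨b, hb, -⟩
    exact hb
  · exact fun i X a ha => ⟨a, ha, Atom.Agree.refl _ _⟩
  · intro i X Y
    refine Set.Subset.antisymm ?_ ?_
    · rintro a ⟨b, ⟨hbX, c, hc, hbc⟩, hab⟩
      exact ⟨⟨b, hbX, hab⟩, c, hc, hab.trans hbc⟩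
    · rintro a ⟨⟨b, hbX, hab⟩, c, hc, hac⟩
      exact ⟨b, ⟨hbX, c, hc, hab.symm.trans hac⟩, hab⟩
  · intro i j X
    exact Set.Subset.antisymm (cyl_comm i j X) (cyl_comm j i X)
  · intro (X : Set (ULift.{u} S.Atom))
    refine Set.ext fun a => ?_
    show (⟨a.down.comp id⟩ : ULift.{u} S.Atom) ∈ X ↔ a ∈ X
    rw [Atom.comp_id]
  · intro σ τ (X : Set (ULift.{u} S.Atom))
    refine Set.ext fun a => ?_
    show (⟨a.down.comp (σ ∘ τ)⟩ : ULift.{u} S.Atom) ∈ X ↔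
      (⟨(a.down.comp σ).comp τ⟩ : ULift.{u} S.Atom) ∈ X
    rw [Atom.comp_comp]
  · exact fun τ => ⟨fun X Y => rfl, fun X => rfl⟩
  · intro σ τ i X h
    have key : ∀ (σ τ : Fin (m + 1) → Fin (m + 1)) (a : S.Atom), (∀ k, k ≠ i → σ k = τ k) →
        Atom.Agree {i}ᶜ (a.comp τ) (a.comp σ) := fun σ τ a h =>
      a.agree_comp_congr fun k hk => (h k hk).symm
    refine Set.ext fun a => ⟨?_, ?_⟩ <;> rintro ⟨b, hb, hab⟩
    · exact ⟨b, hb, (key σ τ a.down h).trans hab⟩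
    · exact ⟨b, hb, (key τ σ a.down fun k hk => (h k hk).symm).trans hab⟩
  · intro τ i j (X : Set (ULift.{u} S.Atom)) hτ
    have h1 : ∀ k, τ k = i ↔ k = j := fun k => by
      have := Set.ext_iff.1 hτ k; simpa using this
    refine Set.ext fun a => ⟨?_, ?_⟩
    · rintro ⟨b, hb, hab⟩
      exact ⟨_, hb, hab.comp fun k hk e => hk ((h1 k).1 e)⟩
    · rintro ⟨⟨b⟩, hb, hab⟩
      have hab : Atom.Agree {j}ᶜ (a.down.comp τ) b := hab
      -- Although `τ` need not be injective, `b` agrees with `a.comp τ` off `j` and so identifies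
      -- coordinates with equal image. Hence `b.comp g` carries all information of `b` on the range
      -- of `τ`.
      let g := Function.invFun τ
      have hg : ∀ k, τ (g (τ k)) = τ k := fun k => Function.invFun_eq ⟨k, rfl⟩
      have hgj : g (τ j) = j := by rw [← h1, hg, h1]
      have hgne : ∀ k, k ≠ j → g (τ k) ≠ j := fun k hk e => by
        rw [← h1, hg, h1] at e; exact hk e
      have hbE : ∀ k, b.E (g (τ k)) k := by
        intro k
        by_cases hk : k = j
        · subst hk; rw [hgj]; exact b.E_refl k
        · refine (hab.1 _ (hgne k hk) _ hk).1 ?_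
          show a.down.E (τ (g (τ k))) (τ k)
          rw [hg]
          exact a.down.E_refl _
      have hagree : Atom.Agree (τ '' {j}ᶜ) a.down (b.comp g) := by
        refine ⟨?_, fun p hp => ?_⟩
        · rintro _ ⟨k, hk, rfl⟩ _ ⟨l, hl, rfl⟩
          have := hab.1 _ (hgne k hk) _ (hgne l hl)
          simp only [Atom.comp, hg] at this
          exact this
        · have h2 : (p.map g).In ({j}ᶜ : Set (Fin (m + 1))) :=
            Pos.in_map.2 (hp.mono (by rintro _ ⟨k, hk, rfl⟩; exact hgne k hk))
          have := hab.2 _ h2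
          simp only [Atom.comp, Pos.map_map] at this ⊢
          rw [← this, Pos.map_congr hp (f := τ ∘ g) (g := id), Pos.map_id]
          rintro _ ⟨k, -, rfl⟩
          exact hg k
      obtain ⟨c, hac, hcb⟩ := Atom.exists_amalgam (i := i) (by
        rintro ⟨k, hk, e⟩; exact hk ((h1 k).1 e)) hagree
      refine ⟨⟨c⟩, ?_, hac⟩
      show (⟨c.comp τ⟩ : ULift.{u} S.Atom) ∈ X
      have hJ : ∀ k ∈ (Set.univ : Set (Fin (m + 1))), τ k ∈ insert i (τ '' {j}ᶜ) := by
        intro k _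
        by_cases hk : k = j
        · exact Or.inl ((h1 k).2 hk)
        · exact Or.inr ⟨k, hk, rfl⟩
      rw [(hcb.comp hJ).eq, Atom.comp_comp, Atom.comp_self b (q := g ∘ τ) hbE]
      exact hb
  · intro τ i (X : Set (ULift.{u} S.Atom)) hτ
    refine Set.Subset.antisymm ?_ fun a ha => ⟨a, ha, Atom.Agree.refl _ _⟩
    rintro a ⟨b, hb, hab⟩
    have h1 : ∀ k ∈ (Set.univ : Set (Fin (m + 1))), τ k ∈ ({i}ᶜ : Set (Fin (m + 1))) := by
      intro k _ hk
      have := Set.ext_iff.1 hτ k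
      simp at hk
      simp [hk] at this
    show (⟨a.down.comp τ⟩ : ULift.{u} S.Atom) ∈ X
    rw [(hab.comp h1).eq]
    exact hb
  · intro i
    exact Set.eq_univ_of_forall fun a => a.down.E_refl i
  · intro i j (X : Set (ULift.{u} S.Atom))
    rintro a ⟨ha, hE⟩
    have hE : a.down.E i j := hE
    show (⟨a.down.comp (replace i j)⟩ : ULift.{u} S.Atom) ∈ X
    rw [Atom.comp_self]
    · exact ha
    · intro k
      by_cases hk : k = i
      · subst hk
        rw [replace_apply_self]
        obtain ⟨r, hr, -⟩ := a.down.good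
        exact (hr _ _).2 ((hr _ _).1 hE).symm
      · rw [replace_apply_of_ne hk]
        exact a.down.E_refl k
  · intro τ i j
    rfl

end LabelSys

/-! ### The algebra of the standard labels -/

namespace LabelSys

/-- The standard label system: labels are natural numbers. -/
def std (m : ℕ) : LabelSys m ℕ where
  base l d := d = l
  tint d := m ≤ d
  nxt d d' := m ≤ d ∧ d' = d + 1
  adj d := d ≠ 0
  white l d := d = l
  red d := m ≤ d
  dec d d' := d = d' + 1
  mem t y := y = 0 ∨ (y - 1).testBit t = true
  base_unique h h' := Fin.ext (h.symm.trans h')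
  not_tint_of_base {l d} h := by have := l.2; omega
  tint_of_nxt h := by omega
  nxt_irrefl h := by omega
  nxt_nxt_ne h h' := by omega
  white_unique h h' := Fin.ext (h.symm.trans h')
  not_red_of_white {l d} h := by have := l.2; omega
  red_of_not_white {d} h := by
    by_contra hd
    exact h ⟨d, by omega⟩ rfl
  exists_not_adj := ⟨0, by simp⟩
  exists_white l := ⟨l, rfl⟩
  exists_shade T := by
    -- A nonzero shade `y` lists the binary digits of `y - 1`; the value 0 is reserved for the
    -- unrestricted shade. Inserting `a` sets bit `a`.
    induction T using Finset.induction_on with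
    | empty => exact ⟨1, fun t => by simp⟩
    | insert a T _ ih =>
      obtain ⟨y, hy⟩ := ih
      have hy0 : y ≠ 0 := by
        rintro rfl
        obtain ⟨t, ht⟩ := Infinite.exists_notMem_finset T
        exact ht ((hy t).1 (Or.inl rfl))
      refine ⟨((y - 1) ||| 2 ^ a) + 1, fun t => ?_⟩
      have hy' : (y - 1).testBit t = true ↔ t ∈ T := by rw [← hy t]; simp [hy0]
      rw [Finset.mem_insert, ← hy', Nat.add_sub_cancel, Nat.testBit_or, Nat.testBit_two_pow,
        Bool.or_eq_true, decide_eq_true_eq, @eq_comm _ a t, or_comm (a := t = a)]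
      exact ⟨fun h => h.resolve_left (Nat.succ_ne_zero _), Or.inr⟩

variable {m : ℕ}

/-- The atom of a base with unrestricted shade and an apex of tint `i`. -/
def apexAtom (m i : ℕ) : (std m).Atom where
  E j k := j = k
  L
    | .col k => if k = Fin.last m then m + i else k
    | .adj _ _ => 1
    | .el _ _ => m
    | .shade _ => 0
  good := by
    refine ⟨id, fun _ _ => Iff.rfl, fun p => by rw [Pos.map_id], ⟨?_, ?_, ?_⟩⟩
    -- All edges have the label m, which is red and hence not white. The chain constraint is vacuous
    -- because only the last coordinate is tinted.
    · intro l x y q _ _ _ _ _ (hw : m = l)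
      exact absurd hw (by have := l.2; omega)
    · rintro x y w ⟨hx, hxy⟩
      simp only at hx hxy
      have lt : ∀ z : Fin (m + 1), z ≠ Fin.last m → z.val < m := fun z hz => Fin.val_lt_last hz
      have := lt x
      have := lt y
      split_ifs at hx hxy with h1 h2 <;> grind
    · intro x F _ _ _
      exact Or.inl rfl

theorem apexAtom_injective : Function.Injective (apexAtom m) := by
  intro i j h
  have := congrArg (fun a => Atom.L a (.col (Fin.last m))) h
  simpa [apexAtom] using this

theorem apexAtom_agree (i j : ℕ) : Atom.Agree {Fin.last m}ᶜ (apexAtom m i) (apexAtom m j) := by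
  refine ⟨fun _ _ _ _ => Iff.rfl, fun p hp => ?_⟩
  cases p with
  | col k =>
    have hk : k ≠ Fin.last m := hp
    simp [apexAtom, hk]
  | _ => rfl

theorem cm_cyl_closed {D : Type v} {S : LabelSys m D} {j : Fin (m + 1)}
    {X : Set (ULift.{u} S.Atom)}
    (h : ∀ a b : S.Atom, Atom.Agree {j}ᶜ a b → (⟨b⟩ : ULift.{u} S.Atom) ∈ X → ⟨a⟩ ∈ X) :
    (cm.{u} S).una (.cyl j) X = X := by
  refine Set.Subset.antisymm ?_ fun a ha => ⟨a, ha, Atom.Agree.refl _ _⟩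
  rintro a ⟨b, hb, hab⟩
  exact h a.down b.down hab hb

/-- The apexes of `apexAtom` share one base with unrestricted shade, one for each tint, and form the
sequence to which `false_of_descent` applies. The base point of sort `l` sits at coordinate `l`, the
apex at the last coordinate, and edge labels are read at the coordinates 0 and m. -/
theorem cm_std_not_neat (hm : 2 ≤ m) {β : Type} {C : Type u} [BooleanAlgebra C] {c : β → C → C}
    {s : β → β → C → C} {ι : Fin (m + 1) → β} {σ : Fin 3 → β} {f : (cm.{u} (std m)) → C}
    (hf : NeatMap (fun i => (cm.{u} (std m)).una (.cyl i))
      (fun i j => (cm.{u} (std m)).una (.sub trivial (replace i j))) c s ι σ f)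
    (hbot : ∀ x, f x = ⊥ → x = ⊥) : False := by
  let o : Fin (m + 1) := Fin.last m
  let a : Fin (m + 1) := ⟨0, by omega⟩
  let b : Fin (m + 1) := ⟨1, by omega⟩
  have hab : a ≠ b := by simp [a, b]
  have hao : a ≠ o := by simp [a, o, Fin.ext_iff]; omega
  have hbo : b ≠ o := by simp [b, o, Fin.ext_iff]; omega
  let W' := ULift.{u} (std m).Atom
  let θ : ℕ → Set W' := fun i => {⟨apexAtom m i⟩}
  let φ : Set W' := {x | Atom.Agree {o}ᶜ x.down (apexAtom m 0)}
  let G : Fin (m + 1) → ℕ → Set W' := fun l i => {x | x.down.L (.col o) = m + i ∧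
    x.down.L (.col l) = l ∧ x.down.L (.adj o l) ≠ 0}
  let W : Fin (m + 1) → Set W' := fun l => {x | x.down.L (.el a o) = l}
  let E : ℕ → Set W' := fun k => {x | x.down.L (.el a o) = m + k}
  let V : ℕ → Set W' := fun i => {x | x.down.L (.col o) = m + i}
  refine hf.false_of_descent hab hao hbo (θ := θ) (φ := φ) (L := {o}ᶜ) (G := G) (W := W) (E := E)
    (V := V) ?_ ?_ ?_ ?_ ?_ ?_ ?_ ?_ ?_ ?_ ?_
  · intro i
    refine Set.ext fun x => ⟨?_, ?_⟩
    · rintro ⟨_, rfl, h⟩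
      exact h.trans (apexAtom_agree i 0)
    · intro h
      exact ⟨_, rfl, Atom.Agree.trans h (apexAtom_agree 0 i)⟩
  · intro h
    exact Set.singleton_ne_empty _ (hbot _ h)
  · rintro l hl i _ rfl
    have hl : l ≠ Fin.last m := hl
    exact ⟨if_pos rfl, if_neg hl, one_ne_zero⟩
  · rintro i _ rfl
    exact if_pos rfl
  · intro l hl i k hkl hko
    refine cm_cyl_closed fun x y hxy hy => ?_
    have e1 := hxy.2 (.col o) hko.symm
    have e2 := hxy.2 (.col l) hkl.symm
    have e3 := hxy.2 (.adj o l) ⟨hko.symm, hkl.symm⟩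
    exact ⟨e1.trans hy.1, e2.trans hy.2.1, fun h => hy.2.2 (e3.symm.trans h)⟩
  · intro i k hko
    refine cm_cyl_closed fun x y hxy hy => ?_
    have e1 := hxy.2 (.col o) hko.symm
    exact e1.trans hy
  · intro l hl
    refine cm_cyl_closed fun x y hxy hy => ?_
    have e1 := hxy.2 (.el a o) ⟨hab, hbo.symm⟩
    exact e1.trans hy
  · intro k
    refine cm_cyl_closed fun x y hxy hy => ?_
    have e1 := hxy.2 (.el a o) ⟨hab, hbo.symm⟩
    exact e1.trans hy
  · intro l hl i j k hkl hko
    refine Set.eq_empty_iff_forall_notMem.2 ?_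
    rintro x ⟨⟨h1, h2⟩, h3⟩
    have hlo : l ≠ o := hl
    have h1 : x.down.L (.col (replace o k o)) = m + i ∧ x.down.L (.col (replace o k l)) = l ∧
      x.down.L (.adj (replace o k o) (replace o k l)) ≠ 0 := h1
    have h3 : x.down.L (.el (replace a k a) (replace a k o)) = l := h3
    rw [replace_apply_self, replace_apply_of_ne hlo] at h1
    rw [replace_apply_self, replace_apply_of_ne hao.symm] at h3
    have hlm : l.val < m := Fin.val_lt_last hlo
    refine x.down.valid.white ⟨l, hlm⟩ k o l ?_ ?_ h1.2.1 h1.2.2 h2.2.2 h3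
    · show m ≤ _
      rw [h1.1]; omega
    · show m ≤ _
      rw [h2.1]; omega
  · intro i k k' k'' hk
    refine Set.eq_empty_iff_forall_notMem.2 ?_
    rintro x ⟨⟨⟨⟨⟨h1, h2⟩, h3⟩, h4⟩, h5⟩, h6⟩
    have h1 : x.down.L (.col (replace o a o)) = m + i := h1
    have h2 : x.down.L (.col (replace o b o)) = m + (i + 1) := h2
    have h3 : x.down.L (.col o) = m + (i + 2) := h3
    have h4 : x.down.L (.el (replace o b a) (replace o b o)) = m + k := h4
    have h5 : x.down.L (.el (replace a b a) (replace a b o)) = m + k' := h5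
    have h6 : x.down.L (.el a o) = m + k'' := h6
    rw [replace_apply_self] at h1 h2
    rw [replace_apply_self, replace_apply_of_ne hao] at h4
    rw [replace_apply_self, replace_apply_of_ne hao.symm] at h5
    have := x.down.valid.chain a b o (by rw [h1, h2]; exact ⟨by omega, by omega⟩)
      (by rw [h2, h3]; exact ⟨by omega, by omega⟩) (by rw [h4]; exact Nat.le_add_right _ _)
      (by rw [h5]; exact Nat.le_add_right _ _) (by rw [h6]; exact Nat.le_add_right _ _)
    rw [h4, h5] at this
    have : m + k = m + k' + 1 := this
    omega
  -- Labels below m are white and the others are red, so every atom is covered.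
  · refine ⟨fun _ _ => le_top, fun Y hY => ?_⟩
    rintro x -
    by_cases hx : x.down.L (.el a o) < m
    · refine hY (Or.inl ⟨⟨x.down.L (.el a o), by omega⟩, ?_, rfl⟩) rfl
      intro e
      have : x.down.L (.el a o) = m := congrArg Fin.val e
      omega
    · exact hY (Or.inr ⟨x.down.L (.el a o) - m, rfl⟩) (show x.down.L (.el a o) = _ by omega)

theorem cm_isAtomic {D : Type v} (S : LabelSys m D) : IsAtomic (cm.{u} S) :=
  inferInstanceAs (IsAtomic (Set (ULift.{u} S.Atom)))

theorem finite_pos (X : Type) [Finite X] : Finite (Pos m X) := by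
  let f : Pos m X → X ⊕ (X × X) ⊕ (X × X) ⊕ (Fin m → X)
    | .col x => .inl x
    | .adj x y => .inr (.inl (x, y))
    | .el x y => .inr (.inr (.inl (x, y)))
    | .shade F => .inr (.inr (.inr F))
  refine Finite.of_injective f fun p q h => ?_
  cases p <;> cases q <;> simp_all [f]

theorem countable_atom {D : Type v} [Countable D] (S : LabelSys m D) : Countable S.Atom := by
  have := finite_pos (m := m) (Fin (m + 1))
  refine Function.Injective.countable (f := fun a : S.Atom => (a.E, a.L)) fun a b h => ?_
  exact Atom.ext (congrArg Prod.fst h) (congrArg Prod.snd h)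

theorem countable_atoms_cm {D : Type v} [Countable D] (S : LabelSys m D) :
    {a : cm.{u} S | IsAtom a}.Countable := by
  have := countable_atom S
  refine (Set.countable_range fun a : S.Atom => ({⟨a⟩} : Set (ULift.{u} S.Atom))).mono ?_
  intro X hX
  obtain ⟨a, rfl⟩ := Set.isAtom_iff.1 (show IsAtom (X : Set (ULift.{u} S.Atom)) from hX)
  exact ⟨a.down, rfl⟩

end LabelSys

open FirstOrder

/-! ### Reducts of polyadic equality algebras -/

section Reducts

variable {α : Type} [DecidableEq α]

/-- The unary operations of each type, as polyadic operations. -/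
def UnOp.toPEA {K : Kind} : UnOp K α → UnOp .PEA α
  | .cyl i => .cyl i
  | .repl _ i j => .sub trivial (replace i j)
  | .swap _ i j => .sub trivial (Equiv.swap i j)
  | .sub _ τ => .sub trivial τ

/-- The constants of each type, as polyadic constants. -/
def NulOp.toPEA {K : Kind} : NulOp K α → NulOp .PEA α
  | .diag _ i j => .diag trivial i j

/-- The reduct of an algebra of polyadic type to any of the types. -/
def Alg.rd (K : Kind) (A : Alg.{u} .PEA α) : Alg.{u} K α := A.reduct UnOp.toPEA NulOp.toPEA

theorem rd_Sc (A : Alg.{u} .PEA α) : A.rd .Sc = A.rdSc := by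
  unfold Alg.rd Alg.rdSc
  congr 1
  · funext o
    cases o with
    | cyl i => rfl
    | repl h i j => rfl
    | swap h i j => exact h.elim
    | sub h τ => exact h.elim
  · funext o
    cases o with
    | diag h i j => exact h.elim

theorem rd_QEA (A : Alg.{u} .PEA α) : A.rd .QEA = A.rdQEA := by
  unfold Alg.rd Alg.rdQEA
  congr 1
  funext o
  cases o with
  | cyl i => rfl
  | repl h i j => rfl
  | swap h i j => rfl
  | sub h τ => exact h.elim

/-- The translation of languages underlying the reducts. -/
def rdHom (K : Kind) (α : Type) [DecidableEq α] : lang K α →ᴸ lang .PEA α where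
  onFunction := fun {_} o => match o with
    | .bot => Fn.bot
    | .top => Fn.top
    | .nul o => Fn.nul o.toPEA
    | .compl => Fn.compl
    | .una o => Fn.una o.toPEA
    | .sup => Fn.sup
    | .inf => Fn.inf
  onRelation := fun {_} r => r.elim

theorem rd_realize (K : Kind) (A : Alg.{u} .PEA α) (φ : (lang K α).Sentence) :
    ((A.rd K : Alg.{u} K α) : Type u) ⊨ φ ↔ (A : Type u) ⊨ (rdHom K α).onSentence φ := by
  let _ : (lang .PEA α).Structure (A.rd K) := inferInstanceAs ((lang .PEA α).Structure A)
  have : (rdHom K α).IsExpansionOn (A.rd K) :=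
    ⟨fun {n} f x => by cases f <;> rfl, fun {n} r => r.elim⟩
  exact ((rdHom K α).realize_onSentence (A.rd K) φ).symm

/-- Sentences about a reduct translate into the polyadic language, so equivalence there suffices. -/
theorem IsElementary.rd_mem {K : Kind} {𝒦 : Set (Alg.{u} K α)} (h : IsElementary 𝒦)
    {A B : Alg.{u} .PEA α} (hAB : (lang .PEA α).ElementarilyEquivalent A B) (hB : B.rd K ∈ 𝒦) :
    A.rd K ∈ 𝒦 := by
  obtain ⟨T, hT⟩ := h
  rw [hT, Language.Theory.model_iff] at hB ⊢
  intro φ hφ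
  rw [rd_realize, hAB.realize_sentence, ← rd_realize]
  exact hB φ hφ

end Reducts

/-- Replacements are definable from diagonals. This carries the negative result from `Sc` to types
that have diagonals but no replacements. -/
theorem PEAAxioms.sub_replace {α : Type} [DecidableEq α] {A : Type u} [BooleanAlgebra A]
    {c : α → A → A} {t : (α → α) → A → A} {d : α → α → A} (h : PEAAxioms c t d) {i j : α}
    (hij : i ≠ j) (x : A) : t (replace i j) x = c i (d i j ⊓ x) := by
  refine le_antisymm ?_ ?_
  · have h1 : t (replace i j) (d i j) = ⊤ := by
      rw [h.sub_diag, replace_apply_self, replace_apply_of_ne hij.symm, h.diag_self]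
    calc t (replace i j) x = t (replace i j) (d i j ⊓ x) := by
          rw [(h.sub_endo _).map_inf, h1, top_inf_eq]
      _ ≤ t (replace i j) (c i (d i j ⊓ x)) := (h.sub_endo _).mono (h.le_cyl _ _)
      _ = c i (d i j ⊓ x) := by
          rw [h.sub_cyl_congr (replace i j) id i _ fun k hk => replace_apply_of_ne hk, h.sub_id]
  · rw [← h.cyl_sub_of_empty (replace i j) i x (replace_preimage_empty hij), inf_comm]
    exact h.mono i (h.inf_diag_le i j x)

theorem exists_natAdd {n k : ℕ} {i : Fin (n + k)} (hi : i ∉ Set.range (Fin.castAddEmb (n := n) k)) :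
    ∃ p, Fin.natAdd n p = i := by
  induction i using Fin.addCases with
  | left i => exact (hi ⟨i, rfl⟩).elim
  | right i => exact ⟨i, rfl⟩

theorem natAdd_notMem_range {n k : ℕ} (p : Fin k) :
    Fin.natAdd n p ∉ Set.range (Fin.castAddEmb (n := n) k) := by
  rintro ⟨i, hi⟩
  have := congrArg Fin.val hi
  have h2 := i.2
  simp at this
  omega

/-- A complete embedding into a neat reduct of an algebra with three more dimensions, in which
substitutions `s` are available, is a `NeatMap`. -/
theorem neatMap_of_scNr {K : Kind} {n : ℕ} {A : Alg.{u} K (Fin n)} {C : Alg.{u} K (Fin (n + 3))}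
    {f : A → nr (Fin.castAddEmb 3) C}
    (hf : IsEmbedding (A := A) (B := C.rdDim (Fin.castAddEmb 3))
      (fun x => (f x : C.rdDim (Fin.castAddEmb 3))))
    (hsup : ∀ (S : Set A) (a : A), IsLUB S a → IsLUB (f '' S) (f a))
    {sA : Fin n → Fin n → A → A} {s : Fin (n + 3) → Fin (n + 3) → C → C}
    (hs : ScAxioms (fun i => C.una (.cyl i)) s)
    (hrepl : ∀ i j x, (f (sA i j x)).1 = s (Fin.castAdd 3 i) (Fin.castAdd 3 j) (f x).1) :
    NeatMap (C := C) (fun i => A.una (.cyl i)) sA (fun i => C.una (.cyl i)) s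
      (Fin.castAdd 3) (Fin.natAdd n) (fun x => (f x).1) where
  sc := hs
  ι_inj := Fin.castAdd_injective n 3
  σ_inj := fun p q h => by simpa using h
  ι_ne_σ i p h := natAdd_notMem_range p ⟨i, h⟩
  map_bot := hf.map_bot
  map_inf := hf.map_inf
  map_cyl i x := hf.map_una (.cyl i) x
  map_repl := hrepl
  closed p x := (f x).2 _ (natAdd_notMem_range p)
  dense S hS z hz hzS := by
    let z' : C := z
    -- The complement of `z` lies in the neat reduct and bounds the image of `S`, so it lies above
    -- the image of ⊤.
    have hmem : (z'ᶜ : C) ∈ nr (Fin.castAddEmb 3) C := by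
      intro i hi
      obtain ⟨p, rfl⟩ := exists_natAdd hi
      have := hs.cyl_compl (Fin.natAdd n p) z'
      have hz' : C.una (.cyl (Fin.natAdd n p)) z' = z' := hz p
      rwa [hz'] at this
    have hub : (⟨z'ᶜ, hmem⟩ : nr (Fin.castAddEmb 3) C) ∈ upperBounds (f '' S) := by
      rintro _ ⟨x, hx, rfl⟩
      have key : ∀ y w : C, w ⊓ y = ⊥ → y ≤ wᶜ := fun y w h =>
        le_compl_iff_disjoint_left.2 (disjoint_iff.2 h)
      exact key _ _ (hzS x hx)
    have h1 : ((f ⊤).1 : C) ≤ z'ᶜ := (hsup S ⊤ hS).2 hub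
    have key : ∀ y w : C, y = ⊤ → y ≤ wᶜ → w = ⊥ := fun y w h h' => by
      rwa [h, top_le_iff, compl_eq_top] at h'
    exact key _ _ hf.map_top h1

/-! ### Reducts of the standard algebra outside the classes -/

namespace LabelSys

variable {m : ℕ}

theorem cm_std_rd_Sc_notMem (hm : 2 ≤ m) :
    (cm.{u} (std m)).rd .Sc ∉ ScNr (Fin.castAddEmb 3) (Sc.{u} (Fin (m + 1 + 3))) := by
  rintro ⟨C, hC, f, hf, hsup⟩
  refine cm_std_not_neat hm (neatMap_of_scNr hf hsup hC
    fun i j x => hf.map_una (.repl trivial i j) x) fun x hx => hf.injective ?_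
  exact hx.trans hf.map_bot.symm

theorem cm_std_rd_CA_notMem (hm : 2 ≤ m) :
    (cm.{u} (std m)).rd .CA ∉ ScNr (Fin.castAddEmb 3) (CA.{u} (Fin (m + 1 + 3))) := by
  rintro ⟨C, hC, f, hf, hsup⟩
  refine cm_std_not_neat hm (neatMap_of_scNr hf hsup (CAAxioms.scAxioms hC)
    fun i j x => ?_) fun x hx => hf.injective (hx.trans hf.map_bot.symm)
  have hA := cm_mem_PEA.{u} (S := std m)
  by_cases hij : i = j
  · subst hij
    refine Eq.trans (congrArg (fun y => (f y).1) ?_) (if_pos rfl).symm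
    exact (congrFun (congrArg (fun τ => (cm.{u} (std m)).una (.sub trivial τ)) (replace_self i))
      x).trans (hA.sub_id x)
  · refine Eq.trans ?_ (if_neg fun e => hij (Fin.castAdd_injective (m + 1) 3 e)).symm
    have e1 := hA.sub_replace hij x
    have e2 := hf.map_una (.cyl i) (((cm.{u} (std m)).nul (.diag trivial i j)) ⊓ x)
    have e3 := hf.map_inf ((cm.{u} (std m)).nul (.diag trivial i j)) x
    have e4 := hf.map_nul (.diag trivial i j)
    refine (congrArg (fun y => (f y).1) e1).trans (e2.trans ?_)
    refine congrArg (C.una (.cyl (Fin.castAdd 3 i))) ?_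
    exact e3.trans (congrArg (fun y : C => y ⊓ (f x).1) e4)

end LabelSys

/-- The same map represents the `Sc` reduct: replacements are preserved either as operations of `K`
or through their definition by diagonals. -/
theorem CompletelyRepresentable.rd_Sc {n : ℕ} {A : Alg.{u} .PEA (Fin n)} (hA : A ∈ PEA n) {K : Kind}
    (hK : K.HasRepl ∨ K.HasDiag) (h : A.rd K ∈ CompletelyRepresentable K (Fin n)) :
    A.rd .Sc ∈ CompletelyRepresentable .Sc (Fin n) := by
  obtain ⟨U, 𝒰, h𝒰, f, hf, hsup⟩ := h
  refine ⟨U, 𝒰, h𝒰, f, ⟨hf.injective, hf.map_bot, hf.map_top, hf.map_sup, hf.map_inf, hf.map_compl,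
    fun o x => ?_, fun o => ?_⟩, hsup⟩
  · cases o with
    | cyl i => exact hf.map_una (.cyl i) x
    | repl h i j =>
      rcases hK with hK | hK
      · exact hf.map_una (.repl hK i j) x
      · show f (A.una (.sub trivial (replace i j)) x) = subSet _ (replace i j) (f x)
        by_cases hij : i = j
        · subst hij
          rw [replace_self, subSet_id]
          exact congrArg f (hA.sub_id x)
        · rw [← cylSet_diag_inf i j hij]
          refine (congrArg f (hA.sub_replace hij x)).trans ((hf.map_una (.cyl i) _).trans ?_)
          refine congrArg (cylSet (genSpace (Fin n) 𝒰) i) ((hf.map_inf _ x).trans ?_)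
          exact congrArg (fun y => y ⊓ f x) (hf.map_nul (.diag hK i j))
    | swap h i j => exact h.elim
    | sub h τ => exact h.elim
  · cases o with
    | diag h i j => exact h.elim

theorem LabelSys.cm_std_rd_not_completelyRepresentable {m : ℕ} (hm : 2 ≤ m) {K : Kind}
    (hK : K.HasRepl ∨ K.HasDiag) :
    (cm.{u} (std m)).rd K ∉ CompletelyRepresentable K (Fin (m + 1)) := by
  intro h
  have : Nontrivial (Fin (m + 1)) := Fin.nontrivial_iff_two_le.2 (by omega)
  have hSc := CompletelyRepresentable.rd_Sc cm_mem_PEA hK h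
  refine cm_std_rd_Sc_notMem hm (CompletelyRepresentable.mem_scNr (K := .Sc) (fun h => h.elim) _
    (fun U 𝒰 h𝒰 => ?_) hSc)
  have : Nontrivial (Fin (m + 1 + 3)) := Fin.nontrivial_iff_two_le.2 (by omega)
  exact setAlg_mem_Sc h𝒰

/-! ### Homogeneous structures -/

namespace LabelSys

variable {m : ℕ} {D : Type v} {S : LabelSys m D}

theorem Realizes.comap {X Y : Type} {M : Pos m Y → D} {t : Fin (m + 1) → Y}
    {J : Set (Fin (m + 1))} {b : S.Atom} (ht : Realizes M t J b) {φ : X → Y}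
    {s : Fin (m + 1) → X} (hs : ∀ l ∈ J, φ (s l) = t l)
    (hφ : ∀ l ∈ J, ∀ l' ∈ J, φ (s l) = φ (s l') → s l = s l') :
    Realizes (fun p => M (p.map φ)) s J b := by
  refine ⟨fun l hl l' hl' => ?_, fun p hp => ?_⟩
  · rw [← ht.1 l hl l' hl', ← hs l hl, ← hs l' hl']
    exact ⟨congrArg φ, hφ l hl l' hl'⟩
  · beta_reduce
    rw [← ht.2 p hp, Pos.map_map]
    exact congrArg M (Pos.map_congr hp hs)

theorem Realizes.congr {X : Type} {M M' : Pos m X → D} {s : Fin (m + 1) → X}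
    {J : Set (Fin (m + 1))} {b : S.Atom} (h : Realizes M s J b) {K : Set X}
    (hK : ∀ l ∈ J, s l ∈ K) (hM : ∀ p, p.In K → M' p = M p) : Realizes M' s J b :=
  ⟨h.1, fun p hp => (hM _ (Pos.in_map.2 (hp.mono hK))).trans (h.2 p hp)⟩

variable (S) in
/-- The restriction of a labelling of the positions on `ℕ` to the numbers up to `k` is valid
and tame. -/
def GoodUpTo (h : D → D) (k : ℕ) (M : Pos m ℕ → D) : Prop :=
  S.Valid (fun p : Pos m (Fin (k + 1)) => M (p.map Fin.val)) ∧
    S.Tame h (fun p : Pos m (Fin (k + 1)) => M (p.map Fin.val))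

/-- Each stage adds exactly the point `k + 1`. If the request is meaningful at this stage the point
serves it; otherwise it is a dummy. -/
theorem exists_step {h : D → D} (hd : S.Descending h) {k : ℕ} {M : Pos m ℕ → D}
    (hM : S.GoodUpTo h k M) (s : Fin (m + 1) → ℕ) (J : Set (Fin (m + 1))) (j : Fin (m + 1))
    (b : S.Atom) :
    ∃ M' : Pos m ℕ → D, S.GoodUpTo h (k + 1) M' ∧ (∀ p, p.In {x | x ≤ k} → M' p = M p) ∧
      (j ∉ J → (∀ l ∈ J, s l ≤ k) → Realizes M s J b →
        ∃ z ≤ k + 1, Realizes M' (Function.update s j z) (insert j J) b) := by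
  -- Everything beyond `k` goes to the new point; only the value at `k + 1` matters for the next
  -- stage.
  let φ : ℕ → Option (Fin (k + 1)) := fun x => if hx : x < k + 1 then some ⟨x, hx⟩ else none
  have hφ_lt : ∀ {x} (hx : x < k + 1), φ x = some ⟨x, hx⟩ := fun hx => dif_pos hx
  have hφ_last : φ (k + 1) = none := dif_neg (by omega)
  have hφ_val : ∀ x : Fin (k + 1), φ x.val = some x := fun x => hφ_lt x.2
  have hφ_inj : ∀ {x y}, x ≤ k + 1 → y ≤ k + 1 → φ x = φ y → x = y := by
    intro x y hx hy hxy
    by_cases h1 : x < k + 1 <;> by_cases h2 : y < k + 1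
    · rw [hφ_lt h1, hφ_lt h2] at hxy
      simpa using hxy
    · obtain rfl : y = k + 1 := by omega
      rw [hφ_lt h1, hφ_last] at hxy
      exact (Option.some_ne_none _ hxy).elim
    · obtain rfl : x = k + 1 := by omega
      rw [hφ_lt h2, hφ_last] at hxy
      exact (Option.some_ne_none _ hxy.symm).elim
    · omega
  have hφ_surj : Function.Surjective (φ ∘ (Fin.val : Fin (k + 1 + 1) → ℕ)) := by
    rintro (_ | x)
    · exact ⟨Fin.last _, hφ_last⟩
    · exact ⟨x.castSucc, hφ_val x⟩
  have lift : ∀ M₁ : Pos m (Option (Fin (k + 1))) → D, S.Valid M₁ → S.Tame h M₁ →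
      (∀ p : Pos m (Fin (k + 1)), M₁ (p.map some) = M (p.map Fin.val)) →
      S.GoodUpTo h (k + 1) (fun p => M₁ (p.map φ)) ∧
      ∀ p, p.In {x | x ≤ k} → M₁ (p.map φ) = M p := by
    intro M₁ hv ht hext
    refine ⟨?_, fun p hp => ?_⟩
    · unfold GoodUpTo
      simp only [Pos.map_map]
      exact ⟨hv.comap _, ht.comap hφ_surj⟩
    · let g : ℕ → Fin (k + 1) := fun x => Fin.ofNat (k + 1) x
      have hg : ∀ x ∈ {x | x ≤ k}, (g x).val = x := fun x (hx : x ≤ k) =>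
        Nat.mod_eq_of_lt (by omega)
      have e1 : p.map φ = (p.map g).map some := by
        rw [Pos.map_map]
        refine Pos.map_congr hp fun x hx => ?_
        rw [Function.comp, ← hφ_val (g x), hg x hx]
      rw [e1, hext, Pos.map_map, Pos.map_congr hp (f := Fin.val ∘ g) (g := id) hg,
        Pos.map_id]
  by_cases hcase : j ∉ J ∧ (∀ l ∈ J, s l ≤ k) ∧ Realizes M s J b
  · obtain ⟨hj, hsk, hs⟩ := hcase
    let s' : Fin (m + 1) → Fin (k + 1) := fun l => Fin.ofNat (k + 1) (s l)
    have hs' : ∀ l ∈ J, (s' l).val = s l := fun l hl =>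
      Nat.mod_eq_of_lt (Nat.lt_succ_of_le (hsk l hl))
    have hR : Realizes (fun p : Pos m (Fin (k + 1)) => M (p.map Fin.val)) s' J b :=
      hs.comap hs' fun l _ l' _ e => Fin.ext e
    obtain ⟨M₁, hv, hext, ht, z, hz⟩ := exists_realizes hM.1 hj hR (Or.inr ⟨hd, hM.2⟩)
    obtain ⟨h1, h2⟩ := lift M₁ hv (ht hM.2) hext
    have hzk : ∃ z' ≤ k + 1, φ z' = z := by
      cases z with
      | none => exact ⟨k + 1, le_rfl, hφ_last⟩
      | some z => exact ⟨z, by omega, hφ_val z⟩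
    obtain ⟨z', hz'k, hz'⟩ := hzk
    have hle : ∀ l ∈ insert j J, Function.update s j z' l ≤ k + 1 := by
      intro l hl
      by_cases hlj : l = j
      · subst hlj; simpa using hz'k
      · rw [Function.update_of_ne hlj]
        exact (hsk l (hl.resolve_left hlj)).trans (by omega)
    refine ⟨_, h1, h2, fun _ _ _ => ⟨z', hz'k, hz.comap (fun l hl => ?_)
      fun l hl l' hl' e => hφ_inj (hle l hl) (hle l' hl') e⟩⟩
    by_cases hlj : l = j
    · subst hlj; simpa using hz'
    · rw [Function.update_of_ne hlj, Function.update_of_ne hlj, Function.comp, ← hφ_val,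
        hs' l (hl.resolve_left hlj)]
  -- The dummy is a duplicate of the point 0.
  · let ψ : Option (Fin (k + 1)) → Fin (k + 1) := fun x => x.elim 0 id
    have hψ : Function.Surjective ψ := fun x => ⟨some x, rfl⟩
    obtain ⟨h1, h2⟩ := lift (fun p => M ((p.map ψ).map Fin.val)) (hM.1.comap ψ) (hM.2.comap hψ)
      fun p => by
        rw [Pos.map_map ψ some, show ψ ∘ some = id from rfl, Pos.map_id]
    exact ⟨_, h1, h2, fun a1 a2 a3 => (hcase ⟨a1, a2, a3⟩).elim⟩

theorem exists_in_le (p : Pos m ℕ) : ∃ k, p.In {x | x ≤ k} := by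
  cases p with
  | col x => exact ⟨x, le_refl x⟩
  | adj x y => exact ⟨max x y, le_max_left x y, le_max_right x y⟩
  | el x y => exact ⟨max x y, le_max_left x y, le_max_right x y⟩
  | shade F => exact ⟨Finset.univ.sup F, fun l => Finset.le_sup (f := F) (Finset.mem_univ l)⟩

theorem Valid.of_le {M : Pos m ℕ → D}
    (h : ∀ k, S.Valid (fun p : Pos m (Fin (k + 1)) => M (p.map Fin.val))) : S.Valid M where
  white l x y q := by
    have h1 : x < x + y + q + 1 := by omega
    have h2 : y < x + y + q + 1 := by omega
    have h3 : q < x + y + q + 1 := by omega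
    exact (h (x + y + q)).white l ⟨x, h1⟩ ⟨y, h2⟩ ⟨q, h3⟩
  chain x y w := by
    have h1 : x < x + y + w + 1 := by omega
    have h2 : y < x + y + w + 1 := by omega
    have h3 : w < x + y + w + 1 := by omega
    exact (h (x + y + w)).chain ⟨x, h1⟩ ⟨y, h2⟩ ⟨w, h3⟩
  shade x F := by
    have hF : ∀ l, F l < x + Finset.univ.sup F + 1 := fun l => by
      have := Finset.le_sup (f := F) (Finset.mem_univ l)
      omega
    have h1 : x < x + Finset.univ.sup F + 1 := by omega
    exact (h (x + Finset.univ.sup F)).shade ⟨x, h1⟩ fun l => ⟨F l, hF l⟩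

/-- Partial realizations of atoms extend. -/
def Homogeneous (S : LabelSys m D) {X : Type} (M : Pos m X → D) : Prop :=
  ∀ (s : Fin (m + 1) → X) (J : Set (Fin (m + 1))) (j : Fin (m + 1)) (b : S.Atom), j ∉ J →
    Realizes M s J b → ∃ z, Realizes M (Function.update s j z) (insert j J) b

/-- A countable rich label system has a homogeneous structure realizing all atoms. -/
theorem exists_homogeneous [Countable D] (hm : 2 ≤ m) {h : D → D} (hd : S.Descending h)
    (b₀ : S.Atom) :
    ∃ M : Pos m ℕ → D, S.Valid M ∧ S.Homogeneous M := by
  have := countable_atom S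
  let R := (Fin (m + 1) → ℕ) × Set (Fin (m + 1)) × Fin (m + 1) × S.Atom
  have : Nonempty R := ⟨fun _ => 0, ∅, 0, b₀⟩
  obtain ⟨e, he⟩ := exists_surjective_nat R
  choose! step hstep₁ hstep₂ hstep₃ using fun (k : ℕ) (M : Pos m ℕ → D) (hM : S.GoodUpTo h k M)
    (r : R) => exists_step hd hM r.1 r.2.1 r.2.2.1 r.2.2.2
  let M₀ : Pos m ℕ → D := fun p => b₀.L (p.map fun _ => 0)
  have hM₀ : S.GoodUpTo h 0 M₀ := by
    -- A base has m ≥ 2 distinct points, so the one-point structure contains none and is tame.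
    refine ⟨(b₀.valid.comap _).comap _, fun F hF => ?_⟩
    have := injective_of_base hF (a₁ := ⟨0, by omega⟩) (a₂ := ⟨1, by omega⟩)
      (congrArg Fin.val (Subsingleton.elim (α := Fin 1) (F _) (F _)))
    simp at this
  -- Scheduling by the first component of an unpairing repeats each request infinitely often. The
  -- stage `Nat.pair a (sup s)` used below is late enough for all points of `s` to exist.
  let N : ℕ → Pos m ℕ → D := fun k => Nat.rec M₀ (fun k M => step k M (e k.unpair.1)) k
  have hN : ∀ k, S.GoodUpTo h k (N k) := by
    intro k
    induction k with
    | zero => exact hM₀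
    | succ k ih => exact hstep₁ k _ ih _
  have hagree : ∀ {k k'}, k ≤ k' → ∀ p, p.In {x | x ≤ k} → N k' p = N k p := by
    intro k k' hkk' p hp
    induction k', hkk' using Nat.le_induction with
    | base => rfl
    | succ k' hk ih =>
      exact (hstep₂ k' _ (hN k') _ p (hp.mono fun x (hx : x ≤ k) => hx.trans hk)).trans ih
  choose K hK using exists_in_le (m := m)
  let M : Pos m ℕ → D := fun p => N (K p) p
  have hM : ∀ k p, p.In {x | x ≤ k} → M p = N k p := by
    intro k p hp
    rcases le_total k (K p) with hk | hk
    · exact hagree hk p hp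
    · exact (hagree hk p (hK p)).symm
  refine ⟨M, Valid.of_le fun k => ?_, fun s J j b hj hs => ?_⟩
  · convert (hN k).1 using 2 with p
    exact hM k _ (Pos.in_map.2 (p.in_univ.mono fun x _ => Nat.lt_succ_iff.1 x.2))
  · obtain ⟨a, ha⟩ := he (s, J, j, b)
    let k := Nat.pair a (Finset.univ.sup s)
    have hsk : ∀ l ∈ J, s l ∈ {x | x ≤ k} := fun l _ =>
      (Finset.le_sup (f := s) (Finset.mem_univ l)).trans (Nat.right_le_pair _ _)
    have hk : e k.unpair.1 = (s, J, j, b) := by simp only [k, Nat.unpair_pair]; exact ha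
    have := hstep₃ k (N k) (hN k) (s, J, j, b) hj hsk
      (hs.congr hsk fun p hp => (hM k p hp).symm)
    obtain ⟨z, hzk, hz⟩ := this
    refine ⟨z, Realizes.congr (K := {x | x ≤ k + 1}) hz (fun l hl => ?_) fun p hp => ?_⟩
    · by_cases hlj : l = j
      · subst hlj; simpa using hzk
      · rw [Function.update_of_ne hlj]
        exact (hsk l (hl.resolve_left hlj)).trans (Nat.le_succ k)
    · rw [hM _ p hp, ← hk]

theorem exists_realizes_univ (hm : 0 < m) {X : Type} [Nonempty X] {M : Pos m X → D}
    (hM : S.Homogeneous M) (b : S.Atom) :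
    ∃ s, Realizes M s Set.univ b := by
  classical
  suffices ∀ J : Finset (Fin (m + 1)), ∃ s, Realizes M s (J : Set (Fin (m + 1))) b by
    simpa using this Finset.univ
  intro J
  induction J using Finset.induction_on with
  | empty =>
    rw [Finset.coe_empty]
    refine ⟨fun _ => Classical.arbitrary X, fun j hj => hj.elim, fun p hp => ?_⟩
    cases p with
    | col x => exact hp.elim
    | shade F => exact (hp ⟨0, hm⟩).elim
    | adj x y => exact hp.1.elim
    | el x y => exact hp.1.elim
  | insert j J hj ih =>
    obtain ⟨s, hs⟩ := ih
    obtain ⟨z, hz⟩ := hM s J j b (by simpa using hj) hs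
    exact ⟨_, by simpa using hz⟩

end LabelSys

/-! ### Countable elementary substructures of ultrapowers -/

section Ultrapower

open FirstOrder FirstOrder.Language

/-- The element of the ultrapower given by a sequence. -/
abbrev ultraMk {M : Type u} (U : Ultrafilter ℕ) (X : ℕ → M) : (U : Filter ℕ).Product fun _ => M :=
  (X : (U : Filter ℕ).Product fun _ => M)

theorem ultraMk_eq {M : Type u} {U : Ultrafilter ℕ} {X Y : ℕ → M} :
    ultraMk U X = ultraMk U Y ↔ ∀ᶠ k in U, X k = Y k :=
  Quotient.eq''

/-- Symbols for a set of binary operations. -/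
inductive BinFn {M : Type u} (T : Set (M → M → M)) : ℕ → Type u
  | op (t : T) : BinFn T 2

/-- The language with symbols for a set of binary operations. -/
def binLang {M : Type u} (T : Set (M → M → M)) : FirstOrder.Language.{u, 0} where
  Functions := BinFn T
  Relations := fun _ => Empty

/-- The pointwise action of binary operations on the ultrapower. -/
@[reducible]
def binStructure {M : Type u} (T : Set (M → M → M)) (U : Ultrafilter ℕ) :
    (binLang T).Structure ((U : Filter ℕ).Product fun _ => M) where
  funMap := fun {_} f => match f with
    | .op t => fun v => Quotient.map₂ (fun X Y k => t.1 (X k) (Y k))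
      (fun _ _ hX _ _ hY => by
        filter_upwards [hX, hY] with k h1 h2
        rw [h1, h2]) (v 0) (v 1)
  RelMap := fun r => r.elim

/-- The operations in `T` act pointwise on the ultrapower and are added as function symbols there.
The downward Löwenheim–Skolem theorem in the enlarged language gives the closure, and elementarity
passes to the reduct. -/
theorem exists_countable_elementary (L : FirstOrder.Language.{0, 0}) [Countable L.Symbols] {M : Type u}
    [Infinite M] [L.Structure M] (U : Ultrafilter ℕ) {T : Set (M → M → M)} (hT : T.Countable)
    {Q : Set (ℕ → M)} (hQ : Q.Countable) :
    ∃ S : L.ElementarySubstructure ((U : Filter ℕ).Product fun _ => M), Countable S ∧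
      (∀ X ∈ Q, ultraMk U X ∈ S) ∧
      ∀ t ∈ T, ∀ X Y, ultraMk U X ∈ S → ultraMk U Y ∈ S →
        ultraMk U (fun k => t (X k) (Y k)) ∈ S := by
  let _ : (binLang T).Structure ((U : Filter ℕ).Product fun _ => M) := binStructure T U
  have : Infinite ((U : Filter ℕ).Product fun _ => M) := by
    refine Infinite.of_injective (fun x : M => ultraMk U fun _ => x) fun x y h => ?_
    obtain ⟨k, hk⟩ := (ultraMk_eq.1 h).exists
    exact hk
  have hcard : (L.sum (binLang T)).card ≤ Cardinal.aleph0 := by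
    have := hT.to_subtype
    have : Countable (Σ n, (binLang T).Functions n) := by
      refine Function.Surjective.countable (f := fun t : T => ⟨2, BinFn.op t⟩) ?_
      rintro ⟨_, ⟨t⟩⟩
      exact ⟨t, rfl⟩
    have : Countable (Σ n, (binLang T).Relations n) := by
      have : IsEmpty (Σ n, (binLang T).Relations n) := ⟨fun r => r.2.elim⟩
      infer_instance
    have : Countable (binLang T).Symbols :=
      inferInstanceAs (Countable ((Σ n, (binLang T).Functions n) ⊕ Σ n, (binLang T).Relations n))
    rw [card_sum]
    simp only [FirstOrder.Language.card]
    refine Cardinal.add_le_aleph0.2 ⟨?_, ?_⟩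
    · exact Cardinal.lift_le_aleph0.2 (Cardinal.mk_le_aleph0 (α := L.Symbols))
    · exact Cardinal.lift_le_aleph0.2 (Cardinal.mk_le_aleph0 (α := (binLang T).Symbols))
  obtain ⟨S, hQS, hS⟩ := exists_elementarySubstructure_card_eq (L.sum (binLang T))
    (M := (U : Filter ℕ).Product fun _ => M)
    (ultraMk U '' Q) Cardinal.aleph0.{0} le_rfl (by
      simpa using (hQ.image _).le_aleph0) (by simpa using hcard) (by
      simp [Cardinal.aleph0_le_mk ((U : Filter ℕ).Product fun _ => M)])
  refine ⟨⟨LHom.sumInl.substructureReduct S.toSubstructure, fun n φ x => ?_⟩, ?_,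
    fun X hX => hQS ⟨X, hX, rfl⟩,
    fun t ht X Y hX hY => ?_⟩
  · have h1 := S.isElementary (LHom.sumInl.onFormula φ) x
    rw [LHom.realize_onFormula] at h1
    refine h1.trans ?_
    let _ : L.Structure S := inferInstanceAs (L.Structure
      ((LHom.sumInl (L := L) (L' := binLang T)).substructureReduct S.toSubstructure))
    have : (LHom.sumInl : L →ᴸ L.sum (binLang T)).IsExpansionOn S :=
      ⟨fun f v => rfl, fun r v => rfl⟩
    exact (LHom.sumInl : L →ᴸ L.sum (binLang T)).realize_onFormula (M := S) φ
  · have : Cardinal.mk S ≤ Cardinal.aleph0 := by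
      have := hS.le
      simpa using this
    exact Cardinal.mk_le_aleph0_iff.1 this
  · have := S.1.fun_mem (Sum.inr (BinFn.op ⟨t, ht⟩) : (L.sum (binLang T)).Functions 2)
      ![ultraMk U X, ultraMk U Y] (fun i => by
        refine Fin.cases ?_ (fun i => ?_) i
        · exact hX
        · rw [Subsingleton.elim i 0]; exact hY)
    exact this

end Ultrapower

open Filter

/-! ### Germs of standard labels -/

namespace LabelSys

/-- Adding a tint to a standard shade. -/
def insShade (t y : ℕ) : ℕ := if y = 0 then 0 else ((y - 1) ||| 2 ^ t) + 1

theorem std_mem_insShade {m t t' y : ℕ} :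
    (std m).mem t' (insShade t y) ↔ t' = t ∨ (std m).mem t' y := by
  show insShade t y = 0 ∨ (insShade t y - 1).testBit t' = true ↔
    t' = t ∨ (y = 0 ∨ (y - 1).testBit t' = true)
  by_cases hy : y = 0
  · simp [insShade, hy]
  · simp only [insShade, hy, if_false, Nat.add_sub_cancel, Nat.testBit_or, Nat.testBit_two_pow,
      Nat.succ_ne_zero, false_or, Bool.or_eq_true, decide_eq_true_eq, @eq_comm _ t t']
    exact or_comm

variable {m : ℕ} {D : Type v} {U : Ultrafilter ℕ} {rep : D → ℕ → ℕ}

/-- `D` is a set of germs of sequences of standard labels, closed under some operations. -/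
structure GermClosed (m : ℕ) (U : Ultrafilter ℕ) (rep : D → ℕ → ℕ) : Prop where
  eq_of_eventually : ∀ {d d'}, (∀ᶠ k in U, rep d k = rep d' k) → d = d'
  const : ∀ c, ∃ d, ∀ᶠ k in U, rep d k = c
  ins : ∀ t y, ∃ d, ∀ᶠ k in U, rep d k = insShade (rep t k) (rep y k)
  seed : ∀ z : ℤ, ∃ d, ∀ᶠ k in U, rep d k = ((k : ℤ) + m - z).toNat

/-- The label system of germs: the predicates hold when they hold eventually. -/
def germ (hG : GermClosed m U rep) : LabelSys m D where
  base l d := ∀ᶠ k in U, (std m).base l (rep d k)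
  tint d := ∀ᶠ k in U, (std m).tint (rep d k)
  nxt d d' := ∀ᶠ k in U, (std m).nxt (rep d k) (rep d' k)
  adj d := ∀ᶠ k in U, (std m).adj (rep d k)
  white l d := ∀ᶠ k in U, (std m).white l (rep d k)
  red d := ∀ᶠ k in U, (std m).red (rep d k)
  dec d d' := ∀ᶠ k in U, (std m).dec (rep d k) (rep d' k)
  mem t y := ∀ᶠ k in U, (std m).mem (rep t k) (rep y k)
  base_unique h h' := by
    obtain ⟨k, h1, h2⟩ := (h.and h').exists
    exact (std m).base_unique h1 h2
  not_tint_of_base h h' := by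
    obtain ⟨k, h1, h2⟩ := (h.and h').exists
    exact (std m).not_tint_of_base h1 h2
  tint_of_nxt h := ⟨h.mono fun _ hk => ((std m).tint_of_nxt hk).1,
    h.mono fun _ hk => ((std m).tint_of_nxt hk).2⟩
  nxt_irrefl h := by
    obtain ⟨k, h1⟩ := h.exists
    exact (std m).nxt_irrefl h1
  nxt_nxt_ne h h' := by
    obtain ⟨k, h1, h2⟩ := (h.and h').exists
    exact (std m).nxt_nxt_ne h1 h2
  white_unique h h' := by
    obtain ⟨k, h1, h2⟩ := (h.and h').exists
    exact (std m).white_unique h1 h2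
  not_red_of_white h h' := by
    obtain ⟨k, h1, h2⟩ := (h.and h').exists
    exact (std m).not_red_of_white h1 h2
  red_of_not_white {d} h := by
    have : ∀ᶠ k in U, ∀ l, ¬ (std m).white l (rep d k) :=
      eventually_all.2 fun l => Ultrafilter.eventually_not.2 (h l)
    exact this.mono fun k hk => (std m).red_of_not_white hk
  exists_not_adj := by
    obtain ⟨d, hd⟩ := hG.const 0
    refine ⟨d, Ultrafilter.eventually_not.1 (hd.mono fun k hk h => h hk)⟩
  exists_white l := hG.const l
  exists_shade T := by
    classical
    induction T using Finset.induction_on with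
    | empty =>
      obtain ⟨d, hd⟩ := hG.const 1
      refine ⟨d, fun t => iff_of_false (Ultrafilter.eventually_not.1 (hd.mono fun k hk h => ?_))
        (Finset.notMem_empty t)⟩
      rw [hk] at h
      simp [std] at h
    | insert a T _ ih =>
      obtain ⟨y, hy⟩ := ih
      obtain ⟨d, hd⟩ := hG.ins a y
      refine ⟨d, fun t => ?_⟩
      rw [Finset.mem_insert, ← hy, eventually_congr (hd.mono fun k hk => by
        rw [hk, std_mem_insShade]), Ultrafilter.eventually_or]
      exact or_congr_left ⟨hG.eq_of_eventually, fun h => by simp [h]⟩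

/-- A finite structure has finitely many instances of the constraints, and an ultrafilter commutes
with the connectives. -/
theorem germ_valid_iff (hG : GermClosed m U rep) {X : Type} [Finite X] {L : Pos m X → D} :
    (germ hG).Valid L ↔ ∀ᶠ k in U, (std m).Valid fun p => rep (L p) k := by
  constructor
  · intro h
    have h1 : ∀ᶠ k in U, ∀ l x y q, (std m).tint (rep (L (.col x)) k) →
        (std m).tint (rep (L (.col y)) k) → (std m).base l (rep (L (.col q)) k) →
        (std m).adj (rep (L (.adj x q)) k) → (std m).adj (rep (L (.adj y q)) k) →
        ¬ (std m).white l (rep (L (.el x y)) k) := by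
      simp only [eventually_all, Ultrafilter.eventually_imp, eventually_const]
      exact h.white
    have h2 : ∀ᶠ k in U, ∀ x y w, (std m).nxt (rep (L (.col x)) k) (rep (L (.col y)) k) →
        (std m).nxt (rep (L (.col y)) k) (rep (L (.col w)) k) →
        (std m).red (rep (L (.el x y)) k) → (std m).red (rep (L (.el y w)) k) →
        (std m).red (rep (L (.el x w)) k) →
        (std m).dec (rep (L (.el x y)) k) (rep (L (.el y w)) k) := by
      simp only [eventually_all, Ultrafilter.eventually_imp]
      exact h.chain
    have h3 : ∀ᶠ k in U, ∀ x F, (std m).tint (rep (L (.col x)) k) →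
        (∀ l, (std m).base l (rep (L (.col (F l))) k)) →
        (∀ l, (std m).adj (rep (L (.adj x (F l))) k)) →
        (std m).mem (rep (L (.col x)) k) (rep (L (.shade F)) k) := by
      simp only [eventually_all, Ultrafilter.eventually_imp]
      exact h.shade
    filter_upwards [h1, h2, h3] with k h1 h2 h3 using ⟨h1, h2, h3⟩
  · intro h
    refine ⟨fun l x y q a1 a2 a3 a4 a5 a6 => ?_, fun x y w a1 a2 a3 a4 a5 => ?_,
      fun x F a1 a2 a3 => ?_⟩
    · obtain ⟨k, h, a1, a2, a3, a4, a5, a6⟩ :=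
        (h.and (a1.and (a2.and (a3.and (a4.and (a5.and a6)))))).exists
      exact h.white l x y q a1 a2 a3 a4 a5 a6
    · filter_upwards [h, a1, a2, a3, a4, a5] with k h a1 a2 a3 a4 a5
      exact h.chain x y w a1 a2 a3 a4 a5
    · filter_upwards [h, a1, eventually_all.2 a2, eventually_all.2 a3] with k h a1 a2 a3
      exact h.shade x F a1 a2 a3

/-- Two germs differ by an integer. -/
def germSetoid (U : Ultrafilter ℕ) (rep : D → ℕ → ℕ) : Setoid D where
  r d d' := ∃ z : ℤ, ∀ᶠ k in U, (rep d' k : ℤ) = rep d k + z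
  iseqv := ⟨fun _ => ⟨0, .of_forall fun _ => (add_zero _).symm⟩,
    fun ⟨z, h⟩ => ⟨-z, h.mono fun _ hk => by omega⟩,
    fun ⟨z, h⟩ ⟨z', h'⟩ => ⟨z + z', by filter_upwards [h, h'] with k h h'; omega⟩⟩

/-- Tints are grouped into classes of finite distance, and each is assigned its integer distance
from a fixed representative of its class. Subtracting that distance from the infinite label k + m
gives labels that drop by one when the tint rises by one. -/
theorem germ_exists_descending (hG : GermClosed m U rep) (hU : (U : Filter ℕ) ≤ atTop) :
    ∃ h, (germ hG).Descending h := by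
  have hex : ∀ d, ∃ z : ℤ, ∀ᶠ k in U,
      (rep d k : ℤ) = rep (Quotient.mk (germSetoid U rep) d).out k + z := fun d =>
    Quotient.mk_out (s := germSetoid U rep) d
  choose dist hdist using hex
  choose h hh using fun t => hG.seed (dist t)
  refine ⟨h, fun t => ?_, fun t t' htt' => ?_⟩
  · have := hU (eventually_ge_atTop (dist t).toNat)
    -- Once k exceeds the distance, the label is at least m, hence red, and the truncation at zero
    -- is inactive.
    filter_upwards [hh t, this] with k h1 h2
    show m ≤ _
    omega
  · have hc : (Quotient.mk (germSetoid U rep) t) = Quotient.mk _ t' := by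
      refine Quotient.sound ⟨1, htt'.mono fun k hk => ?_⟩
      have := hk.2
      omega
    have hz : dist t' = dist t + 1 := by
      obtain ⟨k, h1, h2, h3⟩ := ((hdist t).and ((hdist t').and htt')).exists
      rw [← hc] at h2
      have := h3.2
      omega
    have := hU (eventually_ge_atTop (dist t').toNat)
    filter_upwards [hh t, hh t', this] with k h1 h2 h3
    show _ = _ + 1
    omega

/-! ### Decoding atoms over germs -/

section Decode

variable (hG : GermClosed m U rep)

open Classical in
/-- The sequence of standard atoms represented by an atom over germs. -/
noncomputable def Atom.at (a : (germ hG).Atom) (k : ℕ) : (std m).Atom :=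
  if hv : (std m).Valid fun p => rep (a.L p) k then
    { E := a.E
      L := fun p => rep (a.L p) k
      good := by
        obtain ⟨r, hr, hL, -⟩ := a.good
        exact ⟨r, hr, fun p => by rw [hL], hv⟩ }
  else apexAtom m 0

variable {hG}

theorem Atom.eventually_at (a : (germ hG).Atom) :
    ∀ᶠ k in U, (a.at hG k).E = a.E ∧ (a.at hG k).L = fun p => rep (a.L p) k := by
  filter_upwards [(germ_valid_iff hG).1 a.valid] with k hk
  rw [Atom.at, dif_pos hk]
  exact ⟨rfl, rfl⟩

theorem Atom.eventually_at_comp (a : (germ hG).Atom) (τ : Fin (m + 1) → Fin (m + 1)) :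
    ∀ᶠ k in U, (a.comp τ).at hG k = (a.at hG k).comp τ := by
  filter_upwards [a.eventually_at, (a.comp τ).eventually_at] with k h1 h2
  ext1
  · rw [h2.1]; simp only [Atom.comp, h1.1]
  · rw [h2.2]; simp only [Atom.comp, h1.2]

theorem Atom.agree_iff {J : Set (Fin (m + 1))} {a b : (germ hG).Atom} :
    Atom.Agree J a b ↔ ∀ᶠ k in U, Atom.Agree J (a.at hG k) (b.at hG k) := by
  constructor
  · intro h
    filter_upwards [a.eventually_at, b.eventually_at] with k h1 h2
    refine ⟨fun j hj l hl => ?_, fun p hp => ?_⟩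
    · rw [h1.1, h2.1]; exact h.1 j hj l hl
    · rw [h1.2, h2.2]; simp only [h.2 p hp]
  · intro h
    have h' := (a.eventually_at.and (b.eventually_at.and h))
    refine ⟨fun j hj l hl => ?_, fun p hp => hG.eq_of_eventually ?_⟩
    · obtain ⟨k, h1, h2, h3⟩ := h'.exists
      rw [← h1.1, ← h2.1]; exact h3.1 j hj l hl
    · filter_upwards [h'] with k hk
      have := hk.2.2.2 p hp
      rwa [hk.1.2, hk.2.1.2] at this

theorem Atom.eq_iff {a b : (germ hG).Atom} : a = b ↔ ∀ᶠ k in U, a.at hG k = b.at hG k := by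
  refine ⟨fun h => by simp [h], fun h => (Atom.agree_iff.2 (h.mono fun k hk => ?_)).eq⟩
  rw [hk]
  exact Atom.Agree.refl _ _

/-- There are only finitely many maps `r`, so a single one describes the equality pattern for almost
all `k`. -/
theorem exists_eventually_at {β : ℕ → (std m).Atom}
    (hβ : ∀ p, ∃ d, ∀ᶠ k in U, rep d k = (β k).L p) :
    ∃ b : (germ hG).Atom, ∀ᶠ k in U, b.at hG k = β k := by
  have := finite_pos (m := m) (Fin (m + 1))
  choose L hL using hβ
  have hL := eventually_all.2 hL
  have hr : ∀ᶠ k in U, ∃ r : Fin (m + 1) → Fin (m + 1), (∀ j l, (β k).E j l ↔ r j = r l) ∧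
      ∀ p, (β k).L (p.map r) = (β k).L p := .of_forall fun k => by
    obtain ⟨r, h1, h2, -⟩ := (β k).good
    exact ⟨r, h1, h2⟩
  obtain ⟨r, hr⟩ := Ultrafilter.eventually_exists_iff.1 hr
  let b : (germ hG).Atom :=
    { E := fun j l => r j = r l
      L := L
      good := ⟨r, fun _ _ => Iff.rfl, fun p => hG.eq_of_eventually (by
          filter_upwards [hL, hr] with k h1 h2
          rw [h1, h1, h2.2]),
        (germ_valid_iff hG).2 (hL.mono fun k hk => by simp only [hk]; exact (β k).valid)⟩ }
  refine ⟨b, ?_⟩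
  filter_upwards [b.eventually_at, hL, hr] with k h1 h2 h3
  ext1
  · rw [h1.1]
    funext j l
    exact propext (h3.1 j l).symm
  · rw [h1.2]
    funext p
    exact h2 p

end Decode

end LabelSys

/-! ### Closed sets of sequences of elements of the standard algebra -/

namespace LabelSys

variable {m : ℕ} {U : Ultrafilter ℕ}

/-- The atom coding a label. -/
def codeAtom (m d : ℕ) : ULift.{u} (std m).Atom := ⟨apexAtom m d⟩

theorem codeAtom_inj {d d' : ℕ} : codeAtom.{u} m d = codeAtom m d' ↔ d = d' :=
  ⟨fun h => apexAtom_injective (congrArg ULift.down h), fun h => by rw [h]⟩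

/-- A singleton subset of a nonempty set. -/
def pickSet {α : Type u} (X : Set α) : Set α := {a | ∃ h : X.Nonempty, a = h.some}

/-- The labels at a position in a set of atoms, coded as atoms. -/
def labelSet (p : Pos m (Fin (m + 1))) (X : Set (ULift.{u} (std m).Atom)) :
    Set (ULift.{u} (std m).Atom) :=
  (fun a => codeAtom m (a.down.L p)) '' X

/-- The atoms whose label at a position has its code in a given set. -/
def selectSet (p : Pos m (Fin (m + 1))) (X : Set (ULift.{u} (std m).Atom)) :
    Set (ULift.{u} (std m).Atom) :=
  {a | codeAtom m (a.down.L p) ∈ X}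

/-- The atoms with a given equality pattern. -/
def patternSet (E : Fin (m + 1) → Fin (m + 1) → Prop) : Set (ULift.{u} (std m).Atom) :=
  {a | a.down.E = E}

/-- Adding coded tints to coded shades. -/
def insertSet (X Y : Set (ULift.{u} (std m).Atom)) : Set (ULift.{u} (std m).Atom) :=
  {a | ∃ t y, codeAtom m t ∈ X ∧ codeAtom m y ∈ Y ∧ a = codeAtom m (insShade t y)}

/-- A set of sequences of elements of the standard algebra that is closed under eventual equality
and some operations. -/
structure SeqClosed (U : Ultrafilter ℕ) (I : (ℕ → Set (ULift.{u} (std m).Atom)) → Prop) :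
    Prop where
  congr : ∀ {X Y}, I X → (∀ᶠ k in U, X k = Y k) → I Y
  inter : ∀ {X Y}, I X → I Y → I fun k => X k ∩ Y k
  compl : ∀ {X}, I X → I fun k => (X k)ᶜ
  cyl : ∀ i {X}, I X → I fun k => (cm.{u} (std m)).una (.cyl i) (X k)
  sub : ∀ τ {X}, I X → I fun k => (cm.{u} (std m)).una (.sub trivial τ) (X k)
  pick : ∀ {X}, I X → I fun k => pickSet (X k)
  label : ∀ p {X}, I X → I fun k => labelSet p (X k)
  select : ∀ p {X}, I X → I fun k => selectSet p (X k)
  pattern : ∀ E, I fun _ => patternSet E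
  const : ∀ d, I fun _ => {codeAtom m d}
  insert : ∀ {X Y}, I X → I Y → I fun k => insertSet (X k) (Y k)
  seed : ∀ z : ℤ, I fun k => {codeAtom m ((k : ℤ) + m - z).toNat}

/-- The germs of sequences of labels with code in `I`. -/
def LabelGerm (U : Ultrafilter ℕ) (I : (ℕ → Set (ULift.{u} (std m).Atom)) → Prop) : Type :=
  {g : (U : Filter ℕ).Germ ℕ // ∃ t : ℕ → ℕ, (t : (U : Filter ℕ).Germ ℕ) = g ∧
    I fun k => {codeAtom m (t k)}}

variable {I : (ℕ → Set (ULift.{u} (std m).Atom)) → Prop}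

/-- A representing sequence. -/
noncomputable def LabelGerm.rep (d : LabelGerm U I) : ℕ → ℕ := d.2.choose

theorem LabelGerm.rep_mem (d : LabelGerm U I) : I fun k => {codeAtom m (d.rep k)} :=
  d.2.choose_spec.2

theorem LabelGerm.exists_rep {t : ℕ → ℕ} (ht : I fun k => {codeAtom m (t k)}) :
    ∃ d : LabelGerm U I, ∀ᶠ k in U, d.rep k = t k := by
  let d : LabelGerm U I := ⟨t, t, rfl, ht⟩
  exact ⟨d, Germ.coe_eq.1 d.2.choose_spec.1⟩

namespace SeqClosed

variable (hI : SeqClosed U I)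
include hI

theorem germClosed : GermClosed m U (LabelGerm.rep (U := U) (I := I)) where
  eq_of_eventually {d d'} h := by
    refine Subtype.ext ?_
    rw [← d.2.choose_spec.1, ← d'.2.choose_spec.1]
    exact Germ.coe_eq.2 h
  const c := LabelGerm.exists_rep (hI.const c)
  ins t y := by
    refine LabelGerm.exists_rep (hI.congr (hI.insert t.rep_mem y.rep_mem) (.of_forall fun k => ?_))
    ext a
    simp [insertSet, codeAtom_inj]
  seed z := LabelGerm.exists_rep (hI.seed z)

theorem univ : I fun _ => Set.univ :=
  hI.congr (hI.compl (hI.inter (hI.const 0) (hI.compl (hI.const 0)))) (.of_forall fun k => by simp)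

theorem iInter {ι : Type} [Finite ι] {X : ι → ℕ → Set (ULift.{u} (std m).Atom)}
    (hX : ∀ i, I (X i)) : I fun k => ⋂ i, X i k := by
  classical
  have := Fintype.ofFinite ι
  suffices ∀ T : Finset ι, I fun k => ⋂ i ∈ T, X i k by simpa using this Finset.univ
  intro T
  induction T using Finset.induction_on with
  | empty => simpa using hI.univ
  | insert i T _ ih => simpa using hI.inter (hX i) ih

/-- An atom is cut out by its equality pattern and its labels at finitely many positions, all
expressible by the closure operations. -/
theorem singleton_at (a : (germ hI.germClosed).Atom) :
    I fun k => {⟨a.at hI.germClosed k⟩} := by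
  have := finite_pos (m := m) (Fin (m + 1))
  refine hI.congr (hI.inter (hI.pattern a.E) (hI.iInter fun p => hI.select p (a.L p).rep_mem)) ?_
  filter_upwards [a.eventually_at] with k hk
  refine Set.ext fun x => ⟨?_, ?_⟩
  · rintro ⟨h1, h2⟩
    refine congrArg ULift.up (Atom.ext (h1.trans hk.1.symm) (funext fun p => ?_))
    have := Set.mem_iInter.1 h2 p
    rw [hk.2]
    exact codeAtom_inj.1 this
  · rintro rfl
    refine ⟨hk.1, Set.mem_iInter.2 fun p => ?_⟩
    exact congrArg (codeAtom m) (congrFun hk.2 p)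

/-- The set operation `pickSet` chooses an atom at each index without leaving `I`, so its labels are
germs in `LabelGerm`. This is why the operations for picking and coding labels were added. -/
theorem exists_atom_mem {X : ℕ → Set (ULift.{u} (std m).Atom)} (hX : I X)
    (hne : ∀ᶠ k in U, (X k).Nonempty) :
    ∃ b : (germ hI.germClosed).Atom, ∀ᶠ k in U, ⟨b.at hI.germClosed k⟩ ∈ X k := by
  classical
  let β : ℕ → (std m).Atom := fun k => if h : (X k).Nonempty then h.some.down else apexAtom m 0
  have hβ : ∀ᶠ k in U, pickSet (X k) = {⟨β k⟩} ∧ ⟨β k⟩ ∈ X k := by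
    filter_upwards [hne] with k hk
    rw [show β k = hk.some.down from dif_pos hk]
    exact ⟨Set.ext fun a => ⟨fun ⟨_, h⟩ => h, fun h => ⟨hk, h⟩⟩, hk.some_mem⟩
  obtain ⟨b, hb⟩ := exists_eventually_at (hG := hI.germClosed) (β := β) fun p =>
    LabelGerm.exists_rep (hI.congr (hI.label p (hI.pick hX)) (by
      filter_upwards [hβ] with k hk
      rw [hk.1, labelSet, Set.image_singleton]))
  refine ⟨b, ?_⟩
  filter_upwards [hb, hβ] with k h1 h2
  rw [h1]
  exact h2.2

/-- A witness at almost every index is replaced by one atom over germs, found inside `X` cut down to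
the neighbours of `a`. -/
theorem mem_cyl_iff (i : Fin (m + 1)) {X : ℕ → Set (ULift.{u} (std m).Atom)} (hX : I X)
    (a : (germ hI.germClosed).Atom) :
    (∀ᶠ k in U, ∃ b ∈ X k, Atom.Agree {i}ᶜ (a.at hI.germClosed k) b.down) ↔
      ∃ b : (germ hI.germClosed).Atom, Atom.Agree {i}ᶜ a b ∧
        ∀ᶠ k in U, ⟨b.at hI.germClosed k⟩ ∈ X k := by
  constructor
  · intro h
    have h1 := hI.inter (hI.cyl i (hI.singleton_at a)) hX
    obtain ⟨b, hb⟩ := hI.exists_atom_mem h1 (by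
      filter_upwards [h] with k hk
      obtain ⟨b, hb, hab⟩ := hk
      exact ⟨b, ⟨_, rfl, Atom.Agree.symm hab⟩, hb⟩)
    refine ⟨b, Atom.agree_iff.2 (hb.mono fun k hk => ?_), hb.mono fun k hk => hk.2⟩
    obtain ⟨⟨_, rfl, h⟩, -⟩ := hk
    exact h.symm
  · rintro ⟨b, hab, hb⟩
    filter_upwards [Atom.agree_iff.1 hab, hb] with k h1 h2
    exact ⟨_, h2, h1⟩

end SeqClosed

end LabelSys

/-! ### Subalgebras -/

/-- The subalgebra on a Boolean subalgebra closed under the extra operations. -/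
def Alg.sub {K : Kind} {α : Type} (C : Alg.{u} K α) (L : BooleanSubalgebra C)
    (hu : ∀ o, ∀ x ∈ L, C.una o x ∈ L) (hn : ∀ o, C.nul o ∈ L) : Alg.{u} K α where
  carrier := L
  una o x := ⟨C.una o x, hu o x x.2⟩
  nul o := ⟨C.nul o, hn o⟩

theorem Alg.sub_mem_PEA {n : ℕ} {C : Alg.{u} .PEA (Fin n)} (hC : C ∈ PEA n)
    (L : BooleanSubalgebra C) (hu : ∀ o, ∀ x ∈ L, C.una o x ∈ L) (hn : ∀ o, C.nul o ∈ L) :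
    C.sub L hu hn ∈ PEA n where
  cyl_bot i := Subtype.ext (hC.cyl_bot i)
  le_cyl i x := hC.le_cyl i x.1
  cyl_inf_cyl i x y := Subtype.ext (hC.cyl_inf_cyl i x.1 y.1)
  cyl_comm i j x := Subtype.ext (hC.cyl_comm i j x.1)
  sub_id x := Subtype.ext (hC.sub_id x.1)
  sub_comp σ τ x := Subtype.ext (hC.sub_comp σ τ x.1)
  sub_endo τ := ⟨fun x y => Subtype.ext ((hC.sub_endo τ).map_sup x.1 y.1),
    fun x => Subtype.ext ((hC.sub_endo τ).map_compl x.1)⟩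
  sub_cyl_congr σ τ i x h := Subtype.ext (hC.sub_cyl_congr σ τ i x.1 h)
  cyl_sub_of_singleton τ i j x h := Subtype.ext (hC.cyl_sub_of_singleton τ i j x.1 h)
  cyl_sub_of_empty τ i x h := Subtype.ext (hC.cyl_sub_of_empty τ i x.1 h)
  diag_self i := Subtype.ext (hC.diag_self i)
  inf_diag_le i j x := hC.inf_diag_le i j x.1
  sub_diag τ i j := Subtype.ext (hC.sub_diag τ i j)

namespace LabelSys

variable {m : ℕ}

/-! ### Types of tuples -/

section Types

variable {D : Type v} {S : LabelSys m D} {X : Type} {M : Pos m X → D} {hM : S.Valid M}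

theorem typ_eq {s : Fin (m + 1) → X} {b : S.Atom} (h : Realizes M s Set.univ b) :
    typ M hM s = b :=
  Atom.Agree.eq ⟨h.1, h.2⟩

theorem typ_comp (s : Fin (m + 1) → X) (τ : Fin (m + 1) → Fin (m + 1)) :
    typ M hM (s ∘ τ) = (typ M hM s).comp τ := by
  ext1
  · rfl
  · funext p
    simp only [typ, Atom.comp, Pos.map_map]

theorem typ_agree {s t : Fin (m + 1) → X} {J : Set (Fin (m + 1))} (h : ∀ j ∈ J, s j = t j) :
    Atom.Agree J (typ M hM s) (typ M hM t) := by
  refine ⟨fun j hj k hk => ?_, fun p hp => ?_⟩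
  · simp only [typ, h j hj, h k hk]
  · simp only [typ, Pos.map_congr hp h]

end Types

/-! ### The represented algebra -/

/-- The space of the representation. -/
abbrev Tuples (m : ℕ) : Set (Fin (m + 1) → ULift.{u} ℕ) := genSpace (Fin (m + 1)) {Set.univ}

theorem mem_tuples (s : Fin (m + 1) → ULift.{u} ℕ) : s ∈ Tuples.{u} m :=
  ⟨Set.univ, rfl, fun _ => trivial⟩

variable {U : Ultrafilter ℕ} {D : Type} {rep : D → ℕ → ℕ} {hG : GermClosed m U rep}
  {M : Pos m ℕ → D} (hM : (germ hG).Valid M)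

/-- The atom over germs realized by a tuple. -/
def tupleAtom (s : Tuples.{u} m) : (germ hG).Atom := typ M hM (ULift.down ∘ s.1)

/-- The set of tuples represented by a sequence of elements of the standard algebra. -/
def den (X : ℕ → Set (ULift.{u} (std m).Atom)) : Set (Tuples.{u} m) :=
  {s | ∀ᶠ k in U, ⟨(tupleAtom hM s).at hG k⟩ ∈ X k}

variable {X Y : ℕ → Set (ULift.{u} (std m).Atom)}

theorem den_congr (h : ∀ᶠ k in U, X k = Y k) : den hM X = den hM Y :=
  Set.ext fun s => eventually_congr (h.mono fun k hk => by rw [hk])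

theorem den_empty : den hM (fun _ => (∅ : Set (ULift.{u} (std m).Atom))) = ∅ :=
  Set.eq_empty_of_forall_notMem fun _ hs => hs.exists.choose_spec

theorem den_univ : den hM (fun _ => (Set.univ : Set (ULift.{u} (std m).Atom))) = Set.univ :=
  Set.eq_univ_of_forall fun _ => .of_forall fun _ => trivial

theorem den_compl : den hM (fun k => (X k)ᶜ) = (den hM X)ᶜ :=
  Set.ext fun _ => Ultrafilter.eventually_not

theorem den_inter : den hM (fun k => X k ∩ Y k) = den hM X ∩ den hM Y :=
  Set.ext fun _ => eventually_and

theorem den_union : den hM (fun k => X k ∪ Y k) = den hM X ∪ den hM Y :=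
  Set.ext fun _ => Ultrafilter.eventually_or

theorem den_diag (i j : Fin (m + 1)) :
    den hM (fun _ => ((cm.{u} (std m)).nul (.diag trivial i j))) = diagSet (Tuples.{u} m) i j := by
  refine Set.ext fun s => ?_
  have h : ∀ᶠ k in U, ((tupleAtom hM s).at hG k).E i j ↔ s.1 i = s.1 j := by
    filter_upwards [(tupleAtom hM s).eventually_at] with k hk
    rw [hk.1]
    exact ULift.down_inj
  exact (eventually_congr h).trans (by simp [diagSet])

theorem den_sub (τ : Fin (m + 1) → Fin (m + 1)) :
    den hM (fun k => (cm.{u} (std m)).una (.sub trivial τ) (X k)) =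
      subSet (Tuples.{u} m) τ (den hM X) := by
  refine Set.ext fun s => ?_
  rw [mem_subSet]
  have h : tupleAtom hM ⟨s.1 ∘ τ, comp_mem_genSpace s.2 τ⟩ = (tupleAtom hM s).comp τ :=
    typ_comp (hM := hM) (ULift.down ∘ s.1) τ
  have h2 : ∀ᶠ k in U, (⟨((tupleAtom hM s).at hG k).comp τ⟩ : ULift.{u} (std m).Atom) ∈ X k ↔
      ⟨(tupleAtom hM ⟨s.1 ∘ τ, comp_mem_genSpace s.2 τ⟩).at hG k⟩ ∈ X k := by
    filter_upwards [(tupleAtom hM s).eventually_at_comp τ] with k hk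
    rw [h, hk]
  exact eventually_congr h2

theorem mem_den_singleton {b : (germ hG).Atom} {s : Tuples.{u} m} :
    s ∈ den hM (fun k => {⟨b.at hG k⟩}) ↔ tupleAtom hM s = b :=
  (eventually_congr (.of_forall fun _ => ULift.up_inj)).trans Atom.eq_iff.symm

theorem mem_den_of_eq {s t : Tuples.{u} m} (h : tupleAtom hM s = tupleAtom hM t)
    (hs : s ∈ den hM X) : t ∈ den hM X := by
  unfold den at hs ⊢
  rwa [Set.mem_ofPred_eq, h] at hs

variable {m : ℕ} {U : Ultrafilter ℕ} {I : (ℕ → Set (ULift.{u} (std m).Atom)) → Prop}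
  (hI : SeqClosed U I) {M : Pos m ℕ → LabelGerm U I} (hM : (germ hI.germClosed).Valid M)

variable (hhom : (germ hI.germClosed).Homogeneous M) {X Y : ℕ → Set (ULift.{u} (std m).Atom)}
include hhom

theorem exists_tupleAtom (hm : 0 < m) (b : (germ hI.germClosed).Atom) :
    ∃ s : Tuples.{u} m, tupleAtom hM s = b := by
  obtain ⟨s, hs⟩ := exists_realizes_univ hm hhom b
  exact ⟨⟨fun i => ⟨s i⟩, mem_tuples _⟩, typ_eq hs⟩

/-- `mem_cyl_iff` provides the type of a witness, and homogeneity of `M` realizes it by changing the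
coordinate `i` alone. -/
theorem den_cyl (i : Fin (m + 1)) (hX : I X) :
    den hM (fun k => (cm.{u} (std m)).una (.cyl i) (X k)) =
      cylSet (Tuples.{u} m) i (den hM X) := by
  refine Set.ext fun s => (hI.mem_cyl_iff i hX (tupleAtom hM s)).trans ⟨?_, ?_⟩
  · rintro ⟨b, hab, hb⟩
    obtain ⟨z, hz⟩ := hhom (ULift.down ∘ s.1) {i}ᶜ i b (by simp) hab
    have hJ : insert i {i}ᶜ = (Set.univ : Set (Fin (m + 1))) := by
      ext j; simp [em]
    rw [hJ] at hz
    let t : Tuples.{u} m :=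
      ⟨fun j => ⟨Function.update (ULift.down ∘ s.1) i z j⟩, mem_tuples _⟩
    have ht : tupleAtom hM t = b := typ_eq hz
    refine ⟨t, ?_, fun j hj => ULift.ext _ _ (Function.update_of_ne hj _ _)⟩
    unfold den
    rwa [Set.mem_ofPred_eq, ht]
  · rintro ⟨t, ht, hst⟩
    exact ⟨tupleAtom hM t, typ_agree fun j hj => congrArg ULift.down (hst j hj).symm, ht⟩

/-- If inclusion failed for almost all indices, the difference would contain an atom over germs, and
that atom is realized by a tuple. -/
theorem den_subset (hm : 0 < m) (hX : I X) (hY : I Y) (h : den hM X ⊆ den hM Y) :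
    ∀ᶠ k in U, X k ⊆ Y k := by
  by_contra hc
  rw [← Ultrafilter.eventually_not] at hc
  obtain ⟨b, hb⟩ := hI.exists_atom_mem (hI.inter hX (hI.compl hY)) (hc.mono fun k hk => by
    obtain ⟨a, h1, h2⟩ := Set.not_subset.1 hk
    exact ⟨a, h1, h2⟩)
  obtain ⟨s, rfl⟩ := exists_tupleAtom hI hM hhom hm b
  obtain ⟨k, hk, hk'⟩ := (hb.and (h (hb.mono fun k hk => hk.1))).exists
  exact hk.2 hk'

theorem den_inj (hm : 0 < m) (hX : I X) (hY : I Y) (h : den hM X = den hM Y) :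
    ∀ᶠ k in U, X k = Y k := by
  filter_upwards [den_subset hI hM hhom hm hX hY h.le, den_subset hI hM hhom hm hY hX h.ge]
    with k h1 h2 using h1.antisymm h2

omit hhom

/-- The represented sets. -/
def denAlg : BooleanSubalgebra (Set (Tuples.{u} m)) where
  carrier := {Z | ∃ X, I X ∧ den hM X = Z}
  supClosed' := by
    rintro _ ⟨X, hX, rfl⟩ _ ⟨Y, hY, rfl⟩
    refine ⟨_, hI.compl (hI.inter (hI.compl hX) (hI.compl hY)), ?_⟩
    rw [den_compl, den_inter, den_compl, den_compl]
    simp [Set.compl_inter]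
  infClosed' := by
    rintro _ ⟨X, hX, rfl⟩ _ ⟨Y, hY, rfl⟩
    exact ⟨_, hI.inter hX hY, den_inter hM⟩
  compl_mem' := by
    rintro _ ⟨X, hX, rfl⟩
    exact ⟨_, hI.compl hX, den_compl hM⟩
  bot_mem' := by
    refine ⟨_, hI.compl hI.univ, ?_⟩
    rw [den_compl, den_univ]
    simp

theorem mem_of_mem_denAlg {Z : Set (Tuples.{u} m)} (hZ : Z ∈ denAlg hI hM) {s t : Tuples.{u} m}
    (h : tupleAtom hM s = tupleAtom hM t) (hs : s ∈ Z) : t ∈ Z := by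
  obtain ⟨X, -, rfl⟩ := hZ
  exact mem_den_of_eq hM h hs

/-- The tuples of a given type form an element of the represented algebra. -/
theorem setOf_tupleAtom_mem (s : Tuples.{u} m) :
    {t | tupleAtom hM t = tupleAtom hM s} ∈ denAlg hI hM :=
  ⟨_, hI.singleton_at (tupleAtom hM s), Set.ext fun _ => mem_den_singleton hM⟩

theorem una_mem_denAlg (hhom : (germ hI.germClosed).Homogeneous M) (o : UnOp .PEA (Fin (m + 1)))
    {Z : Set (Tuples.{u} m)} (hZ : Z ∈ denAlg hI hM) :
    (setAlg .PEA (Tuples.{u} m)).una o Z ∈ denAlg hI hM := by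
  obtain ⟨X, hX, rfl⟩ := hZ
  cases o with
  | cyl i => exact ⟨_, hI.cyl i hX, den_cyl hI hM hhom i hX⟩
  | sub h τ => exact ⟨_, hI.sub τ hX, den_sub hM τ⟩
  | repl h _ _ => exact h.elim
  | swap h _ _ => exact h.elim

theorem nul_mem_denAlg (hd : ∀ i j, I fun _ => (cm.{u} (std m)).nul (.diag trivial i j))
    (o : NulOp .PEA (Fin (m + 1))) :
    (setAlg .PEA (Tuples.{u} m)).nul o ∈ denAlg hI hM := by
  cases o with
  | diag h i j => exact ⟨_, hd i j, den_diag hM i j⟩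

/-- An atomic algebra of sets closed under types. -/
theorem isAtomic_denAlg : IsAtomic (denAlg hI hM) := by
  refine ⟨fun Z => or_iff_not_imp_left.2 fun hZ => ?_⟩
  have : Z.1.Nonempty := Set.nonempty_iff_ne_empty.2 fun h => hZ (Subtype.ext h)
  obtain ⟨s, hs⟩ := this
  refine ⟨⟨_, setOf_tupleAtom_mem hI hM s⟩, ⟨fun h => ?_, fun Y hY => ?_⟩, ?_⟩
  · have : s ∈ (∅ : Set (Tuples.{u} m)) := (congrArg Subtype.val h).le rfl
    exact this
  · by_contra hne
    have : Y.1.Nonempty := Set.nonempty_iff_ne_empty.2 fun h => hne (Subtype.ext h)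
    obtain ⟨t, ht⟩ := this
    have hts : tupleAtom hM t = tupleAtom hM s := hY.le ht
    exact hY.not_ge fun t' (ht' : tupleAtom hM t' = tupleAtom hM s) =>
      mem_of_mem_denAlg hI hM Y.2 (hts.trans ht'.symm) ht
  · exact fun t (ht : tupleAtom hM t = tupleAtom hM s) => mem_of_mem_denAlg hI hM Z.2 ht.symm hs

/-- If some `s` in the supremum belonged to no member of `T`, the complement of the type of `s`
would be an upper bound that excludes `s`. -/
theorem isLUB_denAlg {T : Set (denAlg hI hM)} {Z : denAlg hI hM} (hZ : IsLUB T Z) :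
    Z.1 = ⋃ Y ∈ T, Y.1 := by
  refine Set.Subset.antisymm (fun s hs => ?_) (Set.iUnion₂_subset fun Y hY => hZ.1 hY)
  by_contra hc
  let C : denAlg hI hM := ⟨_, setOf_tupleAtom_mem hI hM s⟩
  have hub : Cᶜ ∈ upperBounds T := by
    intro Y hY t ht (hts : tupleAtom hM t = tupleAtom hM s)
    exact hc (Set.mem_iUnion₂.2 ⟨Y, hY, mem_of_mem_denAlg hI hM Y.2 hts ht⟩)
  exact hZ.2 hub hs rfl

end LabelSys

theorem sub_rd_completelyRepresentable {α : Type} [DecidableEq α] {W : Type u}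
    {𝒰 : Set (Set W)} (h𝒰 : 𝒰.PairwiseDisjoint id)
    (L : BooleanSubalgebra (Set (genSpace α 𝒰)))
    (hu : ∀ o, ∀ x ∈ L, (setAlg .PEA (genSpace α 𝒰)).una o x ∈ L)
    (hn : ∀ o, (setAlg .PEA (genSpace α 𝒰)).nul o ∈ L)
    (hL : ∀ (T : Set L) (Z : L), IsLUB T Z → Z.1 = ⋃ Y ∈ T, Y.1) (K : Kind) :
    ((setAlg .PEA (genSpace α 𝒰)).sub L hu hn).rd K ∈ CompletelyRepresentable.{u} K α := by
  refine ⟨W, 𝒰, h𝒰, fun Z => Z.1, ⟨Subtype.val_injective, rfl, rfl, fun _ _ => rfl, fun _ _ => rfl,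
    fun _ => rfl, fun o Z => ?_, fun o => ?_⟩, hL⟩
  · cases o <;> rfl
  · cases o; rfl

/-! ### The countable algebra equivalent to the standard one -/

open Filter FirstOrder FirstOrder.Language

instance (m : ℕ) : Countable (lang .PEA (Fin m)).Symbols := by
  have : Countable (UnOp .PEA (Fin m)) := by
    refine Function.Surjective.countable
      (f := fun x : Fin m ⊕ (Fin m → Fin m) => x.elim UnOp.cyl (UnOp.sub trivial)) fun o => ?_
    cases o with
    | cyl i => exact ⟨.inl i, rfl⟩
    | sub h τ => exact ⟨.inr τ, rfl⟩
    | repl h _ _ => exact h.elim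
    | swap h _ _ => exact h.elim
  have : Countable (NulOp .PEA (Fin m)) := by
    refine Function.Surjective.countable
      (f := fun x : Fin m × Fin m => NulOp.diag trivial x.1 x.2) fun o => ?_
    cases o with
    | diag h i j => exact ⟨(i, j), rfl⟩
  have : Countable (Σ n, (lang .PEA (Fin m)).Functions n) := by
    let f : UnOp .PEA (Fin m) ⊕ NulOp .PEA (Fin m) ⊕ Fin 5 → Σ n, Fn .PEA (Fin m) n
      | .inl o => ⟨1, .una o⟩
      | .inr (.inl o) => ⟨0, .nul o⟩
      | .inr (.inr i) => ![⟨0, .bot⟩, ⟨0, .top⟩, ⟨1, .compl⟩, ⟨2, .sup⟩, ⟨2, .inf⟩] i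
    refine Function.Surjective.countable (f := f) ?_
    rintro ⟨n, o⟩
    cases o with
    | bot => exact ⟨.inr (.inr 0), rfl⟩
    | top => exact ⟨.inr (.inr 1), rfl⟩
    | compl => exact ⟨.inr (.inr 2), rfl⟩
    | sup => exact ⟨.inr (.inr 3), rfl⟩
    | inf => exact ⟨.inr (.inr 4), rfl⟩
    | nul o => exact ⟨.inr (.inl o), rfl⟩
    | una o => exact ⟨.inl o, rfl⟩
  have : IsEmpty (Σ n, (lang .PEA (Fin m)).Relations n) := ⟨fun r => r.2.elim⟩
  exact inferInstanceAs (Countable ((Σ n, (lang .PEA (Fin m)).Functions n) ⊕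
    Σ n, (lang .PEA (Fin m)).Relations n))

namespace LabelSys

variable {m : ℕ}

instance : Infinite (cm.{u} (std m)) :=
  Infinite.of_injective (fun d => ({codeAtom m d} : Set (ULift.{u} (std m).Atom)))
    fun _ _ h => codeAtom_inj.1 (Set.singleton_injective h)

/-- The operations on the standard algebra used in the construction of atoms over germs. -/
def ops (m : ℕ) : Set (Set (ULift.{u} (std m).Atom) → Set (ULift.{u} (std m).Atom) →
    Set (ULift.{u} (std m).Atom)) :=
  {fun X _ => pickSet X, insertSet} ∪ Set.range (fun p X _ => labelSet p X) ∪
    Set.range (fun p X _ => selectSet p X) ∪ Set.range (fun E _ _ => patternSet E) ∪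
    Set.range fun d _ _ => {codeAtom m d}

theorem countable_ops : (ops.{u} m).Countable := by
  have := finite_pos (m := m) (Fin (m + 1))
  refine ((((Set.countable_insert.2 (Set.countable_singleton _)).union ?_).union ?_).union
    ?_).union ?_
  all_goals exact Set.countable_range _

variable {U : Ultrafilter ℕ}

theorem ultraMk_out {A : Type u} (x : (U : Filter ℕ).Product fun _ => A) :
    ultraMk U (Quotient.out x) = x := Quotient.out_eq x

section Substructure

variable {L : FirstOrder.Language.{0, 0}} {A : Type u} [L.Structure A]
  (S : L.ElementarySubstructure ((U : Filter ℕ).Product fun _ => A))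

theorem ultraMk_funMap_mem {n : ℕ} (f : L.Functions n) {X : Fin n → ℕ → A}
    (hX : ∀ i, ultraMk U (X i) ∈ S) :
    ultraMk U (fun k => Structure.funMap f fun i => X i k) ∈ S := by
  have h : (Structure.funMap f fun i => ultraMk U (X i)) =
      ultraMk U fun k => Structure.funMap f fun i => X i k := Ultraproduct.funMap_cast f X
  exact h ▸ S.toSubstructure.fun_mem f (fun i => ultraMk U (X i)) hX

theorem ultraMk_mem_congr {X Y : ℕ → A} (hX : ultraMk U X ∈ S) (h : ∀ᶠ k in U, X k = Y k) :
    ultraMk U Y ∈ S :=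
  ultraMk_eq.2 h ▸ hX

theorem ultraMk_out_mem (x : S) : ultraMk U (Quotient.out x.1) ∈ S :=
  (ultraMk_out x.1).symm ▸ x.2

/-- The structure on a substructure of the ultrapower is computed pointwise. -/
theorem eventually_out_funMap {n : ℕ} (f : L.Functions n) (v : Fin n → S) :
    ∀ᶠ k in U, Quotient.out (Structure.funMap f v).1 k =
      Structure.funMap f fun i => Quotient.out (v i).1 k := by
  refine ultraMk_eq.1 ((ultraMk_out _).trans ?_)
  have h : (Structure.funMap f v).1 = Structure.funMap f fun i => (v i).1 := rfl
  rw [h, show (fun i => (v i).1) = fun i => ultraMk U (Quotient.out (v i).1) from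
    funext fun i => (ultraMk_out _).symm]
  exact Ultraproduct.funMap_cast f _

end Substructure

/-- The sequences representing elements of a subset of the ultrapower. -/
def SeqMem (S : (lang .PEA (Fin (m + 1))).ElementarySubstructure
      ((U : Filter ℕ).Product fun _ => cm.{u} (std m))) (X : ℕ → Set (ULift.{u} (std m).Atom)) :
    Prop :=
  ultraMk (M := cm.{u} (std m)) U X ∈ S

variable {S : (lang .PEA (Fin (m + 1))).ElementarySubstructure
  ((U : Filter ℕ).Product fun _ => cm.{u} (std m))}

theorem seqClosed_of_mem
    (hseed : ∀ X ∈ Set.range fun (z : ℤ) (k : ℕ) =>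
      ({codeAtom m ((k : ℤ) + m - z).toNat} : Set (ULift.{u} (std m).Atom)), SeqMem S X)
    (hops : ∀ t ∈ ops.{u} m, ∀ X Y, SeqMem S X → SeqMem S Y → SeqMem S fun k => t (X k) (Y k)) :
    SeqClosed U (SeqMem S) := by
  have htop : SeqMem S fun _ => Set.univ :=
    ultraMk_funMap_mem S (Fn.top : (lang .PEA (Fin (m + 1))).Functions 0)
      (X := fun _ _ => (⊤ : cm.{u} (std m))) fun i => i.elim0
  have hops₁ : ∀ {t : Set (ULift.{u} (std m).Atom) → Set (ULift.{u} (std m).Atom)},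
      (fun X _ => t X) ∈ ops.{u} m → ∀ {X}, SeqMem S X → SeqMem S fun k => t (X k) :=
    fun ht X hX => hops _ ht X X hX hX
  refine ⟨fun {X Y} hX h => ?_, fun {X Y} hX hY => ?_, fun {X} hX => ?_, fun i X hX => ?_,
    fun τ X hX => ?_, hops₁ (by simp [ops]), fun p => hops₁ (by simp [ops]),
    fun p => hops₁ (by simp [ops]), fun E => hops₁ (t := fun _ => patternSet E) (by simp [ops]) htop,
    fun d => hops₁ (t := fun _ => {codeAtom m d}) (by simp [ops]) htop,
    hops _ (by simp [ops]) _ _, fun z => hseed _ ⟨z, rfl⟩⟩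
  · exact ultraMk_mem_congr S hX h
  · exact ultraMk_funMap_mem S (Fn.inf : (lang .PEA (Fin (m + 1))).Functions 2)
      (X := ![X, Y]) fun i => by fin_cases i <;> assumption
  · exact ultraMk_funMap_mem S (Fn.compl : (lang .PEA (Fin (m + 1))).Functions 1)
      (X := fun _ => X) fun i => hX
  · exact ultraMk_funMap_mem S (Fn.una (.cyl i) : (lang .PEA (Fin (m + 1))).Functions 1)
      (X := fun _ => X) fun i => hX
  · exact ultraMk_funMap_mem S (Fn.una (.sub trivial τ) : (lang .PEA (Fin (m + 1))).Functions 1)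
      (X := fun _ => X) fun i => hX

theorem seqMem_nul (o : NulOp .PEA (Fin (m + 1))) : SeqMem S fun _ => (cm.{u} (std m)).nul o :=
  ultraMk_funMap_mem S (Fn.nul o : (lang .PEA (Fin (m + 1))).Functions 0)
    (X := fun _ _ => (⊤ : cm.{u} (std m))) fun i => i.elim0

theorem countable_labelGerm [Countable S] : Countable (LabelGerm U (SeqMem S)) := by
  refine Function.Injective.countable
    (f := fun d : LabelGerm U (SeqMem S) => (⟨_, d.rep_mem⟩ : S)) fun d d' h => Subtype.ext ?_
  have h := ultraMk_eq.1 (congrArg Subtype.val h)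
  rw [← d.2.choose_spec.1, ← d'.2.choose_spec.1]
  exact Germ.coe_eq.2 (h.mono fun k hk => codeAtom_inj.1 (Set.singleton_injective hk))

/-- There is a countable atomic algebra elementarily equivalent to the standard one, all of whose
reducts are completely representable. -/
theorem exists_elementarilyEquivalent_representable (hm : 2 ≤ m) :
    ∃ B ∈ PEA.{u} (m + 1), Countable B ∧ IsAtomic B ∧
      (lang .PEA (Fin (m + 1))).ElementarilyEquivalent (cm.{u} (std m)) B ∧
      ∀ K, B.rd K ∈ CompletelyRepresentable.{u} K (Fin (m + 1)) := by
  obtain ⟨S, hS, hseed, hops⟩ := exists_countable_elementary (lang .PEA (Fin (m + 1)))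
    (M := cm.{u} (std m)) (hyperfilter ℕ) (countable_ops (m := m))
    (Set.countable_range fun (z : ℤ) (k : ℕ) =>
      ({codeAtom m ((k : ℤ) + m - z).toNat} : Set (ULift.{u} (std m).Atom)))
  have hI : SeqClosed (hyperfilter ℕ) (SeqMem S) := seqClosed_of_mem hseed hops
  have := countable_labelGerm (S := S)
  obtain ⟨h, hh⟩ := germ_exists_descending hI.germClosed Nat.hyperfilter_le_atTop
  obtain ⟨b₀, -⟩ := hI.exists_atom_mem hI.univ (.of_forall fun k => ⟨codeAtom m 0, trivial⟩)
  obtain ⟨M, hM, hhom⟩ := exists_homogeneous hm hh b₀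
  have h𝒰 : ({Set.univ} : Set (Set (ULift.{u} ℕ))).PairwiseDisjoint id :=
    Set.pairwiseDisjoint_singleton _ _
  have hu := fun o Z (hZ : Z ∈ denAlg hI hM) => una_mem_denAlg hI hM hhom o hZ
  have hn := fun o => nul_mem_denAlg hI hM (fun i j => seqMem_nul _) o
  have : Nontrivial (Fin (m + 1)) := Fin.nontrivial_iff_two_le.2 (by omega)
  let B : Alg.{u} .PEA (Fin (m + 1)) :=
    (setAlg .PEA (Tuples.{u} m)).sub (denAlg hI hM) hu hn
  have hout : ∀ x : S, SeqMem S (Quotient.out x.1) := ultraMk_out_mem S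
  -- An element of the ultrapower is sent to the set of tuples denoted by a representing sequence;
  -- the choice of sequence does not matter by `den_congr`.
  let g : S → B := fun x => ⟨den hM (Quotient.out x.1), _, hout x, rfl⟩
  have hg : Function.Bijective g := by
    constructor
    · intro x y hxy
      have := den_inj hI hM hhom (by omega) (hout x) (hout y) (congrArg Subtype.val hxy)
      refine Subtype.ext ?_
      exact (ultraMk_out x.1).symm.trans ((ultraMk_eq.2 this).trans (ultraMk_out y.1))
    · rintro ⟨_, X, hX, rfl⟩
      exact ⟨⟨_, hX⟩, Subtype.ext (den_congr hM (ultraMk_eq.1 (ultraMk_out _)))⟩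
  let e : S ≃[lang .PEA (Fin (m + 1))] B :=
    { Equiv.ofBijective g hg with
      map_fun' := fun {n} f v => by
        refine Subtype.ext ((den_congr hM (eventually_out_funMap S f v)).trans ?_)
        cases f with
        | bot => exact den_empty hM
        | top => exact den_univ hM
        | compl => exact den_compl hM
        | sup => exact den_union hM
        | inf => exact den_inter hM
        | nul o => cases o with
          | diag h i j => exact den_diag hM i j
        | una o => cases o with
          | cyl i => exact den_cyl hI hM hhom i (hout _)
          | sub h τ => exact den_sub hM τ
          | repl h _ _ => exact h.elim
          | swap h _ _ => exact h.elim
      map_rel' := fun r => r.elim }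
  refine ⟨B, Alg.sub_mem_PEA (setAlg_pea h𝒰) _ hu hn, hg.surjective.countable,
    isAtomic_denAlg hI hM, ?_, fun K => sub_rd_completelyRepresentable h𝒰 _ hu hn
      (fun T Z hZ => isLUB_denAlg hI hM hZ) K⟩
  refine elementarilyEquivalent_iff.2 fun φ => ?_
  -- Truth passes from `B` along the isomorphism to `S`, from there to the ultrapower, and by Łoś's
  -- theorem to the standard algebra.
  rw [← StrongHomClass.realize_sentence e φ, S.realize_sentence, Ultraproduct.sentence_realize,
    eventually_const]

end LabelSys

end CylAlg

/-! ### The theorem -/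

theorem mainTheorem6 (n : ℕ) (hn : 3 ≤ n) :
    (∃ A ∈ CylAlg.PEA.{u} n,
      IsAtomic A ∧ {a : A | IsAtom a}.Countable ∧
      A.rdSc ∉ CylAlg.ScNr (Fin.castAddEmb 3) (CylAlg.Sc.{u} (Fin (n + 3))) ∧
      ∃ B ∈ CylAlg.PEA.{u} n,
        Countable B ∧ IsAtomic B ∧
        B.rdQEA ∈ CylAlg.ScNr Fin.valEmbedding (CylAlg.QEA.{u} ℕ) ∧
        (CylAlg.lang .PEA (Fin n)).ElementarilyEquivalent A B) ∧
    (∀ 𝒦 : Set (CylAlg.Alg.{u} .CA (Fin n)),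
      CylAlg.ScNr Fin.valEmbedding (CylAlg.CA.{u} ℕ) ⊆ 𝒦 →
      𝒦 ⊆ CylAlg.ScNr (Fin.castAddEmb 3) (CylAlg.CA.{u} (Fin (n + 3))) →
      ¬ CylAlg.IsElementary 𝒦) ∧
    (∀ K ∈ ({.CA, .QA, .QEA, .Sc} : Set CylAlg.Kind),
      ¬ CylAlg.IsElementary (CylAlg.CompletelyRepresentable.{u} K (Fin n))) := by
  obtain ⟨m, rfl⟩ : ∃ m, n = m + 1 := ⟨n - 1, by omega⟩
  have hm : 2 ≤ m := by omega
  have : Nontrivial (Fin (m + 1)) := Fin.nontrivial_iff_two_le.2 (by omega)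
  obtain ⟨B, hB, hBc, hBa, hAB, hBr⟩ :=
    CylAlg.LabelSys.exists_elementarilyEquivalent_representable.{u} hm
  refine ⟨⟨CylAlg.LabelSys.cm (CylAlg.LabelSys.std m), CylAlg.LabelSys.cm_mem_PEA,
    CylAlg.LabelSys.cm_isAtomic _, CylAlg.LabelSys.countable_atoms_cm _, ?_, B, hB, hBc, hBa, ?_, hAB⟩,
    fun 𝒦 h1 h2 h𝒦 => ?_,
    fun K hK h𝒦 => ?_⟩
  · rw [← CylAlg.rd_Sc]
    exact CylAlg.LabelSys.cm_std_rd_Sc_notMem hm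
  · rw [← CylAlg.rd_QEA]
    exact CylAlg.CompletelyRepresentable.mem_scNr (K := .QEA) (fun h => h.elim) _
      (fun U 𝒰 h𝒰 => CylAlg.setAlg_mem_QEA h𝒰) (hBr .QEA)
  -- An elementary class between the two bounds contains the reduct of `B`, hence that of the
  -- standard algebra, which the upper bound excludes.
  · refine CylAlg.LabelSys.cm_std_rd_CA_notMem hm (h2 (h𝒦.rd_mem hAB (h1 ?_)))
    exact CylAlg.CompletelyRepresentable.mem_scNr (K := .CA) (fun h => h.elim) _
      (fun U 𝒰 h𝒰 => CylAlg.setAlg_mem_CA h𝒰) (hBr .CA)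
  · refine CylAlg.LabelSys.cm_std_rd_not_completelyRepresentable hm ?_ (h𝒦.rd_mem hAB (hBr K))
    rcases hK with rfl | rfl | rfl | rfl
    exacts [.inr trivial, .inl trivial, .inl trivial, .inl trivial]
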